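/- **Theorem (optimal-size memorization for i.i.d. data).** All networks are feedforward ReLU networks $\mathcal F:\mathbb R^n\to\mathbb R$, $X_0=x$, $X_l=\mathrm{ReLU}(W_lX_{l-1}+b_l)\in\mathbb R^{n_l}$ for $1\le l\le K$, $\mathcal F(x)=W_{K+1}X_K+b_{K+1}$, with depth $K+1$, width $\max_{1\le l\le K} n_l$ and number of parameters $\sum_{i=0}^{K}n_i(n_{i+1}+1)$, where $n_0=n$ and $n_{K+1}=1$. For $n\ge 1$ and $c>0$ let $\mathcal D(n,c)$ be the set of probability distributions $\mathcal D$ on $[0,1]^n\times\{-1,1\}$ with separation bound $c$: for independent $(x,y),(z,y')\sim\mathcal D$, almost surely $\|x-z\|_2\ge c$ whenever $y=1$, $y'=-1$. A dataset is a finite sequence of elements of $[0,1]^n\times\{-1,1\}$ in which no point occurs with both labels; a network $\mathcal F$ memorizes it if $\mathrm{sign}(\mathcal F(x))=y$ for each of its elements $(x,y)$. A memorization algorithm is a map that sends every dataset, of any dimension $n\ge1$ and any size, to a network that memorizes it. There are an absolute constant $C$ and a randomized memorization algorithm $\mathcal L$ (that is, for every outcome $\omega$ of an infinite sequence of independent fair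 coin tosses, $\mathcal L_\omega$ is a memorization algorithm) such that the following hold. 1. For all $n,N\ge1$, $c>0$ and $\mathcal D\in\mathcal D(n,c)$, with probability $1$ over an i.i.d. sample $\mathcal D_{tr}\sim\mathcal D^N$, for every $\omega$ the network $\mathcal L_\omega(\mathcal D_{tr})$ has width exactly $6$, depth at most $$C\sqrt N\,\ln\!\big(\max\{2,\,Nn/c\}\big),$$ and number of parameters at most $7n+C\sqrt N\,\ln(\max\{2,Nn/c\})$. 2. $\mathcal L$ is computable by a Monte Carlo polynomial-time algorithm: there are a program $P$ for a probabilistic random access machine with logarithmic (bit) cost and a polynomial $p$ in two variables such that, for all $n,N\ge1$, every dataset $\mathcal D_{tr}$ of $N$ points of $[0,1]^n\times\{-1,1\}$ with rational coordinates, and every $\epsilon\in(0,1)$, the program $P$ on input $\mathcal D_{tr}$ and $\lceil\log_2(1/\epsilon)\rceil$ halts, whatever the coin tosses, in time at most $p(\mathrm{size}(\mathcal D_{tr}),\ln(1/\epsilon))$, where $\mathrm{size}(\mathcal D_{tr})$ is the bit-size of $\mathcal D_{tr}$; and, with probability at least $1-\epsilon$ over the coin tosses $\omega$ of the program, its output is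 (the list of the weights of) the network $\mathcal L_\omega(\mathcal D_{tr})$, all of whose weights are then rational. -/

import Mathlib

open MeasureTheory

noncomputable section

/-! ### Feedforward ReLU networks -/

/-- `Network K n`: a fully connected feedforward network with inputs in `K ^ n` and one output.
`out W b` is the last, affine layer; `hidden k W b G` is a hidden layer `x ↦ ReLU (W x + b)` with
`k` nodes, followed by the network `G`. -/
inductive Network (K : Type) : ℕ → Type
  | out {m : ℕ} (W : Fin m → K) (b : K) : Network K m
  | hidden {m : ℕ} (k : ℕ) (W : Fin k → Fin m → K) (b : Fin k → K) (G : Network K k) : Network K m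

namespace Network

/-- The function computed by a network. -/
def eval : {n : ℕ} → Network ℝ n → (Fin n → ℝ) → ℝ
  | _, out W b, x => (∑ j, W j * x j) + b
  | _, hidden _ W b G, x => G.eval fun i => max 0 ((∑ j, W i j * x j) + b i)

/-- The number of hidden layers plus one. -/
def depth {K : Type} : {n : ℕ} → Network K n → ℕ
  | _, out _ _ => 1
  | _, hidden _ _ _ G => G.depth + 1

/-- The largest number of nodes in a hidden layer (`0` if there is none). -/
def width {K : Type} : {n : ℕ} → Network K n → ℕ
  | _, out _ _ => 0
  | _, hidden k _ _ G => max k G.width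

/-- `∑ n_i * (n_{i+1} + 1)`, the sum over all layers, where `n_0` is the input dimension, `n_i` the
number of nodes of the `i`-th hidden layer, and the output has dimension `1`. -/
def numParams {K : Type} : {n : ℕ} → Network K n → ℕ
  | n, out _ _ => n * (1 + 1)
  | n, hidden k _ _ G => n * (k + 1) + G.numParams

/-- A network with rational weights, seen as a network with real weights. -/
def toReal : {n : ℕ} → Network ℚ n → Network ℝ n
  | _, out W b => out (fun j => (W j : ℝ)) (b : ℝ)
  | _, hidden k W b G => hidden k (fun i j => (W i j : ℝ)) (fun i => (b i : ℝ)) G.toReal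

/-- A rational number is written as its numerator followed by its denominator. -/
def ratCode (q : ℚ) : List ℤ := [q.num, (q.den : ℤ)]

/-- A network with rational weights written as a list of integers: layer by layer, a hidden layer
as `1`, its number of nodes, and for each node its weights and its bias; the last layer as `0`, its
weights and its bias. -/
def encode : {n : ℕ} → Network ℚ n → List ℤ
  | n, out W b => 0 :: ((List.finRange n).flatMap (fun j => ratCode (W j)) ++ ratCode b)
  | n, hidden k W b G =>
      1 :: (k : ℤ) ::
        ((List.finRange k).flatMap (fun i =>
          (List.finRange n).flatMap (fun j => ratCode (W i j)) ++ ratCode (b i)) ++ G.encode)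

end Network

/-! ### Data, distributions, memorization -/

/-- A labelled point: a vector (with the Euclidean distance) and a real label. -/
abbrev LabelledPoint (n : ℕ) : Type := EuclideanSpace ℝ (Fin n) × ℝ

/-- `[0,1]^n × {-1,1}`. -/
def dataSpace (n : ℕ) : Set (LabelledPoint n) :=
  {p | (∀ j, p.1 j ∈ Set.Icc (0 : ℝ) 1) ∧ (p.2 = -1 ∨ p.2 = 1)}

/-- The class `𝒟(n,c)`: probability distributions on `[0,1]^n × {-1,1}` with separation bound `c`,
that is, two independent samples with labels `1` and `-1` have, almost surely, distance at
least `c`. -/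
structure IsSeparatedDistribution (n : ℕ) (c : ℝ) (D : Measure (LabelledPoint n)) : Prop where
  isProbabilityMeasure : IsProbabilityMeasure D
  ae_mem_dataSpace : ∀ᵐ p ∂D, p ∈ dataSpace n
  ae_separated : ∀ᵐ q ∂(D.prod D), q.1.2 = 1 → q.2.2 = -1 → c ≤ dist q.1.1 q.2.1

/-- A dataset over `[0,1]^n × {-1,1}`, listed with repetitions allowed, in which no point occurs
with both labels (otherwise it has no memorization). -/
def IsDataset {n N : ℕ} (s : Fin N → LabelledPoint n) : Prop :=
  (∀ i, s i ∈ dataSpace n) ∧ ∀ i j, (s i).1 = (s j).1 → (s i).2 = (s j).2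

/-- The network `F` memorizes the dataset `s`. -/
def Memorizes {n N : ℕ} (F : Network ℝ n) (s : Fin N → LabelledPoint n) : Prop :=
  ∀ i, Real.sign (F.eval fun j => (s i).1 j) = (s i).2

/-- A map from datasets (of any dimension and any size) to networks. -/
abbrev LearningMap : Type := (n N : ℕ) → (Fin N → LabelledPoint n) → Network ℝ n

/-- A memorization algorithm maps every dataset to a network that memorizes it. -/
def IsMemorizationAlgorithm (L : LearningMap) : Prop :=
  ∀ n N : ℕ, 0 < n → ∀ s : Fin N → LabelledPoint n, IsDataset s → Memorizes (L n N s) s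

/-! ### A random access machine with coin tosses and logarithmic cost

The memory consists of finitely many (those named in the program) arrays of integers with integer
indices. Every operation costs the total bit-size of the numbers and indices that it handles, so
that running times agree with those of probabilistic Turing machines up to a polynomial. -/

/-- Number of bits of an integer, with one bit for the sign. -/
def bitSize (z : ℤ) : ℕ := Nat.size z.natAbs + 1

/-- `M a i` is the entry with index `i` of the array `a`. -/
abbrev Memory : Type := ℕ → ℤ → ℤ

/-- Arithmetic expressions. `read a i` is the entry of the array `a` with index `i`, and `div` is
integer division. -/
inductive Expr
  | lit (z : ℤ)
  | read (a : ℕ) (i : Expr)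
  | add (e₁ e₂ : Expr)
  | sub (e₁ e₂ : Expr)
  | mul (e₁ e₂ : Expr)
  | div (e₁ e₂ : Expr)

namespace Expr

/-- The value of an expression. -/
def val (M : Memory) : Expr → ℤ
  | lit z => z
  | read a i => M a (i.val M)
  | add e₁ e₂ => e₁.val M + e₂.val M
  | sub e₁ e₂ => e₁.val M - e₂.val M
  | mul e₁ e₂ => e₁.val M * e₂.val M
  | div e₁ e₂ => e₁.val M / e₂.val M

/-- The time for evaluating an expression: every operation costs the bit-size of its operands,
every access to the memory costs the bit-size of the index and of the entry. -/
def cost (M : Memory) : Expr → ℕ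
  | lit z => bitSize z
  | read a i => i.cost M + bitSize (i.val M) + bitSize (M a (i.val M))
  | add e₁ e₂ => e₁.cost M + e₂.cost M + bitSize (e₁.val M) + bitSize (e₂.val M)
  | sub e₁ e₂ => e₁.cost M + e₂.cost M + bitSize (e₁.val M) + bitSize (e₂.val M)
  | mul e₁ e₂ => e₁.cost M + e₂.cost M + bitSize (e₁.val M) + bitSize (e₂.val M)
  | div e₁ e₂ => e₁.cost M + e₂.cost M + bitSize (e₁.val M) + bitSize (e₂.val M)

end Expr

/-- Programs. `write a i e` stores the value of `e` in the array `a` at index `i`; `flip a i` stores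
there the result of a coin toss (`0` or `1`); `ite e p q` runs `p` if `e > 0`, otherwise `q`;
`loop e p` repeats `p` as long as `e > 0`. -/
inductive Prog
  | skip
  | write (a : ℕ) (i e : Expr)
  | flip (a : ℕ) (i : Expr)
  | seq (p q : Prog)
  | ite (e : Expr) (p q : Prog)
  | loop (e : Expr) (p : Prog)

/-- The memory and the number of coin tosses used so far. -/
structure MachineState where
  mem : Memory
  tosses : ℕ

/-- Change of one entry of the memory. -/
def Memory.set (M : Memory) (a : ℕ) (i v : ℤ) : Memory :=
  fun a' i' => if a' = a ∧ i' = i then v else M a' i'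

/-- `Exec ω p s t s'`: when the coin tosses have the results `ω 0, ω 1, …`, the program `p`, started
in the state `s`, halts after time `t` in the state `s'`. -/
inductive Exec (ω : ℕ → Bool) : Prog → MachineState → ℕ → MachineState → Prop
  | skip (s : MachineState) : Exec ω Prog.skip s 1 s
  | write (a : ℕ) (i e : Expr) (s : MachineState) :
      Exec ω (Prog.write a i e) s
        (i.cost s.mem + e.cost s.mem + bitSize (i.val s.mem) + bitSize (e.val s.mem) + 1)
        ⟨s.mem.set a (i.val s.mem) (e.val s.mem), s.tosses⟩
  | flip (a : ℕ) (i : Expr) (s : MachineState) :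
      Exec ω (Prog.flip a i) s (i.cost s.mem + bitSize (i.val s.mem) + 1)
        ⟨s.mem.set a (i.val s.mem) (if ω s.tosses then 1 else 0), s.tosses + 1⟩
  | seq {p q : Prog} {s s₁ s₂ : MachineState} {t₁ t₂ : ℕ} :
      Exec ω p s t₁ s₁ → Exec ω q s₁ t₂ s₂ → Exec ω (Prog.seq p q) s (t₁ + t₂) s₂
  | ite_pos {e : Expr} {p q : Prog} {s s' : MachineState} {t : ℕ} :
      0 < e.val s.mem → Exec ω p s t s' → Exec ω (Prog.ite e p q) s (e.cost s.mem + t + 1) s'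
  | ite_neg {e : Expr} {p q : Prog} {s s' : MachineState} {t : ℕ} :
      ¬ 0 < e.val s.mem → Exec ω q s t s' → Exec ω (Prog.ite e p q) s (e.cost s.mem + t + 1) s'
  | loop_stop {e : Expr} {p : Prog} {s : MachineState} :
      ¬ 0 < e.val s.mem → Exec ω (Prog.loop e p) s (e.cost s.mem + 1) s
  | loop_step {e : Expr} {p : Prog} {s s₁ s₂ : MachineState} {t₁ t₂ : ℕ} :
      0 < e.val s.mem → Exec ω p s t₁ s₁ → Exec ω (Prog.loop e p) s₁ t₂ s₂ →
        Exec ω (Prog.loop e p) s (e.cost s.mem + t₁ + t₂ + 1) s₂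

/-- The initial state: the input is in the array `0`, at the indices `0, 1, 2, …`, and all other
entries are `0`. -/
def initState (input : List ℤ) : MachineState where
  mem := fun a i => if a = 0 ∧ 0 ≤ i then input.getD i.toNat 0 else 0
  tosses := 0

/-- The output is in the array `1`: its length at index `0`, its entries at the indices
`1, 2, …`. -/
def MachineState.HasOutput (s : MachineState) (l : List ℤ) : Prop :=
  s.mem 1 0 = (l.length : ℤ) ∧ ∀ i : ℕ, i < l.length → s.mem 1 ((i : ℤ) + 1) = l.getD i 0

/-- The law of an infinite sequence of independent tosses of a fair coin. -/
def coinMeasure : Measure (ℕ → Bool) :=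
  Measure.infinitePi fun _ => (PMF.uniformOfFintype Bool).toMeasure

/-! ### Datasets as inputs of the machine -/

/-- `N` labelled points with rational coordinates. -/
abbrev RatData (n N : ℕ) : Type := Fin N → (Fin n → ℚ) × ℤ

namespace RatData

/-- The same points as labelled points with real coordinates. -/
def toReal {n N : ℕ} (T : RatData n N) : Fin N → LabelledPoint n :=
  fun i => (WithLp.toLp 2 fun j => ((T i).1 j : ℝ), ((T i).2 : ℝ))

/-- The bit-size of a dataset. -/
def size {n N : ℕ} (T : RatData n N) : ℕ :=
  ∑ i, (bitSize (T i).2 + ∑ j, (bitSize ((T i).1 j).num + bitSize (((T i).1 j).den : ℤ)))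

/-- The input of the machine: a parameter `k`, the dimension, the number of data, and for each datum
its label and its coordinates. -/
def input {n N : ℕ} (T : RatData n N) (k : ℕ) : List ℤ :=
  (k : ℤ) :: (n : ℤ) :: (N : ℤ) ::
    (List.finRange N).flatMap fun i =>
      (T i).2 :: (List.finRange n).flatMap fun j =>
        [((T i).1 j).num, (((T i).1 j).den : ℤ)]

end RatData

end

/-! The network. Project the points to a line by a vector `w` of nonnegative integers with k bits,
and round down. Suppose that points with different labels have rounded projections at distance at
least 2. Then thresholds on the line separate runs of equal labels, at most N of them matter, and
the label of a point is the parity of the number of thresholds that its projection has passed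
(`exists_threshold_index`). Two layers compare the projection with one threshold, but treating N
thresholds one by one would need depth of order N. Therefore the thresholds form about √N groups of
about 2√N. One pass over the heads of the groups loads an integer that encodes all other thresholds
of the right group into one node. A second pass extracts these thresholds digit by digit and toggles
the output at each one that is passed (`runLayers_memoLayers`). With K digits per threshold this
costs O(√N K) layers of six nodes.

The weights. If two points with different labels have squared distance g, then some coordinate
differs by at least g/n. Given all other weights, at most 4n/g + 1 of the 2^k equally likely values
of that weight bring the rounded projections too close. The number k (`precision`) is computed from
the data so that this has probability at most 1/(2N²); hence a random `w` fails with probability at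
most 1/2 (`measure_badTry_le`). Disjoint blocks of tosses give independent tries, and the algorithm
takes the first success. On the null set where no try succeeds it takes some good vector, which
exists by the probabilistic method (`weights_spec`). Since g ≥ c², the number K is O(log(Nn/c))
(`codeLength_le`). The length of the list of layers depends on the data but not on the tosses, so
the size bounds hold for every outcome.

The machine. A small language of integer terms with bounded loops is compiled once and for all, with
a proof of polynomial running time (`IntTerm.compilesCorrectly`, `exists_prog`). After that it
suffices to write each quantity of the construction as a term, over a common denominator of the data
(`Scope.isList_encode`). The program makes ⌈log₂(1/ε)⌉ tries; unless all of them fail, which has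
probability at most ε, its first successful try is the one of the algorithm. -/

/-! ### Polynomially bounded functions and bit sizes -/

/-- `f` is bounded by a polynomial. -/
def PolyBounded (f : ℕ → ℕ) : Prop := ∃ d : ℕ, ∀ x, f x ≤ (x + 2) ^ d

namespace PolyBounded

theorem const (c : ℕ) : PolyBounded fun _ => c :=
  ⟨c, fun x => (Nat.lt_two_pow_self (n := c)).le.trans (Nat.pow_le_pow_left (by omega) c)⟩

theorem id : PolyBounded fun x => x := ⟨1, fun x => by simp⟩

theorem mul {f g : ℕ → ℕ} (hf : PolyBounded f) (hg : PolyBounded g) :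
    PolyBounded fun x => f x * g x := by
  obtain ⟨d, hd⟩ := hf
  obtain ⟨e, he⟩ := hg
  exact ⟨d + e, fun x => by rw [pow_add]; exact Nat.mul_le_mul (hd x) (he x)⟩

theorem add {f g : ℕ → ℕ} (hf : PolyBounded f) (hg : PolyBounded g) :
    PolyBounded fun x => f x + g x := by
  obtain ⟨d, hd⟩ := hf
  obtain ⟨e, he⟩ := hg
  refine ⟨max d e + 1, fun x => ?_⟩
  have h1 : (x + 2) ^ d ≤ (x + 2) ^ max d e := Nat.pow_le_pow_right (by omega) (le_max_left _ _)
  have h2 : (x + 2) ^ e ≤ (x + 2) ^ max d e := Nat.pow_le_pow_right (by omega) (le_max_right _ _)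
  have := hd x
  have := he x
  calc f x + g x ≤ (x + 2) ^ max d e * 2 := by omega
    _ ≤ (x + 2) ^ max d e * (x + 2) := Nat.mul_le_mul_left _ (by omega)
    _ = _ := (pow_succ _ _).symm

end PolyBounded

theorem bitSize_zero : bitSize 0 = 1 := by simp [bitSize]

theorem bitSize_one : bitSize 1 = 2 := by simp [bitSize]

theorem bitSize_le_of_natAbs_le {a b : ℤ} (h : a.natAbs ≤ b.natAbs) : bitSize a ≤ bitSize b :=
  Nat.add_le_add_right (Nat.size_le_size h) 1

theorem bitSize_le_natAbs_add_one (a : ℤ) : bitSize a ≤ a.natAbs + 1 :=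
  Nat.add_le_add_right (Nat.size_le.2 Nat.lt_two_pow_self) 1

theorem bitSize_neg (a : ℤ) : bitSize (-a) = bitSize a := by simp [bitSize]

/-- Each summand brings its own sign bit. One of the two pays for the sign of the sum, the other for
the carry. -/
theorem bitSize_add_le (a b : ℤ) : bitSize (a + b) ≤ bitSize a + bitSize b := by
  have ha := Nat.lt_size_self a.natAbs
  have hb := Nat.lt_size_self b.natAbs
  have h1 : (2:ℕ) ^ a.natAbs.size ≤ 2 ^ (a.natAbs.size + b.natAbs.size) :=
    Nat.pow_le_pow_right (by norm_num) (by omega)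
  have h2 : (2:ℕ) ^ b.natAbs.size ≤ 2 ^ (a.natAbs.size + b.natAbs.size) :=
    Nat.pow_le_pow_right (by norm_num) (by omega)
  have h3 : (a + b).natAbs < 2 ^ (a.natAbs.size + b.natAbs.size + 1) := by
    rw [pow_succ]
    have := Int.natAbs_add_le a b
    omega
  have := Nat.size_le.2 h3
  simp only [bitSize]
  omega

theorem bitSize_sub_le (a b : ℤ) : bitSize (a - b) ≤ bitSize a + bitSize b := by
  rw [sub_eq_add_neg, ← bitSize_neg b]
  exact bitSize_add_le _ _

theorem bitSize_mul_le (a b : ℤ) : bitSize (a * b) ≤ bitSize a + bitSize b := by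
  have ha := Nat.lt_size_self a.natAbs
  have hb := Nat.lt_size_self b.natAbs
  have h3 : (a * b).natAbs < 2 ^ (a.natAbs.size + b.natAbs.size) := by
    rw [Int.natAbs_mul, pow_add]
    exact Nat.mul_lt_mul'' ha hb
  have := Nat.size_le.2 h3
  simp only [bitSize]
  omega

theorem bitSize_div_le (a b : ℤ) : bitSize (a / b) ≤ bitSize a :=
  bitSize_le_of_natAbs_le (Int.natAbs_ediv_le_natAbs a b)

/-- The modulus m² + 1 is positive for every integer m, so no sign condition is needed and the
remainder lies in [0, m²]. -/
theorem bitSize_emod_le (a m : ℤ) : bitSize (a % (m * m + 1)) ≤ bitSize m + bitSize m := by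
  refine le_trans (bitSize_le_of_natAbs_le (b := m * m) ?_) (bitSize_mul_le m m)
  have h0 : 0 ≤ m * m := mul_self_nonneg m
  have h1 := Int.emod_nonneg a (b := m * m + 1) (by omega)
  have h2 := Int.emod_lt_of_pos a (b := m * m + 1) (by omega)
  omega

/-! ### Cost of expressions and statements -/

namespace Expr

/-- All entries of the memory that are read in the evaluation have at most `b` bits. -/
def Reads (M : Memory) (b : ℕ) : Expr → Prop
  | lit _ => True
  | read a i => i.Reads M b ∧ bitSize (M a (i.val M)) ≤ b
  | add e₁ e₂ => e₁.Reads M b ∧ e₂.Reads M b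
  | sub e₁ e₂ => e₁.Reads M b ∧ e₂.Reads M b
  | mul e₁ e₂ => e₁.Reads M b ∧ e₂.Reads M b
  | div e₁ e₂ => e₁.Reads M b ∧ e₂.Reads M b

/-- The growth rate of the bit size of the value. -/
def weight : Expr → ℕ
  | lit z => bitSize z
  | read _ _ => 1
  | add e₁ e₂ => e₁.weight + e₂.weight
  | sub e₁ e₂ => e₁.weight + e₂.weight
  | mul e₁ e₂ => e₁.weight + e₂.weight
  | div e₁ e₂ => e₁.weight + e₂.weight

/-- The growth rate of the cost. -/
def costWeight : Expr → ℕ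
  | lit z => bitSize z
  | read _ i => i.costWeight + i.weight + 1
  | add e₁ e₂ => e₁.costWeight + e₂.costWeight + e₁.weight + e₂.weight
  | sub e₁ e₂ => e₁.costWeight + e₂.costWeight + e₁.weight + e₂.weight
  | mul e₁ e₂ => e₁.costWeight + e₂.costWeight + e₁.weight + e₂.weight
  | div e₁ e₂ => e₁.costWeight + e₂.costWeight + e₁.weight + e₂.weight

/-- Every operation, even multiplication, at most adds the bit sizes of its operands. So for a fixed
expression the bound is linear in the size of the entries that are read. -/
theorem bitSize_val_le {M : Memory} {b : ℕ} {e : Expr} (h : e.Reads M b) :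
    bitSize (e.val M) ≤ e.weight * (b + 1) := by
  induction e with
  | lit z => simp only [val, weight]; nlinarith
  | read a i => simp only [val, weight]; have := h.2; omega
  | add e₁ e₂ h₁ h₂ =>
    have := bitSize_add_le (e₁.val M) (e₂.val M); have := h₁ h.1; have := h₂ h.2
    simp only [val, weight]; nlinarith
  | sub e₁ e₂ h₁ h₂ =>
    have := bitSize_sub_le (e₁.val M) (e₂.val M); have := h₁ h.1; have := h₂ h.2
    simp only [val, weight]; nlinarith
  | mul e₁ e₂ h₁ h₂ =>
    have := bitSize_mul_le (e₁.val M) (e₂.val M); have := h₁ h.1; have := h₂ h.2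
    simp only [val, weight]; nlinarith
  | div e₁ e₂ h₁ h₂ =>
    have := bitSize_div_le (e₁.val M) (e₂.val M); have := h₁ h.1; have := h₂ h.2
    simp only [val, weight]; nlinarith

theorem cost_le {M : Memory} {b : ℕ} {e : Expr} (h : e.Reads M b) :
    e.cost M ≤ e.costWeight * (b + 1) := by
  induction e with
  | lit z => simp only [cost, costWeight]; nlinarith
  | read a i hi =>
    have := hi h.1; have := bitSize_val_le h.1; have := h.2
    simp only [cost, costWeight]; nlinarith
  | add e₁ e₂ h₁ h₂ | sub e₁ e₂ h₁ h₂ | mul e₁ e₂ h₁ h₂ | div e₁ e₂ h₁ h₂ =>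
    have := h₁ h.1; have := h₂ h.2; have := bitSize_val_le h.1; have := bitSize_val_le h.2
    simp only [cost, costWeight]; nlinarith

end Expr

/-- The program `p` runs from `s` to `s'` in time at most `T`. -/
def Runs (ω : ℕ → Bool) (p : Prog) (s : MachineState) (T : ℕ) (s' : MachineState) : Prop :=
  ∃ t ≤ T, Exec ω p s t s'

namespace Runs

variable {ω : ℕ → Bool} {p q : Prog} {s s₁ s₂ : MachineState} {T T₁ T₂ : ℕ}

theorem mono (h : Runs ω p s T₁ s₁) (hT : T₁ ≤ T₂) : Runs ω p s T₂ s₁ :=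
  let ⟨t, ht, he⟩ := h
  ⟨t, ht.trans hT, he⟩

theorem seq (h₁ : Runs ω p s T₁ s₁) (h₂ : Runs ω q s₁ T₂ s₂) :
    Runs ω (.seq p q) s (T₁ + T₂) s₂ :=
  let ⟨_, ht₁, he₁⟩ := h₁
  let ⟨_, ht₂, he₂⟩ := h₂
  ⟨_, Nat.add_le_add ht₁ ht₂, .seq he₁ he₂⟩

theorem write {a : ℕ} {i e : Expr} {b : ℕ} (hi : i.Reads s.mem b) (he : e.Reads s.mem b) :
    Runs ω (.write a i e) s
      ((i.costWeight + e.costWeight + i.weight + e.weight + 1) * (b + 1))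
      ⟨s.mem.set a (i.val s.mem) (e.val s.mem), s.tosses⟩ := by
  refine ⟨_, ?_, .write a i e s⟩
  have := Expr.cost_le hi
  have := Expr.cost_le he
  have := Expr.bitSize_val_le hi
  have := Expr.bitSize_val_le he
  nlinarith

theorem ite {e : Expr} {b : ℕ} (he : e.Reads s.mem b)
    (h : Runs ω (if 0 < e.val s.mem then p else q) s T s₁) :
    Runs ω (.ite e p q) s (e.costWeight * (b + 1) + T + 1) s₁ := by
  have := Expr.cost_le he
  split_ifs at h with h0 <;> obtain ⟨t, ht, hx⟩ := h
  · exact ⟨_, by omega, .ite_pos h0 hx⟩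
  · exact ⟨_, by omega, .ite_neg h0 hx⟩

/-- The rule for loops with an invariant `I j` that is indexed by the round; the guard has to be
positive exactly before the k-th round. The factor k + 1 also pays for the last, failing test. -/
theorem loop {e : Expr} {b : ℕ} (I : ℕ → MachineState → Prop) (k : ℕ)
    (hcost : ∀ j ≤ k, ∀ s, I j s → e.Reads s.mem b)
    (hpos : ∀ j ≤ k, ∀ s, I j s → (0 < e.val s.mem ↔ j < k))
    (hstep : ∀ j < k, ∀ s, I j s → ∃ s', Runs ω p s T s' ∧ I (j + 1) s') (h0 : I 0 s) :
    ∃ s', Runs ω (.loop e p) s ((k + 1) * (T + e.costWeight * (b + 1) + 1)) s' ∧ I k s' := by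
  -- Induction on the number m of remaining rounds, since `Exec` unfolds a loop at its first round.
  have key : ∀ m j, j + m = k → ∀ s, I j s → ∃ s', Runs ω (.loop e p) s
      ((m + 1) * (T + e.costWeight * (b + 1) + 1)) s' ∧ I k s' := by
    intro m
    induction m with
    | zero =>
      intro j hj s hs
      have hj : j = k := by omega
      subst hj
      have := Expr.cost_le (hcost j le_rfl s hs)
      exact ⟨s, ⟨_, by omega, Exec.loop_stop (by rw [hpos j le_rfl s hs]; omega)⟩, hs⟩
    | succ m ih =>
      intro j hj s hs
      have := Expr.cost_le (hcost j (by omega) s hs)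
      obtain ⟨s', ⟨t, ht, he⟩, hs'⟩ := hstep j (by omega) s hs
      obtain ⟨s'', ⟨t', ht', he'⟩, hs''⟩ := ih (j + 1) (by omega) s' hs'
      refine ⟨s'', ⟨_, ?_, .loop_step ((hpos j (by omega) s hs).2 (by omega)) he he'⟩, hs''⟩
      rw [add_mul (m + 1)]
      omega
  exact key k 0 (by omega) s h0

end Runs

/-! ### A language of integer terms that compiles to polynomial-time programs -/

/-- Binary operations. -/
inductive ArithOp
  | add | sub | mul | div

namespace ArithOp

/-- The operation on expressions. -/
def expr : ArithOp → Expr → Expr → Expr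
  | add => .add
  | sub => .sub
  | mul => .mul
  | div => .div

/-- The operation on integers. -/
def ap : ArithOp → ℤ → ℤ → ℤ
  | add, a, b => a + b
  | sub, a, b => a - b
  | mul, a, b => a * b
  | div, a, b => a / b

theorem bitSize_ap_le (o : ArithOp) (a b : ℤ) : bitSize (o.ap a b) ≤ bitSize a + bitSize b := by
  cases o
  · exact bitSize_add_le a b
  · exact bitSize_sub_le a b
  · exact bitSize_mul_le a b
  · exact (bitSize_div_le a b).trans (Nat.le_add_right _ _)

theorem val_expr (o : ArithOp) (M : Memory) (a b : Expr) :
    (o.expr a b).val M = o.ap (a.val M) (b.val M) := by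
  cases o <;> rfl

theorem reads_expr (o : ArithOp) {M : Memory} {n : ℕ} {a b : Expr} (ha : a.Reads M n)
    (hb : b.Reads M n) : (o.expr a b).Reads M n := by
  cases o <;> exact ⟨ha, hb⟩

end ArithOp

/-- Ways to accumulate the values of the body of a loop: sums, products, and iteration, where the
values are reduced modulo `m ^ 2 + 1`. -/
inductive FoldOp
  | sum | prod | iter

namespace FoldOp

/-- The new value of the accumulator `acc`, for the value `v` of the body. -/
def ap : FoldOp → (acc v m : ℤ) → ℤ
  | sum, acc, v, _ => acc + v
  | prod, acc, v, _ => acc * v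
  | iter, _, v, m => v % (m * m + 1)

/-- The value that the body sees: the accumulator in an iteration. -/
def seen : FoldOp → ℤ → ℤ
  | sum, _ => 0
  | prod, _ => 0
  | iter, acc => acc

/-- `ap` as an expression. -/
def expr : FoldOp → Expr → Expr → Expr → Expr
  | sum, acc, v, _ => .add acc v
  | prod, acc, v, _ => .mul acc v
  | iter, _, v, m =>
    .sub v (.mul (.add (.mul m m) (.lit 1)) (.div v (.add (.mul m m) (.lit 1))))

/-- `seen` as an expression. -/
def seenExpr : FoldOp → Expr → Expr
  | sum, _ => .lit 0
  | prod, _ => .lit 0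
  | iter, acc => acc

theorem val_expr (o : FoldOp) (M : Memory) (a v m : Expr) :
    (o.expr a v m).val M = o.ap (a.val M) (v.val M) (m.val M) := by
  cases o
  · rfl
  · rfl
  · exact (Int.emod_def _ _).symm

theorem val_seenExpr (o : FoldOp) (M : Memory) (a : Expr) :
    (o.seenExpr a).val M = o.seen (a.val M) := by
  cases o <;> rfl

theorem reads_expr (o : FoldOp) {M : Memory} {n : ℕ} {a v m : Expr} (ha : a.Reads M n)
    (hv : v.Reads M n) (hm : m.Reads M n) : (o.expr a v m).Reads M n := by
  cases o <;> simp [expr, Expr.Reads, ha, hv, hm]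

theorem reads_seenExpr (o : FoldOp) {M : Memory} {n : ℕ} {a : Expr} (ha : a.Reads M n) :
    (o.seenExpr a).Reads M n := by
  cases o <;> simp [seenExpr, Expr.Reads, ha]

/-- The value of the accumulator after `j` rounds. -/
def acc (o : FoldOp) (f : ℕ → ℤ → ℤ) (m i : ℤ) : ℕ → ℤ
  | 0 => i
  | j + 1 => o.ap (o.acc f m i j) (f j (o.seen (o.acc f m i j))) m

/-- Repeated squaring in a loop would double the number of bits in every round; two restrictions
exclude this. A sum or a product hides its accumulator from the body, so each round adds at most b
bits. An iteration shows its accumulator to the body, but reduces it modulo m² + 1. -/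
theorem bitSize_acc_le (o : FoldOp) {f : ℕ → ℤ → ℤ} {m i : ℤ} {k b : ℕ}
    (hf : ∀ j < k, ∀ v, bitSize v ≤ bitSize i + 2 * bitSize m + 3 → bitSize (f j v) ≤ b) :
    ∀ j ≤ k, bitSize (o.acc f m i j) ≤ bitSize i + 2 * bitSize m + 3 + j * b ∧
      bitSize (o.seen (o.acc f m i j)) ≤ bitSize i + 2 * bitSize m + 3 := by
  intro j
  induction j with
  | zero => intro _; cases o <;> simp [acc, seen, bitSize_zero] <;> omega
  | succ j ih =>
    intro hj
    obtain ⟨h1, h2⟩ := ih (by omega)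
    have h3 := hf j (by omega) _ h2
    have h4 : (j + 1) * b = j * b + b := by ring
    cases o
    · have := bitSize_add_le (sum.acc f m i j) (f j (sum.seen (sum.acc f m i j)))
      refine ⟨?_, ?_⟩
      · simp only [acc, ap] at *; omega
      · simp only [seen, bitSize_zero]; omega
    · have := bitSize_mul_le (prod.acc f m i j) (f j (prod.seen (prod.acc f m i j)))
      refine ⟨?_, ?_⟩
      · simp only [acc, ap] at *; omega
      · simp only [seen, bitSize_zero]; omega
    · have := bitSize_emod_le (f j (iter.seen (iter.acc f m i j))) m
      refine ⟨?_, ?_⟩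
      · simp only [acc, ap] at *; omega
      · simp only [acc, ap, seen] at *; omega

end FoldOp

/-- Integer terms: literals, variables, entries of the input and of the list of coin tosses,
arithmetic, case distinction (on `0 < c`), binary length, local definitions, and bounded loops
with index `x`, where `y` is the accumulator, `c` the number of rounds, `i` the initial value. -/
inductive IntTerm
  | lit (z : ℤ)
  | var (x : ℕ)
  | inp (t : IntTerm)
  | coin (t : IntTerm)
  | bin (o : ArithOp) (a b : IntTerm)
  | ite (c a b : IntTerm)
  | size (t : IntTerm)
  | lett (x : ℕ) (a b : IntTerm)
  | loop (o : FoldOp) (x y : ℕ) (c i m b : IntTerm)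

namespace IntTerm

open Function (update)

/-- The value of a term for the input `I`, the coin tosses `C` and the values `env` of the
variables. -/
def eval (I C : ℤ → ℤ) : IntTerm → (ℕ → ℤ) → ℤ
  | lit z, _ => z
  | var x, env => env x
  | inp t, env => I (t.eval I C env)
  | coin t, env => C (t.eval I C env)
  | bin o a b, env => o.ap (a.eval I C env) (b.eval I C env)
  | ite c a b, env => if 0 < c.eval I C env then a.eval I C env else b.eval I C env
  | size t, env => Nat.size (t.eval I C env).toNat
  | lett x a b, env => b.eval I C (update env x (a.eval I C env))
  | loop o x y c i m b, env =>
    o.acc (fun j v => b.eval I C (update (update env y v) x j)) (m.eval I C env)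
      (i.eval I C env) (c.eval I C env).toNat

/-- Terms with polynomially bounded values: sums and products of literals, binary lengths, and the
first three entries of the input. -/
def IsCount : IntTerm → Prop
  | lit _ => True
  | inp (lit z) => 0 ≤ z ∧ z < 3
  | size _ => True
  | bin .add a b => a.IsCount ∧ b.IsCount
  | bin .mul a b => a.IsCount ∧ b.IsCount
  | _ => False

/-- All numbers of rounds of loops are given by terms with polynomially bounded values. -/
def WF : IntTerm → Prop
  | lit _ => True
  | var _ => True
  | inp t => t.WF
  | coin t => t.WF
  | bin _ a b => a.WF ∧ b.WF
  | ite c a b => c.WF ∧ a.WF ∧ b.WF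
  | size t => t.WF
  | lett _ a b => a.WF ∧ b.WF
  | loop _ _ _ c i m b => c.IsCount ∧ c.WF ∧ i.WF ∧ m.WF ∧ b.WF

/-- Bounds for all data of a term. -/
structure Bounded (b : ℕ) (I C : ℤ → ℤ) (env : ℕ → ℤ) : Prop where
  inp : ∀ i, bitSize (I i) ≤ b
  coin : ∀ i, bitSize (C i) ≤ b
  env : ∀ x, bitSize (env x) ≤ b
  count : ∀ i, 0 ≤ i → i < 3 → (I i).natAbs ≤ b

theorem Bounded.mono {b b' : ℕ} {I C : ℤ → ℤ} {env : ℕ → ℤ} (h : Bounded b I C env)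
    (hb : b ≤ b') : Bounded b' I C env :=
  ⟨fun i => (h.inp i).trans hb, fun i => (h.coin i).trans hb, fun i => (h.env i).trans hb,
    fun i h0 h1 => (h.count i h0 h1).trans hb⟩

theorem Bounded.update {b : ℕ} {I C : ℤ → ℤ} {env : ℕ → ℤ} (h : Bounded b I C env) (x : ℕ)
    {v : ℤ} (hv : bitSize v ≤ b) : Bounded b I C (update env x v) := by
  refine ⟨h.inp, h.coin, fun x' => ?_, h.count⟩
  by_cases hx : x' = x
  · subst hx; simpa using hv
  · simpa [hx] using h.env x'

/-- The bound B is quantified inside the induction because bodies of loops and of local definitions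
are evaluated with new variables, hence under a larger polynomial bound. For counts the value
itself, and not only its number of bits, has to be polynomial: it becomes a number of rounds. -/
theorem eval_bounded (t : IntTerm) (ht : t.WF) : ∀ B, PolyBounded B → ∃ T, PolyBounded T ∧
    ∀ σ I C env, Bounded (B σ) I C env →
      bitSize (t.eval I C env) ≤ T σ ∧ (t.IsCount → (t.eval I C env).natAbs ≤ T σ) := by
  induction t with
  | lit z =>
    intro B _
    refine ⟨fun _ => z.natAbs + 1, .const _, fun σ I C env _ => ?_⟩
    exact ⟨bitSize_le_natAbs_add_one z, fun _ => by simp only [eval]; omega⟩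
  | var x =>
    intro B hB
    exact ⟨B, hB, fun σ I C env h => ⟨h.env x, False.elim⟩⟩
  | inp t _ =>
    intro B hB
    refine ⟨B, hB, fun σ I C env h => ⟨h.inp _, fun hc => ?_⟩⟩
    cases t with
    | lit z => exact h.count _ hc.1 hc.2
    | _ => exact hc.elim
  | coin t _ =>
    intro B hB
    exact ⟨B, hB, fun σ I C env h => ⟨h.coin _, False.elim⟩⟩
  | bin o a b iha ihb =>
    intro B hB
    obtain ⟨Ta, hTa, ha⟩ := iha ht.1 B hB
    obtain ⟨Tb, hTb, hb⟩ := ihb ht.2 B hB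
    refine ⟨fun σ => Ta σ + Tb σ + Ta σ * Tb σ, (hTa.add hTb).add (hTa.mul hTb),
      fun σ I C env h => ?_⟩
    have ha := ha σ I C env h
    have hb := hb σ I C env h
    refine ⟨?_, fun hc => ?_⟩
    · have := o.bitSize_ap_le (a.eval I C env) (b.eval I C env)
      simp only [eval]
      omega
    · cases o with
      | add =>
        have := Int.natAbs_add_le (a.eval I C env) (b.eval I C env)
        have := ha.2 hc.1
        have := hb.2 hc.2
        simp only [eval, ArithOp.ap]
        omega
      | mul =>
        have := Nat.mul_le_mul (ha.2 hc.1) (hb.2 hc.2)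
        simp only [eval, ArithOp.ap, Int.natAbs_mul]
        omega
      | sub => exact hc.elim
      | div => exact hc.elim
  | ite c a b _ iha ihb =>
    intro B hB
    obtain ⟨Ta, hTa, ha⟩ := iha ht.2.1 B hB
    obtain ⟨Tb, hTb, hb⟩ := ihb ht.2.2 B hB
    refine ⟨fun σ => Ta σ + Tb σ, hTa.add hTb, fun σ I C env h => ⟨?_, False.elim⟩⟩
    have := (ha σ I C env h).1
    have := (hb σ I C env h).1
    simp only [eval]
    split_ifs <;> omega
  | size t iht =>
    intro B hB
    obtain ⟨T, hT, h⟩ := iht ht B hB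
    refine ⟨fun σ => T σ + 1, hT.add (.const 1), fun σ I C env hb => ?_⟩
    have h1 := (h σ I C env hb).1
    have h2 : Nat.size (t.eval I C env).toNat ≤ T σ :=
      (Nat.size_le_size (show _ ≤ (t.eval I C env).natAbs by omega)).trans
        ((Nat.le_succ _).trans h1)
    refine ⟨(bitSize_le_natAbs_add_one _).trans ?_, fun _ => ?_⟩ <;>
      simp only [eval, Int.natAbs_natCast] <;> omega
  | lett x a b iha ihb =>
    intro B hB
    obtain ⟨Ta, hTa, ha⟩ := iha ht.1 B hB
    obtain ⟨Tb, hTb, hb⟩ := ihb ht.2 _ (hB.add hTa)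
    refine ⟨Tb, hTb, fun σ I C env h => ⟨?_, False.elim⟩⟩
    have ha := (ha σ I C env h).1
    exact (hb σ I C _ ((h.mono (Nat.le_add_right _ _)).update x (ha.trans (Nat.le_add_left _ _)))).1
  | loop o x y c i m b ihc ihi ihm ihb =>
    intro B hB
    obtain ⟨Tc, hTc, hc⟩ := ihc ht.2.1 B hB
    obtain ⟨Ti, hTi, hi⟩ := ihi ht.2.2.1 B hB
    obtain ⟨Tm, hTm, hm⟩ := ihm ht.2.2.2.1 B hB
    -- The enlargement covers the two variables of the loop: the index, which is below the number of
    -- rounds, and the part of the accumulator that the body sees.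
    obtain ⟨Tb, hTb, hb⟩ := ihb ht.2.2.2.2 (fun σ => B σ + (Tc σ + (Ti σ + 2 * Tm σ + 3)))
      (hB.add (hTc.add ((hTi.add ((PolyBounded.const 2).mul hTm)).add (.const 3))))
    refine ⟨fun σ => Ti σ + 2 * Tm σ + 3 + Tc σ * Tb σ,
      ((hTi.add ((PolyBounded.const 2).mul hTm)).add (.const 3)).add (hTc.mul hTb),
      fun σ I C env h => ⟨?_, False.elim⟩⟩
    have hi := (hi σ I C env h).1
    have hm := (hm σ I C env h).1
    have hc := (hc σ I C env h).2 ht.1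
    refine ((o.bitSize_acc_le (k := (c.eval I C env).toNat) (b := Tb σ) ?_ _ le_rfl).1).trans ?_
    · intro j hj v hv
      refine (hb σ I C _ (((h.mono (Nat.le_add_right _ _)).update y ?_).update x ?_)).1
      · omega
      · exact (bitSize_le_natAbs_add_one _).trans (by omega)
    · have : (c.eval I C env).toNat * Tb σ ≤ Tc σ * Tb σ := Nat.mul_le_mul_right _ (by omega)
      show _ ≤ Ti σ + 2 * Tm σ + 3 + Tc σ * Tb σ
      omega

end IntTerm

/-! ### Compilation of terms

Variables are kept in the array `3`, intermediate results in the array `4`, whose entries are called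
registers. -/

namespace MachineState

/-- Change of one entry of the memory. -/
def set (s : MachineState) (a : ℕ) (i v : ℤ) : MachineState := ⟨s.mem.set a i v, s.tosses⟩

theorem set_mem (s : MachineState) (a : ℕ) (i v : ℤ) (a' : ℕ) (i' : ℤ) :
    (s.set a i v).mem a' i' = if a' = a ∧ i' = i then v else s.mem a' i' := rfl

/-- `s'` differs from `s` only in registers with index at least `r`. -/
structure Agree (r : ℕ) (s s' : MachineState) : Prop where
  tosses : s'.tosses = s.tosses
  mem : ∀ a i, a ≠ 4 ∨ i < (r : ℤ) → s'.mem a i = s.mem a i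

theorem Agree.refl (r : ℕ) (s : MachineState) : Agree r s s := ⟨rfl, fun _ _ _ => rfl⟩

theorem Agree.trans {r : ℕ} {s s' s'' : MachineState} (h : Agree r s s') (h' : Agree r s' s'') :
    Agree r s s'' :=
  ⟨h'.tosses.trans h.tosses, fun a i hi => (h'.mem a i hi).trans (h.mem a i hi)⟩

theorem Agree.mono {r r' : ℕ} {s s' : MachineState} (h : Agree r' s s') (hr : r ≤ r') :
    Agree r s s' :=
  ⟨h.tosses, fun a i hi => h.mem a i (hi.imp_right fun hi => by omega)⟩

theorem Agree.set {r : ℕ} {s s' : MachineState} (h : Agree r s s') {i : ℤ} (hi : (r : ℤ) ≤ i)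
    (v : ℤ) : Agree r s (s'.set 4 i v) := by
  refine ⟨h.tosses, fun a j hj => ?_⟩
  rw [set_mem, if_neg (by omega)]
  exact h.mem a j hj

theorem Agree.array {r : ℕ} {s s' : MachineState} (h : Agree r s s') {a : ℕ} (ha : a ≠ 4) :
    s'.mem a = s.mem a :=
  funext fun i => h.mem a i (Or.inl ha)

end MachineState

/-- The growth rate of the cost of the assignment of `e` to an entry with index `i`. -/
def writeCost (i e : Expr) : ℕ := i.costWeight + e.costWeight + i.weight + e.weight + 1

namespace Runs

variable {ω : ℕ → Bool} {s : MachineState}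

theorem set {a : ℕ} {i e : Expr} {b : ℕ} (hi : i.Reads s.mem b) (he : e.Reads s.mem b) :
    Runs ω (.write a i e) s (writeCost i e * (b + 1))
      (s.set a (i.val s.mem) (e.val s.mem)) :=
  Runs.write hi he

end Runs

/-- The register `r`. -/
abbrev reg (r : ℕ) : Expr := .read 4 (.lit r)

/-- Assignment to the register `r`. -/
abbrev setReg (r : ℕ) (e : Expr) : Prog := .write 4 (.lit r) e

/-- The variable `x`. -/
abbrev slot (x : ℕ) : Expr := .read 3 (.lit x)

/-- Assignment to the variable `x`. -/
abbrev setSlot (x : ℕ) (e : Expr) : Prog := .write 3 (.lit x) e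

namespace IntTerm

open Function (update)

/-- A program that evaluates the term into the register `r`, using only registers from `r` on. -/
def compile : IntTerm → ℕ → Prog
  | lit z, r => setReg r (.lit z)
  | var x, r => setReg r (slot x)
  | inp t, r => .seq (t.compile r) (setReg r (.read 0 (reg r)))
  | coin t, r => .seq (t.compile r) (setReg r (.read 2 (reg r)))
  | bin o a b, r =>
    .seq (a.compile r) (.seq (b.compile (r + 1)) (setReg r (o.expr (reg r) (reg (r + 1)))))
  | ite c a b, r => .seq (c.compile r) (.ite (reg r) (a.compile r) (b.compile r))
  | size t, r =>
    .seq (t.compile r) (.seq (setReg (r + 1) (.lit 0)) (.seq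
      (.loop (reg r) (.seq (setReg r (.div (reg r) (.lit 2)))
        (setReg (r + 1) (.add (reg (r + 1)) (.lit 1)))))
      (setReg r (reg (r + 1)))))
  | lett x a b, r =>
    .seq (a.compile r) (.seq (setReg (r + 1) (slot x)) (.seq (setSlot x (reg r))
      (.seq (b.compile (r + 2)) (.seq (setSlot x (reg (r + 1))) (setReg r (reg (r + 2)))))))
  | loop o x y c i m b, r =>
    .seq (c.compile r) (.seq (m.compile (r + 1)) (.seq (i.compile (r + 2))
      (.seq (setReg (r + 3) (slot x)) (.seq (setReg (r + 4) (slot y))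
      (.seq (setReg (r + 5) (.lit 0)) (.seq
        (.loop (reg r)
          (.seq (setSlot y (o.seenExpr (reg (r + 2)))) (.seq (setSlot x (reg (r + 5)))
            (.seq (b.compile (r + 6))
            (.seq (setReg (r + 2) (o.expr (reg (r + 2)) (reg (r + 6)) (reg (r + 1))))
            (.seq (setReg (r + 5) (.add (reg (r + 5)) (.lit 1)))
              (setReg r (.sub (reg r) (.lit 1)))))))))
      (.seq (setSlot x (reg (r + 3))) (.seq (setSlot y (reg (r + 4)))
        (setReg r (reg (r + 2)))))))))))

/-- The values of the variables. -/
def envOf (s : MachineState) (x : ℕ) : ℤ := s.mem 3 x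

/-- The value of a term in a state. -/
def value (t : IntTerm) (s : MachineState) : ℤ := t.eval (s.mem 0) (s.mem 2) (envOf s)

/-- Bounds for all data in a state. -/
def BoundedState (b : ℕ) (s : MachineState) : Prop := Bounded b (s.mem 0) (s.mem 2) (envOf s)

theorem _root_.MachineState.Agree.envOf {r : ℕ} {s s' : MachineState} (h : s.Agree r s') :
    envOf s' = envOf s :=
  funext fun _ => h.mem _ _ (Or.inl (by norm_num))

theorem value_congr (t : IntTerm) {s s' : MachineState} (h0 : s'.mem 0 = s.mem 0)
    (h2 : s'.mem 2 = s.mem 2) (h3 : envOf s' = envOf s) : t.value s' = t.value s := by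
  rw [value, value, h0, h2, h3]

theorem value_agree (t : IntTerm) {r : ℕ} {s s' : MachineState} (h : s.Agree r s') :
    t.value s' = t.value s :=
  t.value_congr (h.array (by norm_num)) (h.array (by norm_num)) h.envOf

theorem BoundedState.agree {r b : ℕ} {s s' : MachineState} (hb : BoundedState b s)
    (h : s.Agree r s') : BoundedState b s' := by
  rw [BoundedState, h.array (by norm_num), h.array (by norm_num), h.envOf]
  exact hb

/-! ### Correctness and running time of compiled terms -/

/-- Correctness and polynomial running time of the program of a term. -/
def CompilesCorrectly (t : IntTerm) : Prop :=
  ∀ B, PolyBounded B → ∀ r, ∃ T, PolyBounded T ∧ ∀ σ ω s, BoundedState (B σ) s →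
    ∃ s', Runs ω (t.compile r) s (T σ) s' ∧ s'.mem 4 r = t.value s ∧ s.Agree r s'

theorem compilesCorrectly_lit (z : ℤ) : CompilesCorrectly (lit z) := by
  intro B hB r
  refine ⟨fun σ => writeCost (.lit r) (.lit z) * (0 + 1), ?poly, ?main⟩
  case main =>
    intro σ ω s hs
    refine ⟨_, Runs.set (by simp [Expr.Reads]) (by simp [Expr.Reads]), ?_, ?_⟩
    · simp [MachineState.set_mem, Expr.val, value, eval]
    · exact (MachineState.Agree.refl r s).set le_rfl _
  case poly => exact .const _

theorem compilesCorrectly_var (x : ℕ) : CompilesCorrectly (var x) := by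
  intro B hB r
  refine ⟨fun σ => writeCost (.lit r) (slot x) * (B σ + 1), ?poly, ?main⟩
  case main =>
    intro σ ω s hs
    refine ⟨_, Runs.set (by simp [Expr.Reads]) ⟨trivial, hs.env x⟩,
      ?_, ?_⟩
    · simp [MachineState.set_mem, Expr.val, value, eval, envOf]
    · exact (MachineState.Agree.refl r s).set le_rfl _
  case poly => exact (PolyBounded.const _).mul (hB.add (.const 1))

theorem compilesCorrectly_inp {t : IntTerm} (ht : t.WF) (h : t.CompilesCorrectly) :
    CompilesCorrectly (inp t) := by
  intro B hB r
  obtain ⟨T, hT, h⟩ := h B hB r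
  obtain ⟨V, hV, hv⟩ := t.eval_bounded ht B hB
  refine ⟨fun σ => T σ + writeCost (.lit r) (.read 0 (reg r)) * (B σ + V σ + 1), ?poly, ?main⟩
  case main =>
    intro σ ω s hs
    obtain ⟨s', hr, hval, ha⟩ := h σ ω s hs
    have hv := (hv σ _ _ _ hs).1
    have h0 : s'.mem 0 = s.mem 0 := ha.array (by norm_num)
    have := hs.inp (t.value s)
    refine ⟨_, hr.seq (Runs.set (by simp [Expr.Reads]) ?_), ?_, ?_⟩
    · simp only [Expr.Reads, Expr.val, true_and, hval, h0]
      exact ⟨hv.trans (by omega), by omega⟩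
    · simp [MachineState.set_mem, Expr.val, value, eval, hval, h0]
    · exact ha.set le_rfl _
  case poly => exact hT.add ((PolyBounded.const _).mul ((hB.add hV).add (.const 1)))

theorem compilesCorrectly_coin {t : IntTerm} (ht : t.WF) (h : t.CompilesCorrectly) :
    CompilesCorrectly (coin t) := by
  intro B hB r
  obtain ⟨T, hT, h⟩ := h B hB r
  obtain ⟨V, hV, hv⟩ := t.eval_bounded ht B hB
  refine ⟨fun σ => T σ + writeCost (.lit r) (.read 2 (reg r)) * (B σ + V σ + 1), ?poly, ?main⟩
  case main =>
    intro σ ω s hs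
    obtain ⟨s', hr, hval, ha⟩ := h σ ω s hs
    have hv := (hv σ _ _ _ hs).1
    have h0 : s'.mem 2 = s.mem 2 := ha.array (by norm_num)
    have := hs.coin (t.value s)
    refine ⟨_, hr.seq (Runs.set (by simp [Expr.Reads]) ?_), ?_, ?_⟩
    · simp only [Expr.Reads, Expr.val, true_and, hval, h0]
      exact ⟨hv.trans (by omega), by omega⟩
    · simp [MachineState.set_mem, Expr.val, value, eval, hval, h0]
    · exact ha.set le_rfl _
  case poly => exact hT.add ((PolyBounded.const _).mul ((hB.add hV).add (.const 1)))

theorem compilesCorrectly_bin (o : ArithOp) {a b : IntTerm} (hwa : a.WF) (hwb : b.WF)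
    (ha : a.CompilesCorrectly) (hb : b.CompilesCorrectly) : CompilesCorrectly (bin o a b) := by
  intro B hB r
  obtain ⟨Ta, hTa, ha⟩ := ha B hB r
  obtain ⟨Va, hVa, hva⟩ := a.eval_bounded hwa B hB
  obtain ⟨Tb, hTb, hb⟩ := hb B hB (r + 1)
  obtain ⟨Vb, hVb, hvb⟩ := b.eval_bounded hwb B hB
  refine ⟨fun σ => Ta σ + (Tb σ + writeCost (.lit r) (o.expr (reg r) (reg (r + 1))) * (Va σ + Vb σ + 1)), ?poly, ?main⟩
  case main =>
    intro σ ω s hs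
    obtain ⟨s₁, hr₁, hval₁, ha₁⟩ := ha σ ω s hs
    obtain ⟨s₂, hr₂, hval₂, ha₂⟩ := hb σ ω s₁ (hs.agree ha₁)
    have hva := (hva σ _ _ _ hs).1
    have hvb := (hvb σ _ _ _ hs).1
    have e1 : s₂.mem 4 r = a.value s := (ha₂.mem _ _ (Or.inr (by simp))).trans hval₁
    have e2 : s₂.mem 4 ((r + 1 : ℕ) : ℤ) = b.value s := hval₂.trans (b.value_agree ha₁)
    refine ⟨_, hr₁.seq (hr₂.seq (Runs.set (by simp [Expr.Reads]) (o.reads_expr ?_ ?_))), ?_, ?_⟩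
    · simp only [Expr.Reads, Expr.val, true_and, e1]
      exact hva.trans (Nat.le_add_right _ _)
    · simp only [Expr.Reads, Expr.val, true_and, e2]
      exact hvb.trans (Nat.le_add_left _ _)
    · simp only [MachineState.set_mem, o.val_expr, Expr.val, e1, e2, value, eval]
      simp
    · exact (ha₁.trans (ha₂.mono (Nat.le_succ r))).set le_rfl _
  case poly =>
    exact hTa.add (hTb.add ((PolyBounded.const _).mul ((hVa.add hVb).add (.const 1))))

theorem compilesCorrectly_ite {c a b : IntTerm} (hwc : c.WF)
    (hc : c.CompilesCorrectly) (ha : a.CompilesCorrectly) (hb : b.CompilesCorrectly) :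
    CompilesCorrectly (ite c a b) := by
  intro B hB r
  obtain ⟨Tc, hTc, hc⟩ := hc B hB r
  obtain ⟨Vc, hVc, hvc⟩ := c.eval_bounded hwc B hB
  obtain ⟨Ta, hTa, ha⟩ := ha B hB r
  obtain ⟨Tb, hTb, hb⟩ := hb B hB r
  refine ⟨fun σ => Tc σ + ((reg r).costWeight * (Vc σ + 1) + (Ta σ + Tb σ) + 1), ?_, ?_⟩
  · exact hTc.add ((((PolyBounded.const _).mul (hVc.add (.const 1))).add (hTa.add hTb)).add
      (.const 1))
  · intro σ ω s hs
    obtain ⟨s₁, hr₁, hval₁, ha₁⟩ := hc σ ω s hs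
    have hvc := (hvc σ _ _ _ hs).1
    have hread : (reg r).Reads s₁.mem (Vc σ) := by
      simp only [Expr.Reads, Expr.val, true_and, hval₁]
      exact hvc
    by_cases h0 : 0 < c.value s
    · obtain ⟨s₂, hr₂, hval₂, ha₂⟩ := ha σ ω s₁ (hs.agree ha₁)
      refine ⟨s₂, hr₁.seq (Runs.ite hread ?_), ?_, ha₁.trans ha₂⟩
      · rw [if_pos (by simpa only [Expr.val, hval₁])]
        exact hr₂.mono (Nat.le_add_right _ _)
      · rw [hval₂, a.value_agree ha₁, value, value, eval, if_pos (by exact h0)]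
    · obtain ⟨s₂, hr₂, hval₂, ha₂⟩ := hb σ ω s₁ (hs.agree ha₁)
      refine ⟨s₂, hr₁.seq (Runs.ite hread ?_), ?_, ha₁.trans ha₂⟩
      · rw [if_neg (by simpa only [Expr.val, hval₁])]
        exact hr₂.mono (Nat.le_add_left _ _)
      · rw [hval₂, b.value_agree ha₁, value, value, eval, if_neg (by exact h0)]

/-- Halving removes exactly one binary digit; so the binary length is the number of halvings until 0
is reached, which is how the machine computes it. -/
theorem size_toNat_ediv_two {z : ℤ} (hz : 0 < z) :
    Nat.size (z / 2).toNat + 1 = Nat.size z.toNat := by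
  obtain ⟨n, rfl⟩ := Int.eq_ofNat_of_zero_le hz.le
  have h1 : ((n : ℤ) / 2).toNat = n / 2 := by omega
  have hn : 0 < n := by omega
  rw [h1, Int.toNat_natCast]
  apply le_antisymm
  · rw [Nat.succ_le_iff, Nat.lt_size]
    by_cases h : n / 2 = 0
    · rw [h]; simp; omega
    · have h2 : 0 < Nat.size (n / 2) := Nat.size_pos.2 (by omega)
      have h3 : 2 ^ (Nat.size (n / 2) - 1) ≤ n / 2 := Nat.lt_size.1 (by omega)
      obtain ⟨m, hm⟩ := Nat.exists_eq_succ_of_ne_zero h2.ne'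
      rw [hm] at h3 ⊢
      simp only [Nat.succ_sub_one] at h3
      rw [pow_succ]
      omega
  · rw [Nat.size_le, pow_succ]
    have := Nat.lt_size_self (n / 2)
    omega

theorem compilesCorrectly_size {t : IntTerm} (ht : t.WF) (h : t.CompilesCorrectly) :
    CompilesCorrectly (size t) := by
  intro B hB r
  obtain ⟨T, hT, h⟩ := h B hB r
  obtain ⟨V, hV, hv⟩ := t.eval_bounded ht B hB
  refine ⟨fun σ => T σ + (writeCost (.lit (r + 1 : ℕ)) (.lit 0) * (2 * V σ + 2 + 1) + ((V σ + 1) *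
    (writeCost (.lit r) (.div (reg r) (.lit 2)) * (2 * V σ + 2 + 1) +
      writeCost (.lit (r + 1 : ℕ)) (.add (reg (r + 1)) (.lit 1)) * (2 * V σ + 2 + 1) +
      (reg r).costWeight * (2 * V σ + 2 + 1) + 1) +
      writeCost (.lit r) (reg (r + 1)) * (2 * V σ + 2 + 1))), ?poly, ?main⟩
  case main =>
    intro σ ω s hs
    obtain ⟨s₁, hr₁, hval₁, ha₁⟩ := h σ ω s hs
    have hv := (hv σ _ _ _ hs).1
    have hsz : Nat.size (t.value s).toNat ≤ V σ :=
      (Nat.size_le_size (show _ ≤ (t.value s).natAbs by omega)).trans ((Nat.le_succ _).trans hv)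
    have hr₂ : Runs ω (setReg (r + 1) (.lit 0)) s₁ _ _ :=
      Runs.set (b := 2 * V σ + 2) (by simp [Expr.Reads]) (by simp [Expr.Reads])
    obtain ⟨s₃, hr₃, hI⟩ : ∃ s₃, Runs ω (.loop (reg r) (.seq (setReg r (.div (reg r) (.lit 2)))
        (setReg (r + 1) (.add (reg (r + 1)) (.lit 1))))) (s₁.set 4 ((r : ℤ) + 1) 0)
        ((Nat.size (t.value s).toNat + 1) *
          ((writeCost (.lit r) (.div (reg r) (.lit 2)) * (2 * V σ + 2 + 1) +
          writeCost (.lit (r + 1 : ℕ)) (.add (reg (r + 1)) (.lit 1)) * (2 * V σ + 2 + 1)) +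
          (reg r).costWeight * (2 * V σ + 2 + 1) + 1)) s₃ ∧
        (s.Agree r s₃ ∧ bitSize (s₃.mem 4 r) ≤ V σ ∧
          s₃.mem 4 (r + 1) = (Nat.size (t.value s).toNat : ℕ) ∧
        Nat.size (s₃.mem 4 r).toNat + Nat.size (t.value s).toNat =
          Nat.size (t.value s).toNat) := by
      -- Invariant: the digits left in register r and the j digits already counted in register r + 1
      -- add up to the binary length.
      refine Runs.loop (I := fun j s' => s.Agree r s' ∧ bitSize (s'.mem 4 r) ≤ V σ ∧
        s'.mem 4 (r + 1) = j ∧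
        Nat.size (s'.mem 4 r).toNat + j = Nat.size (t.value s).toNat) _ ?_ ?_ ?_ ?_
      · rintro j - s' ⟨-, h1, -, -⟩
        simp only [Expr.Reads, Expr.val, true_and]
        omega
      · rintro j hj s' ⟨-, -, -, h3⟩
        simp only [Expr.val]
        rw [← h3, lt_add_iff_pos_left, Nat.size_pos]
        omega
      · rintro j hj s' ⟨h0, h1, h2, h3⟩
        have hpos : 0 < s'.mem 4 r := by
          have : 0 < Nat.size (s'.mem 4 r).toNat := by omega
          rw [Nat.size_pos] at this
          omega
        have := size_toNat_ediv_two hpos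
        have := bitSize_div_le (s'.mem 4 r) 2
        refine ⟨_, Runs.seq (Runs.set (b := 2 * V σ + 2) (by simp [Expr.Reads]) ?_)
          (Runs.set (b := 2 * V σ + 2) (by simp [Expr.Reads]) ?_), ?_, ?_, ?_, ?_⟩
        · simp only [Expr.Reads, Expr.val, true_and, and_true]
          omega
        · simp only [Expr.Reads, Expr.val, true_and, and_true, MachineState.set_mem]
          simp only [Nat.cast_add, Nat.cast_one, add_eq_left, one_ne_zero, if_false, h2]
          exact (bitSize_le_natAbs_add_one _).trans (by simp; omega)
        · exact (h0.set le_rfl _).set (by simp [Expr.val]) _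
        · simp [MachineState.set_mem, Expr.val]
          omega
        · simp [MachineState.set_mem, Expr.val, h2]
        · simp [MachineState.set_mem, Expr.val]
          omega
      · refine ⟨ha₁.set (by simp) _, ?_, ?_, ?_⟩ <;> simp [MachineState.set_mem, hval₁]
        exact hv
    have hr₄ : Runs ω (setReg r (reg (r + 1))) s₃ _ _ :=
      Runs.set (b := 2 * V σ + 2) (by simp [Expr.Reads]) (by
        simp only [Expr.Reads, Expr.val, true_and, Nat.cast_add, Nat.cast_one, hI.2.2.1]
        exact (bitSize_le_natAbs_add_one _).trans (by simp; omega))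
    refine ⟨_, hr₁.seq (hr₂.seq (Runs.seq (hr₃.mono (T₂ := _) ?_) hr₄)), ?_, ?_⟩
    · exact Nat.mul_le_mul_right _ (by omega)
    · simp [MachineState.set_mem, Expr.val, hI.2.2.1, value, eval]
    · exact hI.1.set le_rfl _
  case poly =>
    have h1 := ((PolyBounded.const 2).mul hV).add (.const 2) |>.add (.const 1)
    have h2 : ∀ c, PolyBounded _ := fun c => (PolyBounded.const c).mul h1
    exact hT.add ((h2 _).add (((hV.add (.const 1)).mul ((((h2 _).add (h2 _)).add (h2 _)).add
      (.const 1))).add (h2 _)))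

end IntTerm

namespace IntTerm

open Function (update)

theorem envOf_set (s : MachineState) (x : ℕ) (v : ℤ) :
    envOf (s.set 3 x v) = update (envOf s) x v := by
  funext z
  by_cases hz : z = x
  · subst hz; simp [envOf, MachineState.set_mem]
  · simp [envOf, MachineState.set_mem, hz]

theorem mem_set_of_ne (s : MachineState) {a a' : ℕ} (h : a' ≠ a) (i v : ℤ) :
    (s.set a i v).mem a' = s.mem a' := by
  funext z
  simp [MachineState.set_mem, h]

/-- The old value of the variable waits in register r + 1, out of reach of the body, which is
compiled from r + 2 on. It is restored at the end, so that only registers have changed. -/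
theorem compilesCorrectly_lett (x : ℕ) {a b : IntTerm} (hwa : a.WF) (hwb : b.WF)
    (ha : a.CompilesCorrectly) (hb : b.CompilesCorrectly) : CompilesCorrectly (lett x a b) := by
  intro B hB r
  obtain ⟨Ta, hTa, ha⟩ := ha B hB r
  obtain ⟨Va, hVa, hva⟩ := a.eval_bounded hwa B hB
  obtain ⟨Tb, hTb, hb⟩ := hb _ (hB.add hVa) (r + 2)
  obtain ⟨Vb, hVb, hvb⟩ := b.eval_bounded hwb _ (hB.add hVa)
  refine ⟨fun σ => Ta σ + (writeCost (.lit (r + 1 : ℕ)) (slot x) * (B σ + Va σ + Vb σ + 1) +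
    (writeCost (.lit x) (reg r) * (B σ + Va σ + Vb σ + 1) + (Tb σ +
      (writeCost (.lit x) (reg (r + 1)) * (B σ + Va σ + Vb σ + 1) +
        writeCost (.lit r) (reg (r + 2)) * (B σ + Va σ + Vb σ + 1))))), ?_, ?_⟩
  · have h1 := ((hB.add hVa).add hVb).add (.const 1)
    have h2 : ∀ c, PolyBounded _ := fun c => (PolyBounded.const c).mul h1
    exact hTa.add ((h2 _).add ((h2 _).add (hTb.add ((h2 _).add (h2 _)))))
  · intro σ ω s hs
    obtain ⟨s₁, hr₁, hval₁, ha₁⟩ := ha σ ω s hs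
    have hva := (hva σ _ _ _ hs).1
    have hx : bitSize (s.mem 3 x) ≤ B σ := hs.env x
    have hx₁ : s₁.mem 3 x = s.mem 3 x := ha₁.mem _ _ (Or.inl (by norm_num))
    have hr₂ : Runs ω (setReg (r + 1) (slot x)) s₁
        (writeCost (.lit (r + 1 : ℕ)) (slot x) * (B σ + Va σ + Vb σ + 1)) (s₁.set 4 ((r + 1 : ℕ) : ℤ) (s.mem 3 x)) := by
      rw [← hx₁]
      refine Runs.set (b := B σ + Va σ + Vb σ) trivial ⟨trivial, ?_⟩
      simp only [Expr.val, hx₁]; omega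
    set s₂ := s₁.set 4 ((r + 1 : ℕ) : ℤ) (s.mem 3 x) with hs₂
    have hv₂ : s₂.mem 4 r = a.value s := by simp [hs₂, MachineState.set_mem, hval₁]
    have hr₃ : Runs ω (setSlot x (reg r)) s₂
        (writeCost (.lit x) (reg r) * (B σ + Va σ + Vb σ + 1)) (s₂.set 3 x (a.value s)) := by
      rw [← hv₂]
      refine Runs.set (b := B σ + Va σ + Vb σ) trivial ⟨trivial, ?_⟩
      simp only [Expr.val, hv₂]; exact hva.trans (by omega)
    set s₃ := s₂.set 3 x (a.value s) with hs₃
    have ha₂ : s.Agree r s₂ := ha₁.set (by simp) _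
    have henv : envOf s₃ = update (envOf s) x (a.value s) := by rw [hs₃, envOf_set, ha₂.envOf]
    have h0 : s₃.mem 0 = s.mem 0 := by
      rw [hs₃, mem_set_of_ne _ (by norm_num), ha₂.array (by norm_num)]
    have h2 : s₃.mem 2 = s.mem 2 := by
      rw [hs₃, mem_set_of_ne _ (by norm_num), ha₂.array (by norm_num)]
    have hs₃b : BoundedState (B σ + Va σ) s₃ := by
      rw [BoundedState, h0, h2, henv]
      exact (hs.mono (Nat.le_add_right _ _)).update x (hva.trans (Nat.le_add_left _ _))
    have hvb := (hvb σ _ _ _ hs₃b).1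
    obtain ⟨s₄, hr₄, hval₄, ha₄⟩ := hb σ ω s₃ hs₃b
    have hx₄ : s₄.mem 4 ((r + 1 : ℕ) : ℤ) = s.mem 3 x := by
      rw [ha₄.mem _ _ (Or.inr (by simp)), hs₃, mem_set_of_ne _ (by norm_num), hs₂,
        MachineState.set_mem, if_pos (by simp)]
    have hr₅ : Runs ω (setSlot x (reg (r + 1))) s₄
        (writeCost (.lit x) (reg (r + 1)) * (B σ + Va σ + Vb σ + 1)) (s₄.set 3 x (s.mem 3 x)) := by
      rw [← hx₄]
      refine Runs.set (b := B σ + Va σ + Vb σ) trivial ⟨trivial, ?_⟩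
      simp only [Expr.val, hx₄]; omega
    set s₅ := s₄.set 3 x (s.mem 3 x) with hs₅
    have hv₅ : s₅.mem 4 ((r + 2 : ℕ) : ℤ) = b.value s₃ := by
      rw [hs₅, mem_set_of_ne _ (by norm_num), hval₄]
    have hr₆ : Runs ω (setReg r (reg (r + 2))) s₅
        (writeCost (.lit r) (reg (r + 2)) * (B σ + Va σ + Vb σ + 1)) (s₅.set 4 r (b.value s₃)) := by
      rw [← hv₅]
      refine Runs.set (b := B σ + Va σ + Vb σ) trivial ⟨trivial, ?_⟩
      simp only [Expr.val, hv₅]; exact hvb.trans (by omega)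
    refine ⟨_, hr₁.seq (hr₂.seq (hr₃.seq (hr₄.seq (hr₅.seq hr₆)))), ?_, ?_⟩
    · rw [MachineState.set_mem, if_pos (by simp), value, h0, h2, henv]
      rfl
    · refine MachineState.Agree.set ⟨?_, fun a' i hi => ?_⟩ le_rfl _
      · exact ha₄.tosses.trans ha₂.tosses
      · by_cases h3 : a' = 3 ∧ i = x
        · obtain ⟨rfl, rfl⟩ := h3
          simp [hs₅, MachineState.set_mem]
        · rw [hs₅, MachineState.set_mem, if_neg h3,
            ha₄.mem _ _ (hi.imp_right fun h => by push_cast; omega), hs₃, MachineState.set_mem,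
            if_neg h3, ha₂.mem _ _ hi]

/-- The state in the `j`-th round of the loop in the program of a term. -/
structure LoopState (s : MachineState) (r x y : ℕ) (c m : ℤ) (acc : ℕ → ℤ) (j : ℕ)
    (s' : MachineState) : Prop where
  tosses : s'.tosses = s.tosses
  mem : ∀ a i, a ≠ 4 ∨ i < (r : ℤ) → ¬ (a = 3 ∧ (i = x ∨ i = y)) → s'.mem a i = s.mem a i
  count : s'.mem 4 r = c - j
  modulus : s'.mem 4 (r + 1) = m
  acc : s'.mem 4 (r + 2) = acc j
  oldx : s'.mem 4 (r + 3) = s.mem 3 x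
  oldy : s'.mem 4 (r + 4) = s.mem 3 y
  index : s'.mem 4 (r + 5) = j

/-- One round. The registers from r on hold: the rounds left, the modulus, the accumulator, the old
values of x and y, the index; the body starts at r + 6. The variable y is written before x, so that
for x = y the index prevails, as in the order of the updates in `eval`. -/
theorem loop_step {b : IntTerm} {s : MachineState} {o : FoldOp} {r x y : ℕ} {c m i : ℤ}
    {ω : ℕ → Bool} {n n' Tb j : ℕ} {f : ℕ → ℤ → ℤ}
    (hf : ∀ j v, f j v = b.eval (s.mem 0) (s.mem 2) (update (update (envOf s) y v) x j))
    (hs : BoundedState n' s)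
    (hb : ∀ s, BoundedState n' s → bitSize (b.value s) ≤ n ∧
      ∃ s', Runs ω (b.compile (r + 6)) s Tb s' ∧
        s'.mem 4 ((r + 6 : ℕ) : ℤ) = b.value s ∧ s.Agree (r + 6) s')
    (hj : bitSize (j : ℤ) ≤ n') (hseen : bitSize (o.seen (o.acc f m i j)) ≤ n')
    (hacc : bitSize (o.acc f m i j) ≤ n) (hm : bitSize m ≤ n) (hc : bitSize (c - j) ≤ n)
    (hjn : bitSize (j : ℤ) ≤ n) {s' : MachineState}
    (h : LoopState s r x y c m (o.acc f m i) j s') :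
    ∃ s'', Runs ω (.seq (setSlot y (o.seenExpr (reg (r + 2)))) (.seq (setSlot x (reg (r + 5)))
            (.seq (b.compile (r + 6))
            (.seq (setReg (r + 2) (o.expr (reg (r + 2)) (reg (r + 6)) (reg (r + 1))))
            (.seq (setReg (r + 5) (.add (reg (r + 5)) (.lit 1)))
              (setReg r (.sub (reg r) (.lit 1)))))))) s'
        (writeCost (.lit y) (o.seenExpr (reg (r + 2))) * (n + 1) +
        (writeCost (.lit x) (reg (r + 5)) * (n + 1) + (Tb +
        (writeCost (.lit (r + 2 : ℕ)) (o.expr (reg (r + 2)) (reg (r + 6)) (reg (r + 1))) * (n + 1) +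
        (writeCost (.lit (r + 5 : ℕ)) (.add (reg (r + 5)) (.lit 1)) * (n + 1) +
        writeCost (.lit r) (.sub (reg r) (.lit 1)) * (n + 1)))))) s'' ∧
      LoopState s r x y c m (o.acc f m i) (j + 1) s'' := by
  have hr₁ : Runs ω (setSlot y (o.seenExpr (reg (r + 2)))) s'
        (writeCost (.lit y) (o.seenExpr (reg (r + 2))) * (n + 1))
      (s'.set 3 y (o.seen (o.acc f m i j))) := by
    have : (o.seenExpr (reg (r + 2))).val s'.mem = o.seen (o.acc f m i j) := by
      rw [o.val_seenExpr, ← h.acc]; simp [Expr.val]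
    rw [← this]
    refine Runs.set (b := n) trivial (o.reads_seenExpr ⟨trivial, ?_⟩)
    simp only [Expr.val, Nat.cast_add, Nat.cast_ofNat, h.acc, hacc]
  set s₁ := s'.set 3 y (o.seen (o.acc f m i j)) with hs₁
  have hm₁ : s₁.mem 4 = s'.mem 4 := mem_set_of_ne _ (by norm_num) _ _
  have hr₂ : Runs ω (setSlot x (reg (r + 5))) s₁
        (writeCost (.lit x) (reg (r + 5)) * (n + 1)) (s₁.set 3 x j) := by
    have : s₁.mem 4 ((r + 5 : ℕ) : ℤ) = j := by rw [hm₁, ← h.index]; simp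
    rw [← this]
    refine Runs.set (b := n) trivial ⟨trivial, ?_⟩
    simp only [Expr.val, this, hjn]
  set s₂ := s₁.set 3 x j with hs₂
  have hm₂ : s₂.mem 4 = s'.mem 4 := (mem_set_of_ne _ (by norm_num) _ _).trans hm₁
  have henv : envOf s₂ = update (update (envOf s) y (o.seen (o.acc f m i j))) x j := by
    rw [hs₂, envOf_set, hs₁, envOf_set]
    funext z
    by_cases hx : z = x
    · simp [hx]
    · by_cases hy : z = y
      · subst hy; simp [Function.update_of_ne hx]
      · simp only [Function.update_of_ne hx, Function.update_of_ne hy]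
        exact h.mem _ _ (Or.inl (by norm_num)) (by simp [hx, hy])
  have harr : ∀ a, a ≠ 3 → a ≠ 4 → s₂.mem a = s.mem a := by
    intro a h3 h4
    rw [hs₂, mem_set_of_ne _ h3, hs₁, mem_set_of_ne _ h3]
    exact funext fun i => h.mem _ _ (Or.inl h4) (by simp [h3])
  have hval : b.value s₂ = f j (o.seen (o.acc f m i j)) := by
    rw [hf, value, harr 0 (by norm_num) (by norm_num), harr 2 (by norm_num) (by norm_num), henv]
  have hb₂ : BoundedState n' s₂ := by
    rw [BoundedState, harr 0 (by norm_num) (by norm_num), harr 2 (by norm_num) (by norm_num), henv]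
    exact (hs.update y hseen).update x hj
  obtain ⟨hbv, s₃, hr₃, hv₃, ha₃⟩ := hb s₂ hb₂
  have hreg : ∀ k : ℤ, k < 6 → s₃.mem 4 (r + k) = s'.mem 4 (r + k) := fun k hk => by
    rw [ha₃.mem _ _ (Or.inr (by push_cast; omega)), hm₂]
  have hreg0 : s₃.mem 4 r = s'.mem 4 r := by simpa using hreg 0 (by norm_num)
  have hr₄ : Runs ω (setReg (r + 2) (o.expr (reg (r + 2)) (reg (r + 6)) (reg (r + 1)))) s₃
        (writeCost (.lit (r + 2 : ℕ)) (o.expr (reg (r + 2)) (reg (r + 6)) (reg (r + 1))) * (n + 1))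
      (s₃.set 4 (r + 2 : ℕ) (o.acc f m i (j + 1))) := by
    have : (o.expr (reg (r + 2)) (reg (r + 6)) (reg (r + 1))).val s₃.mem =
        o.acc f m i (j + 1) := by
      rw [o.val_expr, FoldOp.acc, ← hval]
      simp only [Expr.val, hv₃]
      push_cast
      rw [hreg _ (by norm_num), hreg _ (by norm_num), h.acc, h.modulus]
    rw [← this]
    refine Runs.set (b := n) trivial (o.reads_expr ⟨trivial, ?_⟩ ⟨trivial, ?_⟩ ⟨trivial, ?_⟩)
    · simp only [Expr.val]; push_cast; rw [hreg _ (by norm_num), h.acc]; exact hacc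
    · simp only [Expr.val, hv₃]; exact hbv
    · simp only [Expr.val]; push_cast; rw [hreg _ (by norm_num), h.modulus]; exact hm
  set s₄ := s₃.set 4 (r + 2 : ℕ) (o.acc f m i (j + 1)) with hs₄
  have hr₅ : Runs ω (setReg (r + 5) (.add (reg (r + 5)) (.lit 1))) s₄
        (writeCost (.lit (r + 5 : ℕ)) (.add (reg (r + 5)) (.lit 1)) * (n + 1))
      (s₄.set 4 (r + 5 : ℕ) (j + 1 : ℕ)) := by
    have : s₄.mem 4 ((r + 5 : ℕ) : ℤ) = j := by
      rw [hs₄, MachineState.set_mem, if_neg (by simp)]; push_cast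
      rw [hreg _ (by norm_num), h.index]
    have h' : ((j + 1 : ℕ) : ℤ) = (Expr.add (reg (r + 5)) (.lit 1)).val s₄.mem := by
      simp only [Expr.val, this]; push_cast; rfl
    rw [h']
    refine Runs.set (b := n) trivial ⟨⟨trivial, ?_⟩, trivial⟩
    simp only [Expr.val, this, hjn]
  set s₅ := s₄.set 4 (r + 5 : ℕ) (j + 1 : ℕ) with hs₅
  have hr₆ : Runs ω (setReg r (.sub (reg r) (.lit 1))) s₅
        (writeCost (.lit r) (.sub (reg r) (.lit 1)) * (n + 1))
      (s₅.set 4 r (c - (j + 1 : ℕ))) := by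
    have : s₅.mem 4 (r : ℤ) = c - j := by
      rw [hs₅, MachineState.set_mem, if_neg (by simp), hs₄, MachineState.set_mem,
        if_neg (by simp), hreg0, h.count]
    have h' : (c - (j + 1 : ℕ)) = (Expr.sub (reg r) (.lit 1)).val s₅.mem := by
      simp only [Expr.val, this]; push_cast; ring
    rw [h']
    refine Runs.set (b := n) trivial ⟨⟨trivial, ?_⟩, trivial⟩
    simp only [Expr.val, this, hc]
  refine ⟨_, hr₁.seq (hr₂.seq (hr₃.seq (hr₄.seq (hr₅.seq hr₆)))), ?_⟩
  refine ⟨?_, ?_, ?_, ?_, ?_, ?_, ?_, ?_⟩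
  · exact ha₃.tosses.trans h.tosses
  · intro a z hz hz'
    have e1 : ¬ (a = 4 ∧ z = (r + 2 : ℕ)) := by push_cast; omega
    have e2 : ¬ (a = 4 ∧ z = (r + 5 : ℕ)) := by push_cast; omega
    have e3 : ¬ (a = 4 ∧ z = r) := by omega
    have e4 : ¬ (a = 3 ∧ z = x) := fun h => hz' ⟨h.1, Or.inl h.2⟩
    have e5 : ¬ (a = 3 ∧ z = y) := fun h => hz' ⟨h.1, Or.inr h.2⟩
    rw [MachineState.set_mem, if_neg e3, hs₅, MachineState.set_mem, if_neg e2, hs₄,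
      MachineState.set_mem, if_neg e1, ha₃.mem _ _ (by push_cast; omega), hs₂,
      MachineState.set_mem, if_neg e4, hs₁, MachineState.set_mem, if_neg e5, h.mem _ _ hz hz']
  · simp [MachineState.set_mem]
  · simp [MachineState.set_mem, hs₅, hs₄, hreg, h.modulus]
  · simp [MachineState.set_mem, hs₅, hs₄]
  · simp [MachineState.set_mem, hs₅, hs₄, hreg, h.oldx]
  · simp [MachineState.set_mem, hs₅, hs₄, hreg, h.oldy]
  · simp [MachineState.set_mem, hs₅]

theorem compilesCorrectly_loop (o : FoldOp) (x y : ℕ) {c i m b : IntTerm} (hcount : c.IsCount)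
    (hwc : c.WF) (hwi : i.WF) (hwm : m.WF) (hwb : b.WF)
    (hc : c.CompilesCorrectly) (hi : i.CompilesCorrectly) (hm : m.CompilesCorrectly)
    (hb : b.CompilesCorrectly) : CompilesCorrectly (loop o x y c i m b) := by
  intro B hB r
  obtain ⟨Tc, hTc, hc⟩ := hc B hB r
  obtain ⟨Vc, hVc, hvc⟩ := c.eval_bounded hwc B hB
  obtain ⟨Tm, hTm, hm⟩ := hm B hB (r + 1)
  obtain ⟨Vm, hVm, hvm⟩ := m.eval_bounded hwm B hB
  obtain ⟨Ti, hTi, hi⟩ := hi B hB (r + 2)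
  obtain ⟨Vi, hVi, hvi⟩ := i.eval_bounded hwi B hB
  have hN' : PolyBounded fun σ => B σ + (Vc σ + 1) + (Vi σ + 2 * Vm σ + 3) :=
    (hB.add (hVc.add (.const 1))).add ((hVi.add ((PolyBounded.const 2).mul hVm)).add (.const 3))
  -- `N'` bounds the data of the states in which the body starts. The later bound `N` also covers
  -- the registers, among them the accumulator, which in sums and products outgrows what the body
  -- sees.
  set N' : ℕ → ℕ := fun σ => B σ + (Vc σ + 1) + (Vi σ + 2 * Vm σ + 3) with hN'def
  obtain ⟨Tb, hTb, hb⟩ := hb N' hN' (r + 6)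
  obtain ⟨Vb, hVb, hvb⟩ := b.eval_bounded hwb N' hN'
  have hN : PolyBounded fun σ => N' σ + Vc σ + Vi σ + Vb σ + (Vi σ + 2 * Vm σ + 3 + Vc σ * Vb σ) :=
    (((hN'.add hVc).add hVi).add hVb).add
      (((hVi.add ((PolyBounded.const 2).mul hVm)).add (.const 3)).add (hVc.mul hVb))
  set N : ℕ → ℕ :=
    fun σ => N' σ + Vc σ + Vi σ + Vb σ + (Vi σ + 2 * Vm σ + 3 + Vc σ * Vb σ) with hNdef
  let body : ℕ → ℕ := fun σ => writeCost (.lit y) (o.seenExpr (reg (r + 2))) * (N σ + 1) +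
        (writeCost (.lit x) (reg (r + 5)) * (N σ + 1) + (Tb σ +
        (writeCost (.lit (r + 2 : ℕ)) (o.expr (reg (r + 2)) (reg (r + 6)) (reg (r + 1))) *
          (N σ + 1) +
        (writeCost (.lit (r + 5 : ℕ)) (.add (reg (r + 5)) (.lit 1)) * (N σ + 1) +
        writeCost (.lit r) (.sub (reg r) (.lit 1)) * (N σ + 1)))))
  refine ⟨fun σ => Tc σ + (Tm σ + (Ti σ + (writeCost (.lit (r + 3 : ℕ)) (slot x) * (N σ + 1) +
    (writeCost (.lit (r + 4 : ℕ)) (slot y) * (N σ + 1) +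
    (writeCost (.lit (r + 5 : ℕ)) (.lit 0) * (N σ + 1) +
    ((Vc σ + 1) * (body σ + (reg r).costWeight * (N σ + 1) + 1) +
    (writeCost (.lit x) (reg (r + 3)) * (N σ + 1) +
    (writeCost (.lit y) (reg (r + 4)) * (N σ + 1) +
    writeCost (.lit r) (reg (r + 2)) * (N σ + 1))))))))), ?_, ?_⟩
  · have h2 : ∀ c, PolyBounded fun σ => c * (N σ + 1) :=
      fun c => (PolyBounded.const c).mul (hN.add (.const 1))
    exact hTc.add (hTm.add (hTi.add ((h2 _).add ((h2 _).add ((h2 _).add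
      (((hVc.add (.const 1)).mul ((((h2 _).add ((h2 _).add (hTb.add ((h2 _).add
        ((h2 _).add (h2 _)))))).add (h2 _)).add (.const 1))).add
          ((h2 _).add ((h2 _).add (h2 _)))))))))
  · intro σ ω s hs
    obtain ⟨hbc, hcc⟩ := hvc σ _ _ _ hs
    have hcc := hcc hcount
    have hbm := (hvm σ _ _ _ hs).1
    have hbi := (hvi σ _ _ _ hs).1
    change bitSize (c.value s) ≤ _ at hbc
    change (c.value s).natAbs ≤ _ at hcc
    change bitSize (m.value s) ≤ _ at hbm
    change bitSize (i.value s) ≤ _ at hbi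
    have hxb : bitSize (s.mem 3 x) ≤ B σ := hs.env x
    have hyb : bitSize (s.mem 3 y) ≤ B σ := hs.env y
    have hNN : N' σ = B σ + (Vc σ + 1) + (Vi σ + 2 * Vm σ + 3) := rfl
    have hNN' : N σ = N' σ + Vc σ + Vi σ + Vb σ + (Vi σ + 2 * Vm σ + 3 + Vc σ * Vb σ) := rfl
    obtain ⟨s₁, hr₁, hval₁, ha₁⟩ := hc σ ω s hs
    obtain ⟨s₂, hr₂, hval₂, ha₂⟩ := hm σ ω s₁ (hs.agree ha₁)
    obtain ⟨s₃, hr₃, hval₃, ha₃⟩ := hi σ ω s₂ ((hs.agree ha₁).agree ha₂)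
    rw [m.value_agree ha₁] at hval₂
    rw [i.value_agree ha₂, i.value_agree ha₁] at hval₃
    have ha : s.Agree r s₃ := (ha₁.trans (ha₂.mono (by omega))).trans (ha₃.mono (by omega))
    have hx₃ : s₃.mem 3 x = s.mem 3 x := ha.mem _ _ (Or.inl (by norm_num))
    have hy₃ : s₃.mem 3 y = s.mem 3 y := ha.mem _ _ (Or.inl (by norm_num))
    have hc₃ : s₃.mem 4 r = c.value s := by
      rw [ha₃.mem _ _ (Or.inr (by simp)), ha₂.mem _ _ (Or.inr (by simp)), hval₁]
    have hm₃ : s₃.mem 4 (r + 1) = m.value s := by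
      rw [ha₃.mem _ _ (Or.inr (by simp)), ← hval₂]; simp
    have hi₃ : s₃.mem 4 (r + 2) = i.value s := by rw [← hval₃]; simp
    have hr₄ : Runs ω (setReg (r + 3) (slot x)) s₃
        (writeCost (.lit (r + 3 : ℕ)) (slot x) * (N σ + 1)) (s₃.set 4 (r + 3 : ℕ) (s.mem 3 x)) := by
      rw [← hx₃]
      refine Runs.set (b := N σ) trivial ⟨trivial, ?_⟩
      simp only [Expr.val, hx₃]; omega
    set s₄ := s₃.set 4 (r + 3 : ℕ) (s.mem 3 x) with hs₄
    have hy₄ : s₄.mem 3 y = s.mem 3 y := by rw [hs₄, mem_set_of_ne _ (by norm_num), hy₃]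
    have hr₅ : Runs ω (setReg (r + 4) (slot y)) s₄
        (writeCost (.lit (r + 4 : ℕ)) (slot y) * (N σ + 1)) (s₄.set 4 (r + 4 : ℕ) (s.mem 3 y)) := by
      rw [← hy₄]
      refine Runs.set (b := N σ) trivial ⟨trivial, ?_⟩
      simp only [Expr.val, hy₄]; omega
    set s₅ := s₄.set 4 (r + 4 : ℕ) (s.mem 3 y) with hs₅
    have hr₆ : Runs ω (setReg (r + 5) (.lit 0)) s₅
        (writeCost (.lit (r + 5 : ℕ)) (.lit 0) * (N σ + 1)) (s₅.set 4 (r + 5 : ℕ) 0) :=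
      Runs.set (b := N σ) trivial trivial
    set f : ℕ → ℤ → ℤ :=
      fun j v => b.eval (s.mem 0) (s.mem 2) (update (update (envOf s) y v) x j) with hf
    have hbits := o.bitSize_acc_le (f := f) (m := m.value s) (i := i.value s)
      (k := (c.value s).toNat) (b := Vb σ) (fun j hj v hv => (hvb σ _ _ _
        (((hs.mono (by omega)).update y (by omega)).update x
          ((bitSize_le_natAbs_add_one _).trans (by simp only [Int.natAbs_natCast]; omega)))).1)
    have hbits' : ∀ j ≤ (c.value s).toNat,
        bitSize (o.acc f (m.value s) (i.value s) j) ≤ N σ := fun j hj => by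
      have h1 := (hbits j hj).1
      have h2 : j * Vb σ ≤ Vc σ * Vb σ := Nat.mul_le_mul_right _ (by omega)
      omega
    have hcj : ∀ j ≤ (c.value s).toNat, bitSize (c.value s - j) ≤ N σ := fun j hj =>
      (bitSize_sub_le _ _).trans (by
        have := (bitSize_le_natAbs_add_one (j : ℤ)); simp only [Int.natAbs_natCast] at this; omega)
    obtain ⟨s₇, hr₇, hI⟩ := Runs.loop (ω := ω) (T := body σ) (e := reg r) (b := N σ)
      (p := _) (s := s₅.set 4 (r + 5 : ℕ) 0)
      (I := LoopState s r x y (c.value s) (m.value s) (o.acc f (m.value s) (i.value s)))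
      (c.value s).toNat
      (fun j hj s' h => ⟨trivial, by simp only [Expr.val, h.count]; exact hcj j hj⟩)
      (fun j hj s' h => by simp only [Expr.val, h.count]; omega)
      (fun j hj s' h => by
        have hjb := (bitSize_le_natAbs_add_one (j : ℤ))
        simp only [Int.natAbs_natCast] at hjb
        exact loop_step (n := N σ) (n' := N' σ) (b := b) (fun _ _ => rfl) (hs.mono (by omega))
          (fun s hs => ⟨(hvb σ _ _ _ hs).1.trans (by omega), hb σ ω s hs⟩)
          (by omega) ((hbits j hj.le).2.trans (by omega)) (hbits' j hj.le) (by omega)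
          (hcj j hj.le) (by omega) h)
      ⟨ha.tosses, fun a' z hz hz' => by
          rw [MachineState.set_mem, if_neg (by push_cast; omega), hs₅, MachineState.set_mem,
            if_neg (by push_cast; omega), hs₄, MachineState.set_mem,
            if_neg (by push_cast; omega), ha.mem _ _ hz],
        by simp [MachineState.set_mem, hs₅, hs₄, hc₃],
        by simp [MachineState.set_mem, hs₅, hs₄, hm₃],
        by simp [MachineState.set_mem, hs₅, hs₄, hi₃, FoldOp.acc],
        by simp [MachineState.set_mem, hs₅, hs₄],
        by simp [MachineState.set_mem, hs₅, hs₄],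
        by simp [MachineState.set_mem]⟩
    have hr₈ : Runs ω (setSlot x (reg (r + 3))) s₇
        (writeCost (.lit x) (reg (r + 3)) * (N σ + 1)) (s₇.set 3 x (s.mem 3 x)) := by
      have : s₇.mem 4 ((r + 3 : ℕ) : ℤ) = s.mem 3 x := by rw [← hI.oldx]; simp
      rw [← this]
      refine Runs.set (b := N σ) trivial ⟨trivial, ?_⟩
      simp only [Expr.val, this]; omega
    set s₈ := s₇.set 3 x (s.mem 3 x) with hs₈
    have hr₉ : Runs ω (setSlot y (reg (r + 4))) s₈
        (writeCost (.lit y) (reg (r + 4)) * (N σ + 1)) (s₈.set 3 y (s.mem 3 y)) := by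
      have : s₈.mem 4 ((r + 4 : ℕ) : ℤ) = s.mem 3 y := by
        rw [hs₈, mem_set_of_ne _ (by norm_num), ← hI.oldy]; simp
      rw [← this]
      refine Runs.set (b := N σ) trivial ⟨trivial, ?_⟩
      simp only [Expr.val, this]; omega
    set s₉ := s₈.set 3 y (s.mem 3 y) with hs₉
    have hr₁₀ : Runs ω (setReg r (reg (r + 2))) s₉
        (writeCost (.lit r) (reg (r + 2)) * (N σ + 1))
        (s₉.set 4 r (o.acc f (m.value s) (i.value s) (c.value s).toNat)) := by
      have : s₉.mem 4 ((r + 2 : ℕ) : ℤ) = o.acc f (m.value s) (i.value s) (c.value s).toNat := by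
        rw [hs₉, mem_set_of_ne _ (by norm_num), hs₈, mem_set_of_ne _ (by norm_num), ← hI.acc]; simp
      rw [← this]
      refine Runs.set (b := N σ) trivial ⟨trivial, ?_⟩
      simp only [Expr.val, this]; exact hbits' _ le_rfl
    refine ⟨_, hr₁.seq (hr₂.seq (hr₃.seq (hr₄.seq (hr₅.seq (hr₆.seq ((hr₇.mono ?_).seq
      (hr₈.seq (hr₉.seq hr₁₀)))))))), ?_, ?_⟩
    · exact Nat.mul_le_mul_right _ (by omega)
    · rw [MachineState.set_mem, if_pos (by simp)]
      rfl
    · refine MachineState.Agree.set (s' := s₉) ⟨hI.tosses, fun a' z hz => ?_⟩ le_rfl _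
      -- Outside the registers only the entries of x and y were touched, and both have been
      -- restored.
      by_cases hy : a' = 3 ∧ z = y
      · obtain ⟨rfl, rfl⟩ := hy
        simp [hs₉, MachineState.set_mem]
      · rw [hs₉, MachineState.set_mem, if_neg hy]
        by_cases hx : a' = 3 ∧ z = x
        · obtain ⟨rfl, rfl⟩ := hx
          simp [hs₈, MachineState.set_mem]
        · rw [hs₈, MachineState.set_mem, if_neg hx, hI.mem _ _ hz (by tauto)]

theorem compilesCorrectly (t : IntTerm) (ht : t.WF) : t.CompilesCorrectly := by
  induction t with
  | lit z => exact compilesCorrectly_lit z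
  | var x => exact compilesCorrectly_var x
  | inp t h => exact compilesCorrectly_inp ht (h ht)
  | coin t h => exact compilesCorrectly_coin ht (h ht)
  | bin o a b ha hb => exact compilesCorrectly_bin o ht.1 ht.2 (ha ht.1) (hb ht.2)
  | ite c a b hc ha hb =>
    exact compilesCorrectly_ite ht.1 (hc ht.1) (ha ht.2.1) (hb ht.2.2)
  | size t h => exact compilesCorrectly_size ht (h ht)
  | lett x a b ha hb => exact compilesCorrectly_lett x ht.1 ht.2 (ha ht.1) (hb ht.2)
  | loop o x y c i m b hc hi hm hb =>
    obtain ⟨h0, h1, h2, h3, h4⟩ := ht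
    exact compilesCorrectly_loop o x y h0 h1 h2 h3 h4 (hc h1) (hi h2) (hm h3) (hb h4)

end IntTerm

/-! ### Programs that write lists of integers -/

theorem Runs.setTo {ω : ℕ → Bool} {s : MachineState} {a : ℕ} {i e : Expr} {b : ℕ} {v w : ℤ}
    (hi : i.Reads s.mem b) (he : e.Reads s.mem b) (hv : i.val s.mem = v) (hw : e.val s.mem = w) :
    Runs ω (.write a i e) s (writeCost i e * (b + 1)) (s.set a v w) :=
  hv ▸ hw ▸ Runs.set hi he

theorem bitSize_natCast_le (n : ℕ) : bitSize (n : ℤ) ≤ n + 1 := bitSize_le_natAbs_add_one _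

/-- Lists of values of terms, with bounded loops. -/
inductive ListTerm
  | nil
  | emit (t : IntTerm)
  | append (a b : ListTerm)
  | loop (x : ℕ) (c : IntTerm) (b : ListTerm)

namespace ListTerm

open Function (update)
open IntTerm

/-- The list for the input `I`, the coin tosses `C` and the values `env` of the variables. -/
def eval (I C : ℤ → ℤ) : ListTerm → (ℕ → ℤ) → List ℤ
  | nil, _ => []
  | emit t, env => [t.eval I C env]
  | append a b, env => a.eval I C env ++ b.eval I C env
  | loop x c b, env =>
    (List.range (c.eval I C env).toNat).flatMap fun j : ℕ => b.eval I C (update env x j)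

/-- All numbers of rounds of loops are given by terms with polynomially bounded values. -/
def WF : ListTerm → Prop
  | nil => True
  | emit t => t.WF
  | append a b => a.WF ∧ b.WF
  | loop _ c b => c.IsCount ∧ c.WF ∧ b.WF

theorem length_flatMap_range_le {f : ℕ → List ℤ} {k n : ℕ} (h : ∀ j < k, (f j).length ≤ n) :
    ((List.range k).flatMap f).length ≤ k * n := by
  induction k with
  | zero => simp
  | succ k ih =>
    have := ih fun j hj => h j (by omega)
    have := h k (by omega)
    simp only [List.range_succ, List.flatMap_append, List.length_append, List.flatMap_cons,
      List.flatMap_nil, List.append_nil]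
    rw [add_mul]
    omega

/-- The length of the output is itself a number that the machine reads and writes, so it has to be
bounded before the running time can be. -/
theorem length_eval_bounded (t : ListTerm) (ht : t.WF) : ∀ B, PolyBounded B →
    ∃ T, PolyBounded T ∧ ∀ σ I C env, Bounded (B σ) I C env → (t.eval I C env).length ≤ T σ := by
  induction t with
  | nil => exact fun B _ => ⟨fun _ => 0, .const 0, fun _ _ _ _ _ => le_rfl⟩
  | emit t => exact fun B _ => ⟨fun _ => 1, .const 1, fun _ _ _ _ _ => le_rfl⟩
  | append a b iha ihb =>
    intro B hB
    obtain ⟨Ta, hTa, ha⟩ := iha ht.1 B hB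
    obtain ⟨Tb, hTb, hb⟩ := ihb ht.2 B hB
    refine ⟨_, hTa.add hTb, fun σ I C env h => ?_⟩
    have := ha σ I C env h
    have := hb σ I C env h
    simp only [eval, List.length_append]
    omega
  | loop x c b ihb =>
    intro B hB
    obtain ⟨Tc, hTc, hc⟩ := c.eval_bounded ht.2.1 B hB
    obtain ⟨Tb, hTb, hb⟩ := ihb ht.2.2 _ (hB.add (hTc.add (.const 1)))
    refine ⟨_, hTc.mul hTb, fun σ I C env h => ?_⟩
    have hc := (hc σ I C env h).2 ht.1
    rw [eval]
    refine (length_flatMap_range_le fun j hj => hb σ I C (update env x j) ?_).trans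
      (Nat.mul_le_mul_right _ (show (c.eval I C env).toNat ≤ Tc σ by omega))
    exact (h.mono (Nat.le_add_right _ _)).update x ((bitSize_natCast_le j).trans (by omega))

/-- A program that appends the list to the output, using only registers from `r` on. -/
def compile : ListTerm → ℕ → Prog
  | nil, _ => .skip
  | emit t, r => .seq (t.compile r) (.seq
      (.write 1 (.add (.read 1 (.lit 0)) (.lit 1)) (reg r))
      (.write 1 (.lit 0) (.add (.read 1 (.lit 0)) (.lit 1))))
  | append a b, r => .seq (a.compile r) (b.compile r)
  | loop x c b, r =>
    .seq (c.compile r) (.seq (setReg (r + 1) (slot x)) (.seq (setReg (r + 2) (.lit 0)) (.seq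
      (.loop (reg r) (.seq (setSlot x (reg (r + 2))) (.seq (b.compile (r + 3))
        (.seq (setReg (r + 2) (.add (reg (r + 2)) (.lit 1))) (setReg r (.sub (reg r) (.lit 1)))))))
      (setSlot x (reg (r + 1))))))

/-- `s'` differs from `s` only in the output and in registers with index at least `r`. -/
def OutAgree (r : ℕ) (s s' : MachineState) : Prop :=
  ∀ a i, a ≠ 1 → a ≠ 4 ∨ i < (r : ℤ) → s'.mem a i = s.mem a i

theorem OutAgree.array {r : ℕ} {s s' : MachineState} (h : OutAgree r s s') {a : ℕ} (h1 : a ≠ 1)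
    (h4 : a ≠ 4) : s'.mem a = s.mem a :=
  funext fun i => h a i h1 (Or.inl h4)

theorem OutAgree.envOf {r : ℕ} {s s' : MachineState} (h : OutAgree r s s') :
    envOf s' = envOf s :=
  funext fun _ => h _ _ (by norm_num) (Or.inl (by norm_num))

/-- The list in a state. -/
def value (t : ListTerm) (s : MachineState) : List ℤ := t.eval (s.mem 0) (s.mem 2) (envOf s)

theorem value_congr (t : ListTerm) {s s' : MachineState} (h0 : s'.mem 0 = s.mem 0)
    (h2 : s'.mem 2 = s.mem 2) (h3 : IntTerm.envOf s' = IntTerm.envOf s) :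
    t.value s' = t.value s := by
  rw [value, value, h0, h2, h3]

theorem _root_.MachineState.HasOutput.congr {s s' : MachineState} {l : List ℤ}
    (h : s.HasOutput l) (h1 : s'.mem 1 = s.mem 1) : s'.HasOutput l := by
  rw [MachineState.HasOutput, h1]
  exact h

/-- Correctness and polynomial running time of the program of a list. -/
def CompilesCorrectly (t : ListTerm) : Prop :=
  ∀ B, PolyBounded B → ∀ r, ∃ T, PolyBounded T ∧ ∀ σ ω s l, BoundedState (B σ) s →
    s.HasOutput l → l.length ≤ B σ →
    ∃ s', Runs ω (t.compile r) s (T σ) s' ∧ s'.HasOutput (l ++ t.value s) ∧ OutAgree r s s'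

theorem compilesCorrectly_emit {t : IntTerm} (ht : t.WF) : CompilesCorrectly (emit t) := by
  intro B hB r
  obtain ⟨T, hT, h⟩ := t.compilesCorrectly ht B hB r
  obtain ⟨V, hV, hv⟩ := t.eval_bounded ht B hB
  refine ⟨fun σ => T σ + (writeCost (.add (.read 1 (.lit 0)) (.lit 1)) (reg r) *
    (B σ + 1 + V σ + 1) + writeCost (.lit 0) (.add (.read 1 (.lit 0)) (.lit 1)) *
    (B σ + 1 + V σ + 1)), ?_, ?_⟩
  · have h1 : ∀ c, PolyBounded _ := fun c =>
      (PolyBounded.const c).mul (((hB.add (.const 1)).add hV).add (.const 1))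
    exact hT.add ((h1 _).add (h1 _))
  · intro σ ω s l hs hl hlen
    obtain ⟨s₁, hr₁, hval₁, ha₁⟩ := h σ ω s hs
    have hv : bitSize (t.value s) ≤ V σ := (hv σ _ _ _ hs).1
    have h1 : s₁.mem 1 = s.mem 1 := ha₁.array (by norm_num)
    have hlen' := bitSize_natCast_le l.length
    have hr₂ : Runs ω (.write 1 (.add (.read 1 (.lit 0)) (.lit 1)) (reg r)) s₁ _ _ :=
      Runs.setTo (b := B σ + 1 + V σ) (v := (l.length : ℤ) + 1) (w := t.value s)
        ⟨⟨trivial, by simp only [Expr.val, h1, hl.1]; omega⟩, trivial⟩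
        ⟨trivial, by simp only [Expr.val, hval₁]; omega⟩
        (by simp [Expr.val, h1, hl.1]) (by simp only [Expr.val, hval₁])
    have h10 : (s₁.set 1 ((l.length : ℤ) + 1) (t.value s)).mem 1 0 = l.length := by
      rw [MachineState.set_mem, if_neg (by omega), h1, hl.1]
    have hr₃ : Runs ω (.write 1 (.lit 0) (.add (.read 1 (.lit 0)) (.lit 1)))
        (s₁.set 1 ((l.length : ℤ) + 1) (t.value s)) _ _ :=
      Runs.setTo (b := B σ + 1 + V σ) (v := 0) (w := (l.length : ℤ) + 1)
        trivial ⟨⟨trivial, by simp only [Expr.val, h10]; omega⟩, trivial⟩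
        rfl (by simp only [Expr.val, h10])
    refine ⟨_, hr₁.seq (hr₂.seq hr₃), ⟨?_, ?_⟩, ?_⟩
    · simp [MachineState.set_mem, value, eval]
    · intro i hi
      have hi : i < l.length + 1 := by simpa [value, eval] using hi
      rw [MachineState.set_mem, if_neg (by omega), MachineState.set_mem]
      rcases Nat.lt_succ_iff_lt_or_eq.1 hi with hi | rfl
      · rw [if_neg (by omega), h1, hl.2 i hi, List.getD_append _ _ _ _ hi]
      · rw [if_pos ⟨rfl, rfl⟩, List.getD_append_right _ _ _ _ le_rfl]
        simp [value, eval, IntTerm.value]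
    · intro a i ha hi
      rw [MachineState.set_mem, if_neg (by tauto), MachineState.set_mem, if_neg (by tauto),
        ha₁.mem _ _ hi]

/-- The state in the `j`-th round of the loop in the program of a list. -/
structure LoopState (s : MachineState) (r x : ℕ) (c : ℤ) (l : ℕ → List ℤ) (j : ℕ)
    (s' : MachineState) : Prop where
  mem : ∀ a i, a ≠ 1 → a ≠ 4 ∨ i < (r : ℤ) → ¬ (a = 3 ∧ i = x) → s'.mem a i = s.mem a i
  count : s'.mem 4 r = c - j
  oldx : s'.mem 4 (r + 1) = s.mem 3 x
  index : s'.mem 4 (r + 2) = j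
  out : s'.HasOutput (l j)

/-- The invariant contains the output so far: `l` and the lists of the first j rounds. The a priori
bound on its length makes the induction hypothesis for the body applicable with one and the same
bound in all rounds. -/
theorem compilesCorrectly_loop (x : ℕ) {c : IntTerm} {b : ListTerm} (hcount : c.IsCount)
    (hwc : c.WF) (hwb : b.WF) (hb : b.CompilesCorrectly) : CompilesCorrectly (loop x c b) := by
  intro B hB r
  obtain ⟨Tc, hTc, hc⟩ := c.compilesCorrectly hwc B hB r
  obtain ⟨Vc, hVc, hvc⟩ := c.eval_bounded hwc B hB
  obtain ⟨Vb, hVb, hvb⟩ := b.length_eval_bounded hwb _ (hB.add (hVc.add (.const 1)))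
  have hN : PolyBounded fun σ => B σ + (Vc σ + 1) + Vc σ * Vb σ :=
    (hB.add (hVc.add (.const 1))).add (hVc.mul hVb)
  set N : ℕ → ℕ := fun σ => B σ + (Vc σ + 1) + Vc σ * Vb σ with hNdef
  obtain ⟨Tb, hTb, hb⟩ := hb N hN (r + 3)
  let body : ℕ → ℕ := fun σ => writeCost (.lit x) (reg (r + 2)) * (N σ + 1) + (Tb σ +
    (writeCost (.lit (r + 2 : ℕ)) (.add (reg (r + 2)) (.lit 1)) * (N σ + 1) +
      writeCost (.lit r) (.sub (reg r) (.lit 1)) * (N σ + 1)))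
  refine ⟨fun σ => Tc σ + (writeCost (.lit (r + 1 : ℕ)) (slot x) * (N σ + 1) +
    (writeCost (.lit (r + 2 : ℕ)) (.lit 0) * (N σ + 1) +
    ((Vc σ + 1) * (body σ + (reg r).costWeight * (N σ + 1) + 1) +
    writeCost (.lit x) (reg (r + 1)) * (N σ + 1)))), ?_, ?_⟩
  · have h2 : ∀ c, PolyBounded fun σ => c * (N σ + 1) :=
      fun c => (PolyBounded.const c).mul (hN.add (.const 1))
    exact hTc.add ((h2 _).add ((h2 _).add (((hVc.add (.const 1)).mul
      ((((h2 _).add (hTb.add ((h2 _).add (h2 _)))).add (h2 _)).add (.const 1))).add (h2 _))))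
  · intro σ ω s l hs hl hlen
    obtain ⟨hbc, hcc⟩ := hvc σ _ _ _ hs
    have hcc := hcc hcount
    change bitSize (c.value s) ≤ _ at hbc
    change (c.value s).natAbs ≤ _ at hcc
    have hxb : bitSize (s.mem 3 x) ≤ B σ := hs.env x
    have hNN : N σ = B σ + (Vc σ + 1) + Vc σ * Vb σ := rfl
    obtain ⟨s₁, hr₁, hval₁, ha₁⟩ := hc σ ω s hs
    have hx₁ : s₁.mem 3 x = s.mem 3 x := ha₁.mem _ _ (Or.inl (by norm_num))
    have hr₂ : Runs ω (setReg (r + 1) (slot x)) s₁ _ _ :=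
      Runs.setTo (b := N σ) (v := (r : ℤ) + 1) (w := s.mem 3 x) trivial
        ⟨trivial, by simp only [Expr.val, hx₁]; omega⟩ (by simp [Expr.val])
        (by simp only [Expr.val, hx₁])
    set s₂ := s₁.set 4 ((r : ℤ) + 1) (s.mem 3 x) with hs₂
    have hr₃ : Runs ω (setReg (r + 2) (.lit 0)) s₂ _ _ :=
      Runs.setTo (b := N σ) (v := (r : ℤ) + 2) (w := 0) trivial trivial (by simp [Expr.val]) rfl
    set f : ℕ → List ℤ := fun j => b.eval (s.mem 0) (s.mem 2) (update (envOf s) x j) with hf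
    have hlenf : ∀ j < (c.value s).toNat, (f j).length ≤ Vb σ := fun j hj =>
      hvb σ _ _ _ ((hs.mono (Nat.le_add_right _ _)).update x
        ((bitSize_natCast_le j).trans (by omega)))
    have hcj : ∀ j ≤ (c.value s).toNat, bitSize (c.value s - j) ≤ N σ := fun j hj =>
      (bitSize_le_of_natAbs_le (b := c.value s) (by omega)).trans (hbc.trans (by omega))
    obtain ⟨s₄, hr₄, hI⟩ := Runs.loop (ω := ω) (T := body σ) (e := reg r) (b := N σ)
      (p := .seq (setSlot x (reg (r + 2))) (.seq (b.compile (r + 3))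
        (.seq (setReg (r + 2) (.add (reg (r + 2)) (.lit 1)))
          (setReg r (.sub (reg r) (.lit 1))))))
      (s := s₂.set 4 ((r : ℤ) + 2) 0)
      (I := LoopState s r x (c.value s) fun j => l ++ (List.range j).flatMap f)
      (c.value s).toNat
      (fun j hj s' h => ⟨trivial, by simp only [Expr.val, h.count]; exact hcj j hj⟩)
      (fun j hj s' h => by simp only [Expr.val, h.count]; omega)
      (fun j hj s' h => by
        have hjb := bitSize_natCast_le j
        have hr₁ : Runs ω (setSlot x (reg (r + 2))) s' _ _ :=
          Runs.setTo (b := N σ) (v := (x : ℤ)) (w := j) trivial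
            ⟨trivial, by simp only [Expr.val]; push_cast; rw [h.index]; omega⟩ rfl
            (by simp only [Expr.val]; push_cast; rw [h.index])
        set s₁ := s'.set 3 (x : ℤ) j with hs₁
        have harr : ∀ a, a ≠ 1 → a ≠ 3 → a ≠ 4 → s₁.mem a = s.mem a := by
          intro a h1 h3 h4
          rw [hs₁, mem_set_of_ne _ h3]
          exact funext fun i => h.mem _ _ h1 (Or.inl h4) (by simp [h3])
        have henv : envOf s₁ = update (envOf s) x j := by
          rw [hs₁, envOf_set]
          funext z
          by_cases hx : z = x
          · simp [hx]
          · simp only [Function.update_of_ne hx]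
            exact h.mem _ _ (by norm_num) (Or.inl (by norm_num)) (by simp [hx])
        have hval : b.value s₁ = f j := by
          rw [hf, value, harr 0 (by norm_num) (by norm_num) (by norm_num),
            harr 2 (by norm_num) (by norm_num) (by norm_num), henv]
        have hbs : BoundedState (N σ) s₁ := by
          rw [BoundedState, harr 0 (by norm_num) (by norm_num) (by norm_num),
            harr 2 (by norm_num) (by norm_num) (by norm_num), henv]
          exact (hs.mono (by omega)).update x (by omega)
        have hlen' := length_flatMap_range_le (f := f) (k := j) (n := Vb σ)
          fun i hi => hlenf i (by omega)
        have hmul : j * Vb σ ≤ Vc σ * Vb σ := Nat.mul_le_mul_right _ (by omega)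
        obtain ⟨s₂, hr₂, ho₂, ha₂⟩ := hb σ ω s₁ _ hbs
          (h.out.congr (mem_set_of_ne _ (by norm_num) _ _))
          (by rw [List.length_append]; omega)
        have hreg : ∀ k : ℤ, k < 3 → s₂.mem 4 (r + k) = s'.mem 4 (r + k) := fun k hk => by
          rw [ha₂ _ _ (by norm_num) (Or.inr (by push_cast; omega)), hs₁,
            mem_set_of_ne _ (by norm_num)]
        have hreg0 : s₂.mem 4 r = s'.mem 4 r := by simpa using hreg 0 (by norm_num)
        have hr₃ : Runs ω (setReg (r + 2) (.add (reg (r + 2)) (.lit 1))) s₂ _ _ :=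
          Runs.setTo (b := N σ) (v := (r : ℤ) + 2) (w := (j : ℤ) + 1) trivial
            ⟨⟨trivial, by simp only [Expr.val]; push_cast; rw [hreg _ (by norm_num), h.index]; omega⟩,
              trivial⟩ (by simp [Expr.val])
            (by simp only [Expr.val]; push_cast; rw [hreg _ (by norm_num), h.index])
        set s₃ := s₂.set 4 ((r : ℤ) + 2) ((j : ℤ) + 1) with hs₃
        have hc₃ : s₃.mem 4 r = c.value s - j := by
          rw [hs₃, MachineState.set_mem, if_neg (by simp), hreg0, h.count]
        have hr₄ : Runs ω (setReg r (.sub (reg r) (.lit 1))) s₃ _ _ :=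
          Runs.setTo (b := N σ) (v := (r : ℤ)) (w := c.value s - j - 1) trivial
            ⟨⟨trivial, by simp only [Expr.val, hc₃]; exact hcj j hj.le⟩, trivial⟩ rfl
            (by simp only [Expr.val, hc₃])
        refine ⟨_, hr₁.seq (hr₂.seq (hr₃.seq hr₄)), ?_, ?_, ?_, ?_, ?_⟩
        · intro a z h1 hz hz'
          rw [MachineState.set_mem, if_neg (by omega), hs₃, MachineState.set_mem,
            if_neg (by omega), ha₂ _ _ h1 (by push_cast; omega), hs₁, MachineState.set_mem,
            if_neg hz', h.mem _ _ h1 hz hz']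
        · simp [MachineState.set_mem]; ring
        · simp [MachineState.set_mem, hs₃, hreg, h.oldx]
        · simp [MachineState.set_mem, hs₃]
        · rw [hval] at ho₂
          rw [List.range_succ, List.flatMap_append, ← List.append_assoc]
          simp only [List.flatMap_cons, List.flatMap_nil, List.append_nil]
          exact ho₂.congr ((mem_set_of_ne _ (by norm_num) _ _).trans
            (mem_set_of_ne _ (by norm_num) _ _)))
      (by
        refine ⟨?_, ?_, ?_, ?_, ?_⟩
        · intro a z h1 hz hz'
          rw [MachineState.set_mem, if_neg (by omega), hs₂, MachineState.set_mem,
            if_neg (by omega), ha₁.mem _ _ hz]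
        · simp [MachineState.set_mem, hs₂, hval₁]
        · simp [MachineState.set_mem, hs₂]
        · simp [MachineState.set_mem]
        · simp only [List.range_zero, List.flatMap_nil, List.append_nil]
          exact hl.congr ((mem_set_of_ne _ (by norm_num) _ _).trans
            ((mem_set_of_ne _ (by norm_num) _ _).trans (ha₁.array (by norm_num)))))
    have hr₅ : Runs ω (setSlot x (reg (r + 1))) s₄ _ _ :=
      Runs.setTo (b := N σ) (v := (x : ℤ)) (w := s.mem 3 x) trivial
        ⟨trivial, by simp only [Expr.val]; push_cast; rw [hI.oldx]; omega⟩ rfl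
        (by simp only [Expr.val]; push_cast; rw [hI.oldx])
    refine ⟨_, hr₁.seq (hr₂.seq (hr₃.seq ((hr₄.mono ?_).seq hr₅))), ?_, ?_⟩
    · exact Nat.mul_le_mul_right _ (by omega)
    · rw [value, eval]
      exact hI.out.congr (mem_set_of_ne _ (show (1 : ℕ) ≠ 3 by norm_num) _ _)
    · intro a z h1 hz
      rw [MachineState.set_mem]
      split_ifs with h
      · obtain ⟨rfl, rfl⟩ := h; rfl
      · exact hI.mem _ _ h1 hz h

theorem compilesCorrectly (t : ListTerm) (ht : t.WF) : t.CompilesCorrectly := by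
  induction t with
  | nil =>
    refine fun B _ r => ⟨fun _ => 1, .const 1, fun σ ω s l _ hl _ =>
      ⟨s, ⟨1, le_rfl, .skip s⟩, ?_, fun _ _ _ _ => rfl⟩⟩
    simpa [value, eval] using hl
  | emit t => exact compilesCorrectly_emit ht
  | append a b iha ihb =>
    intro B hB r
    obtain ⟨Ta, hTa, ha⟩ := iha ht.1 B hB r
    obtain ⟨Va, hVa, hva⟩ := a.length_eval_bounded ht.1 B hB
    obtain ⟨Tb, hTb, hb⟩ := ihb ht.2 _ (hB.add hVa) r
    refine ⟨_, hTa.add hTb, fun σ ω s l hs hl hlen => ?_⟩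
    have hva : (a.value s).length ≤ _ := hva σ _ _ _ hs
    obtain ⟨s₁, hr₁, ho₁, ha₁⟩ := ha σ ω s l hs hl hlen
    have h0 := ha₁.array (a := 0) (by norm_num) (by norm_num)
    have h2 := ha₁.array (a := 2) (by norm_num) (by norm_num)
    have hs₁ : BoundedState (B σ + Va σ) s₁ := by
      rw [BoundedState, h0, h2, ha₁.envOf]
      exact hs.mono (Nat.le_add_right _ _)
    obtain ⟨s₂, hr₂, ho₂, ha₂⟩ := hb σ ω s₁ _ hs₁ ho₁ (by rw [List.length_append]; omega)
    refine ⟨s₂, hr₁.seq hr₂, ?_, fun a i h1 hi => (ha₂ a i h1 hi).trans (ha₁ a i h1 hi)⟩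
    rw [b.value_congr h0 h2 ha₁.envOf, List.append_assoc] at ho₂
    exact ho₂
  | loop x c b ihb => exact compilesCorrectly_loop x ht.1 ht.2.1 ht.2.2 (ihb ht.2.2)

end ListTerm

/-! ### Programs that toss coins first -/

/-- The input as an array. -/
def inputArray (input : List ℤ) (i : ℤ) : ℤ := if 0 ≤ i then input.getD i.toNat 0 else 0

/-- The first `k` coin tosses as an array. -/
def coinArray (ω : ℕ → Bool) (k : ℕ) (i : ℤ) : ℤ :=
  if 0 ≤ i ∧ i < k then (if ω i.toNat then 1 else 0) else 0

theorem bitSize_coinArray_le (ω : ℕ → Bool) (k : ℕ) (i : ℤ) : bitSize (coinArray ω k i) ≤ 2 := by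
  unfold coinArray
  split_ifs <;> simp [bitSize_one, bitSize_zero]

theorem mem_zero_initState (input : List ℤ) : (initState input).mem 0 = inputArray input := by
  funext i
  simp [initState, inputArray]

theorem mem_initState_of_ne (input : List ℤ) {a : ℕ} (ha : a ≠ 0) (i : ℤ) :
    (initState input).mem a i = 0 := by
  simp [initState, ha]

/-- Toss as many coins as `c` says. -/
def tossProg (c : IntTerm) : Prog :=
  .seq (c.compile 0) (.seq (setReg 1 (.lit 0)) (.loop (reg 0)
    (.seq (.flip 2 (reg 1)) (.seq (setReg 1 (.add (reg 1) (.lit 1)))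
      (setReg 0 (.sub (reg 0) (.lit 1)))))))

theorem Runs.flipTo {ω : ℕ → Bool} {s : MachineState} {a : ℕ} {i : Expr} {b k : ℕ} {v : ℤ}
    (hi : i.Reads s.mem b) (hv : i.val s.mem = v) (hk : s.tosses = k) :
    Runs ω (.flip a i) s ((i.costWeight + i.weight + 1) * (b + 1))
      ⟨s.mem.set a v (if ω k then 1 else 0), k + 1⟩ := by
  subst hv hk
  refine ⟨_, ?_, .flip a i s⟩
  have := Expr.cost_le hi
  have := Expr.bitSize_val_le hi
  nlinarith

/-- The invariant says that the number of tosses used equals the index of the round, so that the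
j-th toss ends up at index j of array 2. The number of tosses is evaluated before any coin is
tossed, hence with an empty coin array. -/
theorem tossProg_correct {c : IntTerm} (hcount : c.IsCount) (hwc : c.WF) {B : ℕ → ℕ}
    (hB : PolyBounded B) : ∃ T, PolyBounded T ∧ ∀ σ ω input,
    IntTerm.BoundedState (B σ) (initState input) →
    ∃ s, Runs ω (tossProg c) (initState input) (T σ) s ∧ s.mem 0 = inputArray input ∧
      s.mem 1 = (fun _ => 0) ∧
      s.mem 2 = coinArray ω (c.eval (inputArray input) (fun _ => 0) fun _ => 0).toNat ∧
      s.mem 3 = fun _ => 0 := by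
  obtain ⟨Tc, hTc, hc⟩ := c.compilesCorrectly hwc B hB 0
  obtain ⟨Vc, hVc, hvc⟩ := c.eval_bounded hwc B hB
  have hN : PolyBounded fun σ => Vc σ + 1 := hVc.add (.const 1)
  refine ⟨fun σ => Tc σ + (writeCost (.lit (1 : ℕ)) (.lit 0) * (Vc σ + 1 + 1) + (Vc σ + 1) *
    (((reg 1).costWeight + (reg 1).weight + 1) * (Vc σ + 1 + 1) +
    (writeCost (.lit (1 : ℕ)) (.add (reg 1) (.lit 1)) * (Vc σ + 1 + 1) +
      writeCost (.lit (0 : ℕ)) (.sub (reg 0) (.lit 1)) * (Vc σ + 1 + 1)) +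
      (reg 0).costWeight * (Vc σ + 1 + 1) + 1)), ?_, ?_⟩
  · have h2 : ∀ c, PolyBounded fun σ => c * (Vc σ + 1 + 1) :=
      fun c => (PolyBounded.const c).mul (hN.add (.const 1))
    exact hTc.add ((h2 _).add (hN.mul ((((h2 _).add ((h2 _).add (h2 _))).add (h2 _)).add
      (.const 1))))
  · intro σ ω input hs
    obtain ⟨s₁, hr₁, hval₁, ha₁⟩ := hc σ ω _ hs
    obtain ⟨hbc, hcc⟩ := hvc σ _ _ _ hs
    have hcc := hcc hcount
    have henv : IntTerm.envOf (initState input) = fun _ => 0 :=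
      funext fun x => mem_initState_of_ne input (by norm_num) _
    have h2 : (initState input).mem 2 = fun _ => 0 :=
      funext fun x => mem_initState_of_ne input (by norm_num) _
    rw [IntTerm.value] at hval₁
    rw [mem_zero_initState, h2, henv] at hval₁ hbc hcc
    set k := c.eval (inputArray input) (fun _ => 0) fun _ => 0 with hk
    have hr₂ : Runs ω (setReg 1 (.lit 0)) s₁ _ _ :=
      Runs.setTo (b := Vc σ + 1) (v := 1) (w := 0) trivial trivial rfl rfl
    have hcj : ∀ j ≤ k.toNat, bitSize (k - j) ≤ Vc σ + 1 := fun j hj =>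
      (bitSize_le_of_natAbs_le (b := k) (by omega)).trans (hbc.trans (by omega))
    obtain ⟨s₃, hr₃, hI⟩ := Runs.loop (ω := ω) (e := reg 0) (b := Vc σ + 1)
      (T := ((reg 1).costWeight + (reg 1).weight + 1) * (Vc σ + 1 + 1) +
        (writeCost (.lit (1 : ℕ)) (.add (reg 1) (.lit 1)) * (Vc σ + 1 + 1) +
        writeCost (.lit (0 : ℕ)) (.sub (reg 0) (.lit 1)) * (Vc σ + 1 + 1)))
      (p := .seq (.flip 2 (reg 1)) (.seq (setReg 1 (.add (reg 1) (.lit 1)))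
        (setReg 0 (.sub (reg 0) (.lit 1)))))
      (s := s₁.set 4 1 0)
      (I := fun j s => s.tosses = j ∧ s.mem 0 = inputArray input ∧ s.mem 1 = (fun _ => 0) ∧
        s.mem 2 = coinArray ω j ∧ s.mem 3 = (fun _ => 0) ∧ s.mem 4 0 = k - j ∧ s.mem 4 1 = j)
      k.toNat
      (fun j hj s h => ⟨trivial, by
        simp only [Expr.val, Nat.cast_zero, h.2.2.2.2.2.1]; exact hcj j hj⟩)
      (fun j hj s h => by simp only [Expr.val, Nat.cast_zero, h.2.2.2.2.2.1]; omega)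
      (by
        rintro j hj s ⟨ht, h0, h1, h2, h3, hc0, hc1⟩
        have hjb := bitSize_natCast_le j
        have hr₁ : Runs ω (.flip 2 (reg 1)) s _ _ := Runs.flipTo (b := Vc σ + 1) (v := (j : ℤ))
          ⟨trivial, by simp only [Expr.val, Nat.cast_one, hc1]; omega⟩
          (by simp only [Expr.val, Nat.cast_one, hc1]) ht
        set s₁ : MachineState := ⟨s.mem.set 2 (j : ℤ) (if ω j then 1 else 0), j + 1⟩ with hs₁
        have hm : ∀ a, a ≠ 2 → s₁.mem a = s.mem a := fun a ha => by
          funext i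
          simp [hs₁, Memory.set, ha]
        have hr₂ : Runs ω (setReg 1 (.add (reg 1) (.lit 1))) s₁ _ _ :=
          Runs.setTo (b := Vc σ + 1) (v := 1) (w := (j : ℤ) + 1) trivial
            ⟨⟨trivial, by simp only [Expr.val, Nat.cast_one, hm 4 (by norm_num), hc1]; omega⟩,
              trivial⟩ rfl (by simp only [Expr.val, Nat.cast_one, hm 4 (by norm_num), hc1])
        set s₂ := s₁.set 4 1 ((j : ℤ) + 1) with hs₂
        have hc2 : s₂.mem 4 0 = k - j := by
          rw [hs₂, MachineState.set_mem, if_neg (by simp), hm 4 (by norm_num), hc0]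
        have hr₃ : Runs ω (setReg 0 (.sub (reg 0) (.lit 1))) s₂ _ _ :=
          Runs.setTo (b := Vc σ + 1) (v := 0) (w := k - j - 1) trivial
            ⟨⟨trivial, by simp only [Expr.val, Nat.cast_zero, hc2]; exact hcj j hj.le⟩, trivial⟩
            rfl (by simp only [Expr.val, Nat.cast_zero, hc2])
        have hm' : ∀ a, a ≠ 4 → (s₂.set 4 0 (k - j - 1)).mem a = s₁.mem a := fun a ha =>
          (IntTerm.mem_set_of_ne _ ha _ _).trans (IntTerm.mem_set_of_ne _ ha _ _)
        refine ⟨_, hr₁.seq (hr₂.seq hr₃), rfl, ?_, ?_, ?_, ?_, ?_, ?_⟩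
        · rw [hm' 0 (by norm_num), hm 0 (by norm_num), h0]
        · rw [hm' 1 (by norm_num), hm 1 (by norm_num), h1]
        · rw [hm' 2 (by norm_num)]
          funext i
          simp only [hs₁, Memory.set, h2, coinArray, true_and]
          by_cases hi : i = j
          · subst hi; simp
          · have : (0 ≤ i ∧ i < ((j + 1 : ℕ) : ℤ)) ↔ (0 ≤ i ∧ i < (j : ℤ)) := by omega
            simp only [hi, if_false, this]
        · rw [hm' 3 (by norm_num), hm 3 (by norm_num), h3]
        · simp [MachineState.set_mem]; ring
        · simp [MachineState.set_mem, hs₂])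
      (by
        have hm : ∀ a, a ≠ 4 → (s₁.set 4 1 0).mem a = (initState input).mem a := fun a ha =>
          (IntTerm.mem_set_of_ne _ ha _ _).trans (ha₁.array ha)
        refine ⟨ha₁.tosses, ?_, ?_, ?_, ?_, ?_, ?_⟩
        · rw [hm 0 (by norm_num), mem_zero_initState]
        · rw [hm 1 (by norm_num)]
          exact funext fun x => mem_initState_of_ne input (by norm_num) _
        · rw [hm 2 (by norm_num), h2]
          funext i
          rw [coinArray, if_neg (by push_cast; omega)]
        · rw [hm 3 (by norm_num)]
          exact funext fun x => mem_initState_of_ne input (by norm_num) _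
        · rw [MachineState.set_mem, if_neg (by simp)]
          simpa using hval₁
        · simp [MachineState.set_mem])
    refine ⟨s₃, hr₁.seq (hr₂.seq (hr₃.mono ?_)), hI.2.1, hI.2.2.1, hI.2.2.2.1, hI.2.2.2.2.1⟩
    exact Nat.mul_le_mul_right _ (by omega)

/-- Every list of terms is the output of a polynomial-time program, where the number of coins tossed
is given by a term. -/
theorem exists_prog {c : IntTerm} {t : ListTerm} (hcount : c.IsCount) (hc : c.WF) (ht : t.WF) :
    ∃ (P : Prog) (T : ℕ → ℕ), PolyBounded T ∧ ∀ (σ : ℕ) (ω : ℕ → Bool) (input : List ℤ),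
      (∀ z ∈ input, bitSize z ≤ σ) → (∀ i < 3, (input.getD i 0).natAbs ≤ σ) →
      ∃ s, Runs ω P (initState input) (T σ) s ∧ s.HasOutput (t.eval (inputArray input)
        (coinArray ω (c.eval (inputArray input) (fun _ => 0) fun _ => 0).toNat) fun _ => 0) := by
  -- The 2 covers the entries 0 and 1 of the coin array.
  have hB : PolyBounded fun σ => σ + 2 := PolyBounded.id.add (.const 2)
  obtain ⟨T₁, hT₁, h₁⟩ := tossProg_correct hcount hc hB
  obtain ⟨T₂, hT₂, h₂⟩ := t.compilesCorrectly ht _ hB 0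
  refine ⟨.seq (tossProg c) (t.compile 0), _, hT₁.add hT₂, fun σ ω input h h' => ?_⟩
  have hbi : ∀ i, bitSize (inputArray input i) ≤ σ + 2 := by
    intro i
    unfold inputArray
    split_ifs
    · by_cases hi : i.toNat < input.length
      · rw [List.getD_eq_getElem _ _ hi]
        exact (h _ (List.getElem_mem hi)).trans (Nat.le_add_right _ _)
      · rw [List.getD_eq_default _ _ (by omega), bitSize_zero]
        omega
    · rw [bitSize_zero]
      omega
  have hcount : ∀ i, 0 ≤ i → i < 3 → (inputArray input i).natAbs ≤ σ + 2 := fun i h0 h3 => by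
    rw [inputArray, if_pos h0]
    exact (h' _ (by omega)).trans (Nat.le_add_right _ _)
  obtain ⟨s₁, hr₁, h0, h1, h2, h3⟩ := h₁ σ ω input (by
    refine ⟨fun i => ?_, fun i => ?_, fun x => ?_, fun i => ?_⟩
    · rw [mem_zero_initState]; exact hbi i
    · rw [mem_initState_of_ne _ (by norm_num), bitSize_zero]; omega
    · rw [IntTerm.envOf, mem_initState_of_ne _ (by norm_num), bitSize_zero]; omega
    · rw [mem_zero_initState]; exact hcount i)
  have henv : IntTerm.envOf s₁ = fun _ => 0 := by
    funext x
    rw [IntTerm.envOf, h3]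
  obtain ⟨s₂, hr₂, ho, -⟩ := h₂ σ ω s₁ [] (by
    rw [IntTerm.BoundedState, h0, h2, henv]
    refine ⟨hbi, fun i => ?_, fun x => ?_, hcount⟩
    · exact (bitSize_coinArray_le _ _ _).trans (by omega)
    · rw [bitSize_zero]; omega)
    ⟨by simp [h1], by simp⟩ (by simp)
  refine ⟨s₂, hr₁.seq hr₂, ?_⟩
  rwa [List.nil_append, ListTerm.value, h0, h2, henv] at ho

/-! ### The networks -/

/-- The weights and biases of a layer with six nodes after a layer with six nodes; the last column
holds the biases. -/
abbrev LayerMatrix (R : Type) : Type := Fin 6 → Fin 7 → R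

/-- The values of the nodes of a layer. -/
def LayerMatrix.act (A : LayerMatrix ℤ) (v : Fin 6 → ℝ) : Fin 6 → ℝ :=
  fun i => max 0 ((∑ j : Fin 6, (A i j.castSucc : ℝ) * v j) + A i (Fin.last 6))

/-- Hidden layers with six nodes, and the output `2 v₃ - 1`. -/
def stackNet : List (LayerMatrix ℤ) → Network ℚ 6
  | [] => .out (fun j => if j = 3 then 2 else 0) (-1)
  | A :: l => .hidden 6 (fun i j => A i j.castSucc) (fun i => A i (Fin.last 6)) (stackNet l)

/-- The network that computes `w · x + 1` in the first node of the first layer, followed by given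
layers. -/
def memoNet (n : ℕ) (w : ℕ → ℤ) (l : List (LayerMatrix ℤ)) : Network ℚ n :=
  .hidden 6 (fun i j => if i = 0 then w j else 0) (fun i => if i = 0 then 1 else 0) (stackNet l)

theorem eval_stackNet (l : List (LayerMatrix ℤ)) (v : Fin 6 → ℝ) :
    (stackNet l).toReal.eval v = 2 * l.foldl (fun v A => A.act v) v 3 - 1 := by
  induction l generalizing v with
  | nil =>
    simp only [stackNet, Network.toReal, Network.eval, List.foldl_nil, Fin.sum_univ_six]
    simp
    ring
  | cons A l ih =>
    simp only [stackNet, Network.toReal, Network.eval, List.foldl_cons, ← ih]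
    congr 1

theorem eval_memoNet (n : ℕ) (w : ℕ → ℤ) (l : List (LayerMatrix ℤ)) (x : Fin n → ℝ)
    (hx : 0 ≤ (∑ j : Fin n, (w j : ℝ) * x j) + 1) :
    (memoNet n w l).toReal.eval x =
      2 * l.foldl (fun v A => A.act v) ![(∑ j : Fin n, (w j : ℝ) * x j) + 1, 0, 0, 0, 0, 0] 3
        - 1 := by
  simp only [memoNet, Network.toReal, Network.eval, ← eval_stackNet]
  congr 1
  funext i
  fin_cases i <;> simp
  exact hx

theorem width_stackNet (l : List (LayerMatrix ℤ)) : (stackNet l).toReal.width ≤ 6 := by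
  induction l with
  | nil => simp [stackNet, Network.toReal, Network.width]
  | cons A l ih => simpa [stackNet, Network.toReal, Network.width] using ih

theorem width_memoNet (n : ℕ) (w : ℕ → ℤ) (l : List (LayerMatrix ℤ)) :
    (memoNet n w l).toReal.width = 6 := by
  simpa [memoNet, Network.toReal, Network.width] using width_stackNet l

theorem depth_memoNet (n : ℕ) (w : ℕ → ℤ) (l : List (LayerMatrix ℤ)) :
    (memoNet n w l).toReal.depth = l.length + 2 := by
  have : ∀ l : List (LayerMatrix ℤ), (stackNet l).toReal.depth = l.length + 1 := by
    intro l
    induction l with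
    | nil => simp [stackNet, Network.toReal, Network.depth]
    | cons A l ih => simpa [stackNet, Network.toReal, Network.depth] using ih
  simp [memoNet, Network.toReal, Network.depth, this]

/-- By the convention `n_i * (n_{i+1} + 1)` the input contributes 7n, each of the further hidden
layers 6 · 7, and the output layer 6 · 2. -/
theorem numParams_memoNet (n : ℕ) (w : ℕ → ℤ) (l : List (LayerMatrix ℤ)) :
    (memoNet n w l).toReal.numParams = 7 * n + 42 * l.length + 12 := by
  have : ∀ l : List (LayerMatrix ℤ), (stackNet l).toReal.numParams = 42 * l.length + 12 := by
    intro l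
    induction l with
    | nil => simp [stackNet, Network.toReal, Network.numParams]
    | cons A l ih => simp [stackNet, Network.toReal, Network.numParams, ih]; ring
  simp [memoNet, Network.toReal, Network.numParams, this]
  ring

/-! ### Comparison with a threshold in two layers -/

/-- The fourth and the fifth node become `ReLU (p · v - θ)` and `ReLU (p · v - θ - 1)`. -/
def probeMatrix {R : Type} [Zero R] [One R] (p₀ p₁ p₂ b b' : R) : LayerMatrix R :=
  ![![1, 0, 0, 0, 0, 0, 0], ![0, 1, 0, 0, 0, 0, 0], ![0, 0, 1, 0, 0, 0, 0],
    ![0, 0, 0, 1, 0, 0, 0], ![p₀, p₁, p₂, 0, 0, 0, b], ![p₀, p₁, p₂, 0, 0, 0, b']]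

/-- Add multiples of the difference of the fourth and the fifth node to the first three nodes; the
second node is replaced by the `0`-th before if `ρ = 1`. -/
def updateMatrix {R : Type} [Zero R] [One R] (ρ ρ' c₁ c₁' c₂ c₂' c₃ c₃' : R) : LayerMatrix R :=
  ![![1, 0, 0, 0, 0, 0, 0], ![0, 1, 0, 0, c₁, c₁', 0], ![ρ, 0, ρ', 0, c₂, c₂', 0],
    ![0, 0, 0, 1, c₃, c₃', 0], ![0, 0, 0, 0, 0, 0, 0], ![0, 0, 0, 0, 0, 0, 0]]

/-- `0` for `x ≤ 0` and `1` for `x ≥ 1`. -/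
def ramp (x : ℝ) : ℝ := max 0 x - max 0 (x - 1)

theorem ramp_of_nonpos {x : ℝ} (h : x ≤ 0) : ramp x = 0 := by
  rw [ramp, max_eq_left h, max_eq_left (by linarith), sub_zero]

theorem ramp_of_one_le {x : ℝ} (h : 1 ≤ x) : ramp x = 1 := by
  rw [ramp, max_eq_right (by linarith), max_eq_right (by linarith)]
  ring

/-- The network can hold differences u - t only after truncation at 0; comparisons do not suffer
from it. -/
theorem ramp_max_zero (x : ℝ) : ramp (max 0 x) = ramp x := by
  rcases le_total x 0 with h | h
  · rw [max_eq_left h, ramp_of_nonpos le_rfl, ramp_of_nonpos h]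
  · rw [max_eq_right h]

/-- Two layers: compute `σ = ramp (p · v - θ)`, then add multiples of `σ`. -/
def opLayers (p₀ p₁ p₂ θ ρ c₁ c₂ c₃ : ℤ) : List (LayerMatrix ℤ) :=
  [probeMatrix p₀ p₁ p₂ (-θ) (-θ - 1), updateMatrix ρ (1 - ρ) c₁ (-c₁) c₂ (-c₂) c₃ (-c₃)]

/-- The values of the nodes after the given layers. -/
abbrev runLayers (l : List (LayerMatrix ℤ)) (v : Fin 6 → ℝ) : Fin 6 → ℝ :=
  l.foldl (fun v A => A.act v) v

theorem runLayers_append (l l' : List (LayerMatrix ℤ)) (v : Fin 6 → ℝ) :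
    runLayers (l ++ l') v = runLayers l' (runLayers l v) :=
  List.foldl_append

/-- All later layers are instances of this gadget. A ramp is the difference of two ReLUs, so the
first layer computes both in the nodes 4 and 5, and the second layer uses and clears them. Nodes
with nonnegative values survive the ReLU when they are copied. -/
theorem runLayers_opLayers (p₀ p₁ p₂ θ ρ c₁ c₂ c₃ : ℤ) {u a e o σ : ℝ} (hu : 0 ≤ u)
    (ha : 0 ≤ a) (he : 0 ≤ e) (ho : 0 ≤ o)
    (hσ : ramp (p₀ * u + p₁ * a + p₂ * e - θ) = σ) :
    runLayers (opLayers p₀ p₁ p₂ θ ρ c₁ c₂ c₃) ![u, a, e, o, 0, 0] =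
      ![u, max 0 (a + c₁ * σ), max 0 (ρ * u + (1 - ρ) * e + c₂ * σ), max 0 (o + c₃ * σ), 0, 0] := by
  have h1 : (probeMatrix p₀ p₁ p₂ (-θ) (-θ - 1)).act ![u, a, e, o, 0, 0] =
      ![u, a, e, o, max 0 (p₀ * u + p₁ * a + p₂ * e - θ),
        max 0 (p₀ * u + p₁ * a + p₂ * e - θ - 1)] := by
    funext i
    fin_cases i <;> simp [LayerMatrix.act, probeMatrix, Fin.sum_univ_six, hu, ha, he, ho]
    · congr 1
    · congr 1; ring
  rw [runLayers, opLayers, List.foldl_cons, List.foldl_cons, List.foldl_nil, h1]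
  subst hσ
  funext i
  fin_cases i <;> simp [LayerMatrix.act, updateMatrix, Fin.sum_univ_six, hu, ramp] <;>
    congr 1 <;> ring

/-! ### Extraction of digits and decoding of packed thresholds -/

/-- Extract the binary digits of `A / 2 ^ T`, where `A < 2 ^ (T + k)` is the value of the first
node, and subtract the result from the second node. -/
def bitLayers (k T : ℕ) : List (LayerMatrix ℤ) :=
  (List.range k).flatMap fun b =>
    opLayers 0 1 0 (2 ^ (T + (k - 1 - b)) - 1) 0 (-2 ^ (T + (k - 1 - b))) (-2 ^ (k - 1 - b)) 0

theorem bitLayers_succ (k T : ℕ) : bitLayers (k + 1) T =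
    opLayers 0 1 0 (2 ^ (T + k) - 1) 0 (-2 ^ (T + k)) (-2 ^ k) 0 ++ bitLayers k T := by
  simp only [bitLayers, List.range_succ_eq_map, List.flatMap_cons, List.flatMap_map]
  congr 2
  funext b
  rw [show k + 1 - 1 - (b + 1) = k - 1 - b by omega]

/-- Digits are taken from the top. The leading digit of an integer A is 1 if and only if A ≥ 2^p for
its position p; since A is an integer, the ramp that starts at 2^p - 1 takes the exact value 0 or 1.
The digit is then removed from A, and its weight in t is subtracted from node 2. -/
theorem runLayers_bitLayers (k T : ℕ) {t r : ℤ} (ht : 0 ≤ t) (htk : t < 2 ^ k) (hr : 0 ≤ r)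
    (hrT : r < 2 ^ T) {u e o : ℝ} (hu : 0 ≤ u) (he : 0 ≤ e) (ho : 0 ≤ o) :
    runLayers (bitLayers k T) ![u, ((t * 2 ^ T + r : ℤ) : ℝ), e, o, 0, 0] =
      ![u, (r : ℝ), max 0 (e - t), o, 0, 0] := by
  induction k generalizing t e with
  | zero =>
    obtain rfl : t = 0 := by simp at htk; omega
    simp [bitLayers, he]
  | succ k ih =>
    have h2 : (0 : ℤ) < 2 ^ T := by positivity
    have hA : 0 ≤ t * 2 ^ T + r := by positivity
    rw [bitLayers_succ, runLayers_append]
    by_cases h : 2 ^ k ≤ t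
    · have h3 : (2 : ℤ) ^ (T + k) ≤ t * 2 ^ T + r := by
        rw [pow_add, mul_comm]; nlinarith
      have h3' : (2 : ℝ) ^ (T + k) ≤ ((t * 2 ^ T + r : ℤ) : ℝ) := by exact_mod_cast h3
      rw [runLayers_opLayers (σ := 1) _ _ _ _ _ _ _ _ hu (by exact_mod_cast hA) he ho
        (ramp_of_one_le (by push_cast at *; linarith))]
      have e1 : ((t * 2 ^ T + r : ℤ) : ℝ) + ((-2 ^ (T + k) : ℤ) : ℝ) * 1 =
          (((t - 2 ^ k) * 2 ^ T + r : ℤ) : ℝ) := by push_cast; ring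
      have e2 : (0 : ℝ) ≤ (((t - 2 ^ k) * 2 ^ T + r : ℤ) : ℝ) := by
        have : 0 ≤ (t - 2 ^ k) * 2 ^ T + r := by
          have := mul_nonneg (sub_nonneg.2 h) h2.le
          omega
        exact_mod_cast this
      rw [e1, max_eq_right e2, show max 0 (o + ((0 : ℤ) : ℝ) * 1) = o by simpa using ho,
        ih (by omega) (by rw [pow_succ] at htk; omega) (le_max_left _ _)]
      -- The numbers subtracted are nonnegative, so truncating at 0 after every subtraction gives
      -- the same as truncating once at the end.
      have e3 : max 0 (max 0 (((0 : ℤ) : ℝ) * u + (1 - ((0 : ℤ) : ℝ)) * e +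
          ((-2 ^ k : ℤ) : ℝ) * 1) - ((t - 2 ^ k : ℤ) : ℝ)) = max 0 (e - t) := by
        push_cast
        have h' : (2 : ℝ) ^ k ≤ t := by exact_mod_cast h
        rcases le_total (0 * u + (1 - 0) * e + -2 ^ k * 1) 0 with h0 | h0
        · rw [max_eq_left h0, max_eq_left (by linarith), max_eq_left (by linarith)]
        · rw [max_eq_right h0]; congr 1; ring
      rw [e3]
    · push Not at h
      have h3 : t * 2 ^ T + r + 1 ≤ (2 : ℤ) ^ (T + k) := by
        rw [pow_add, mul_comm]
        have : (t + 1) * 2 ^ T ≤ 2 ^ k * 2 ^ T := mul_le_mul_of_nonneg_right (by omega) h2.le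
        linarith
      have h3' : ((t * 2 ^ T + r : ℤ) : ℝ) + 1 ≤ (2 : ℝ) ^ (T + k) := by exact_mod_cast h3
      rw [runLayers_opLayers (σ := 0) _ _ _ _ _ _ _ _ hu (by exact_mod_cast hA) he ho
        (ramp_of_nonpos (by push_cast at *; linarith))]
      have hA' : (0 : ℝ) ≤ ((t * 2 ^ T + r : ℤ) : ℝ) := by exact_mod_cast hA
      simp only [mul_zero, add_zero, Int.cast_zero, zero_mul, zero_add, sub_zero, one_mul,
        max_eq_right hA', max_eq_right he, max_eq_right ho]
      exact ih ht h he

/-- Numbers with `K` binary digits in one number. -/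
def pack (K : ℕ) (t : ℕ → ℤ) (m : ℕ) : ℤ := ∑ r ∈ Finset.range m, t r * 2 ^ (K * (m - 1 - r))

theorem pack_succ (K : ℕ) (t : ℕ → ℤ) (m : ℕ) :
    pack K t (m + 1) = t 0 * 2 ^ (K * m) + pack K (fun r => t (r + 1)) m := by
  rw [pack, Finset.sum_range_succ', add_comm]
  congr 1
  refine Finset.sum_congr rfl fun r _ => ?_
  rw [show m + 1 - 1 - (r + 1) = m - 1 - r by omega]

theorem pack_nonneg {K : ℕ} {t : ℕ → ℤ} {m : ℕ} (h : ∀ r < m, 0 ≤ t r) : 0 ≤ pack K t m :=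
  Finset.sum_nonneg fun r hr => mul_nonneg (h r (Finset.mem_range.1 hr)) (by positivity)

/-- Ensures that the tail of a packed number lies below the digits of its first entry, as the
extraction requires of the remainder. -/
theorem pack_lt {K : ℕ} {t : ℕ → ℤ} {m : ℕ} (h : ∀ r < m, t r < 2 ^ K) :
    pack K t m < 2 ^ (K * m) := by
  induction m generalizing t with
  | zero => simp [pack]
  | succ m ih =>
    have h1 := ih fun r hr => h (r + 1) (by omega)
    have h2 := h 0 (by omega)
    have h3 : (0 : ℤ) < 2 ^ (K * m) := by positivity
    rw [pack_succ, mul_add, pow_add, mul_one]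
    nlinarith

/-- Extract numbers from the first node, and alternately add and subtract the results of the
comparisons of the `0`-th node with them to the third node. -/
def decodeLayers (K : ℕ) (c : ℤ) (m : ℕ) : List (LayerMatrix ℤ) :=
  (List.range m).flatMap fun r =>
    bitLayers K (K * (m - 1 - r)) ++ opLayers 0 0 1 0 1 0 0 (c * (-1) ^ r)

theorem decodeLayers_succ (K : ℕ) (c : ℤ) (m : ℕ) : decodeLayers K c (m + 1) =
    bitLayers K (K * m) ++ opLayers 0 0 1 0 1 0 0 c ++ decodeLayers K (-c) m := by
  simp only [decodeLayers, List.range_succ_eq_map, List.flatMap_cons, List.flatMap_map]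
  congr 2
  · simp
  · funext r
    rw [show m + 1 - 1 - (r + 1) = m - 1 - r by omega, pow_succ]
    congr 2
    ring

/-- The first d comparisons succeed and the others fail, so the output is toggled d times. Toggling
a value o in {0, 1} means adding 1 - 2o, and this increment changes its sign each time; hence the
alternating factors. If d = 0 nothing is added, and c is arbitrary. -/
theorem runLayers_decodeLayers {K : ℕ} {t : ℕ → ℤ} {m d : ℕ} (h0 : ∀ r < m, 0 ≤ t r)
    (hK : ∀ r < m, t r < 2 ^ K) (hd : d ≤ m) {u o : ℝ} (hu : 0 ≤ u)
    (ht : ∀ r < m, ramp (u - t r) = if r < d then 1 else 0) {c : ℤ} (ho : o = 0 ∨ o = 1)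
    (hc : d = 0 ∨ (c : ℝ) = 1 - 2 * o) :
    runLayers (decodeLayers K c m) ![u, (pack K t m : ℤ), u, o, 0, 0] =
      ![u, 0, u, if Even d then o else 1 - o, 0, 0] := by
  induction m generalizing t d o c with
  | zero =>
    obtain rfl : d = 0 := by omega
    simp [decodeLayers, pack]
  | succ m ih =>
    have ho' : 0 ≤ o := by rcases ho with rfl | rfl <;> norm_num
    have hp : 0 ≤ pack K (fun r => t (r + 1)) m := pack_nonneg fun r hr => h0 _ (by omega)
    have hp' : (0 : ℝ) ≤ (pack K (fun r => t (r + 1)) m : ℤ) := by exact_mod_cast hp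
    rw [decodeLayers_succ, runLayers_append, runLayers_append, pack_succ,
      runLayers_bitLayers K (K * m) (h0 0 (by omega)) (hK 0 (by omega)) hp
        (pack_lt fun r hr => hK _ (by omega)) hu hu ho']
    -- Node 2 now holds the truncated difference of u and the first threshold. It is compared with 0
    -- and at the same time reset to u for the next threshold.
    rw [runLayers_opLayers (σ := if 0 < d then 1 else 0) _ _ _ _ _ _ _ _ hu hp'
      (le_max_left _ _) ho' (by
        rw [← ht 0 (by omega), ← ramp_max_zero (u - t 0)]
        congr 1
        push_cast
        ring)]
    have e1 : max 0 (((1 : ℤ) : ℝ) * u + (1 - ((1 : ℤ) : ℝ)) * max 0 (u - t 0) +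
        ((0 : ℤ) : ℝ) * (if 0 < d then 1 else 0)) = u := by
      push_cast; rw [sub_self, zero_mul, zero_mul, one_mul, add_zero, add_zero, max_eq_right hu]
    have e2 : max 0 ((pack K (fun r => t (r + 1)) m : ℝ) + ((0 : ℤ) : ℝ) *
        (if 0 < d then 1 else 0)) = (pack K (fun r => t (r + 1)) m : ℝ) := by
      push_cast; rw [zero_mul, add_zero, max_eq_right hp']
    rw [e1, e2]
    rcases Nat.eq_zero_or_pos d with rfl | hd0
    · have := ih (t := fun r => t (r + 1)) (d := 0) (o := o) (c := -c)
        (fun r hr => h0 _ (by omega)) (fun r hr => hK _ (by omega)) (by omega)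
        (fun r hr => by simpa using ht (r + 1) (by omega)) ho (Or.inl rfl)
      simpa [max_eq_right ho'] using this
    · obtain ⟨d, rfl⟩ : ∃ e, d = e + 1 := ⟨d - 1, by omega⟩
      have hc := hc.resolve_left (by omega)
      have := ih (t := fun r => t (r + 1)) (d := d) (o := 1 - o) (c := -c)
        (fun r hr => h0 _ (by omega)) (fun r hr => hK _ (by omega)) (by omega)
        (fun r hr => by simpa using ht (r + 1) (by omega))
        (by rcases ho with rfl | rfl <;> norm_num) (Or.inr (by push_cast; linarith))
      have e3 : max 0 (o + (c : ℝ) * if 0 < d + 1 then 1 else 0) = 1 - o := by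
        rw [if_pos (by omega), hc]
        rcases ho with rfl | rfl <;> norm_num
      rw [e3, this]
      simp only [Nat.even_add_one]
      split_ifs <;> simp

/-! ### Selection of a group of thresholds -/

/-- The thresholds of the `j`-th group packed into one number, where the groups are counted from
`1`, and `0` for `j = 0`. -/
def groupCode (K q : ℕ) (τ : ℕ → ℤ) (j : ℕ) : ℤ :=
  if 0 < j then pack K (fun r => τ ((j - 1) * q + 1 + r)) (q - 1) else 0

/-- Load the code of the group that contains the value of the `0`-th node into the first node. -/
def selectLayers (K q : ℕ) (τ : ℕ → ℤ) (s : ℕ) : List (LayerMatrix ℤ) :=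
  (List.range s).flatMap fun j =>
    opLayers 1 0 0 (τ (j * q)) 1 (groupCode K q τ (j + 1) - groupCode K q τ j) 0 0

/-- The sum telescopes: every head that u has passed replaces the code of a group by the next one,
until the group of u is reached. The increments may be negative, but all partial sums are codes,
hence nonnegative, and the ReLU does not cut them. -/
theorem runLayers_selectLayers {K q : ℕ} {τ : ℕ → ℤ} (h0 : ∀ i, 0 < i → 0 ≤ τ i) {u : ℝ}
    (hu : 0 ≤ u) {J : ℕ} (hτ : ∀ j, ramp (u - τ (j * q)) = if j ≤ J then 1 else 0) (s : ℕ) :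
    runLayers (selectLayers K q τ s) ![u, 0, 0, 0, 0, 0] =
      ![u, (groupCode K q τ (min s (J + 1)) : ℤ), if 0 < s then u else 0, 0, 0, 0] := by
  have hg : ∀ j, (0 : ℝ) ≤ (groupCode K q τ j : ℤ) := fun j => by
    have : 0 ≤ groupCode K q τ j := by
      unfold groupCode
      split_ifs
      · exact pack_nonneg fun r _ => h0 _ (by omega)
      · exact le_rfl
    exact_mod_cast this
  induction s with
  | zero => simp [selectLayers, groupCode]
  | succ s ih =>
    have : selectLayers K q τ (s + 1) = selectLayers K q τ s ++
        opLayers 1 0 0 (τ (s * q)) 1 (groupCode K q τ (s + 1) - groupCode K q τ s) 0 0 := by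
      simp [selectLayers, List.range_succ, List.flatMap_append]
    rw [this, runLayers_append, ih, runLayers_opLayers (σ := if s ≤ J then 1 else 0) _ _ _ _ _ _ _ _
      hu (hg _) (by split_ifs; exacts [hu, le_rfl]) le_rfl
      (by rw [← hτ s]; congr 1; push_cast; ring)]
    have e : (groupCode K q τ (min s (J + 1)) : ℝ) +
        ((groupCode K q τ (s + 1) - groupCode K q τ s : ℤ) : ℝ) * (if s ≤ J then 1 else 0) =
          groupCode K q τ (min (s + 1) (J + 1)) := by
      split_ifs with h
      · rw [min_eq_left (by omega), min_eq_left (by omega)]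
        push_cast
        ring
      · rw [min_eq_right (by omega), min_eq_right (by omega)]
        ring
    rw [e, max_eq_right (hg _)]
    simp [hu]

/-- All layers for `s` groups of `2 * s` thresholds. -/
def memoLayers (K s : ℕ) (τ : ℕ → ℤ) : List (LayerMatrix ℤ) :=
  selectLayers K (2 * s) τ s ++ decodeLayers K 1 (2 * s - 1)

theorem length_memoLayers (K s : ℕ) (τ : ℕ → ℤ) :
    (memoLayers K s τ).length = 2 * s + (2 * s - 1) * (2 * K + 2) := by
  have h : ∀ (f : ℕ → List (LayerMatrix ℤ)) (k m : ℕ), (∀ j, (f j).length = m) →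
      ((List.range k).flatMap f).length = k * m := fun f k m hf => by
    simp [List.length_flatMap, hf]
  have h2 : ∀ p₀ p₁ p₂ θ ρ c₁ c₂ c₃, (opLayers p₀ p₁ p₂ θ ρ c₁ c₂ c₃).length = 2 :=
    fun _ _ _ _ _ _ _ _ => rfl
  have hb : ∀ T, (bitLayers K T).length = K * 2 := fun T => h _ _ _ fun _ => h2 _ _ _ _ _ _ _ _
  rw [memoLayers, List.length_append, selectLayers, decodeLayers, h _ _ 2 fun _ => h2 _ _ _ _ _ _ _ _,
    h _ _ (K * 2 + 2) fun r => by rw [List.length_append, hb, h2]]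
  ring

/-- Divide i by the size 2s of the groups: the quotient is the group that is selected, and the
remainder is the number of its further thresholds that are passed. -/
theorem runLayers_memoLayers {K s i : ℕ} {τ : ℕ → ℤ} (hs : 0 < s) (h0 : ∀ i, 0 < i → 0 ≤ τ i)
    (hK : ∀ i, 0 < i → τ i < 2 ^ K) {u : ℝ} (hu : 0 ≤ u) (hi : i < s * (2 * s))
    (hτ : ∀ j, ramp (u - τ j) = if j ≤ i then 1 else 0) :
    runLayers (memoLayers K s τ) ![u, 0, 0, 0, 0, 0] 3 = if Even i then 0 else 1 := by
  have hq : 0 < 2 * s := by omega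
  have hJ : i / (2 * s) < s := Nat.div_lt_of_lt_mul (by rwa [mul_comm] at hi)
  rw [memoLayers, runLayers_append, runLayers_selectLayers (J := i / (2 * s)) h0 hu
    (fun j => by rw [hτ]; simp only [Nat.le_div_iff_mul_le hq]),
    min_eq_right (Nat.succ_le_of_lt hJ), if_pos hs, groupCode,
    if_pos (Nat.succ_pos _)]
  have hmod := Nat.mod_add_div i (2 * s)
  have hlt := Nat.mod_lt i hq
  rw [runLayers_decodeLayers (d := i % (2 * s)) (fun r _ => h0 _ (by omega))
    (fun r _ => hK _ (by omega)) (by omega) hu (fun r _ => ?_) (Or.inl rfl)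
    (Or.inr (by norm_num))]
  -- Groups have even size, so the thresholds of the groups before do not influence the parity.
  · have : Even (i % (2 * s)) ↔ Even i := by
      rw [Nat.even_iff, Nat.even_iff, Nat.mod_mul_right_mod]
    simp [this]
  · rw [hτ, Nat.succ_sub_one, mul_comm]
    congr 1
    simp only [eq_iff_iff]
    omega

/-! ### Thresholds between points with different labels -/

/-- The smallest among `S` and the numbers `m l` with `l < k`, `t < m l`, `0 < c * y l`. -/
def minAbove (m y : ℕ → ℤ) (S c t : ℤ) : ℕ → ℤ
  | 0 => S
  | k + 1 => if 0 < c * y k ∧ t < m k ∧ m k < minAbove m y S c t k then m k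
      else minAbove m y S c t k

theorem minAbove_le (m y : ℕ → ℤ) (S c t : ℤ) (k : ℕ) : minAbove m y S c t k ≤ S := by
  induction k with
  | zero => exact le_rfl
  | succ k ih =>
    rw [minAbove]
    split_ifs with h
    · exact h.2.2.le.trans ih
    · exact ih

theorem minAbove_le_apply {m y : ℕ → ℤ} (S : ℤ) {c t : ℤ} {k l : ℕ} (hl : l < k)
    (hc : 0 < c * y l) (ht : t < m l) : minAbove m y S c t k ≤ m l := by
  induction k with
  | zero => omega
  | succ k ih =>
    rw [minAbove]
    rcases Nat.lt_succ_iff_lt_or_eq.1 hl with h | rfl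
    · have := ih h
      split_ifs <;> omega
    · split_ifs with h'
      · exact le_rfl
      · exact not_lt.1 fun h'' => h' ⟨hc, ht, h''⟩

theorem minAbove_eq (m y : ℕ → ℤ) (S c t : ℤ) (k : ℕ) : minAbove m y S c t k = S ∨
    ∃ l < k, 0 < c * y l ∧ t < m l ∧ minAbove m y S c t k = m l := by
  induction k with
  | zero => exact Or.inl rfl
  | succ k ih =>
    rw [minAbove]
    split_ifs with h
    · exact Or.inr ⟨k, by omega, h.1, h.2.1, rfl⟩
    · rcases ih with h | ⟨l, hl, h⟩
      · exact Or.inl h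
      · exact Or.inr ⟨l, by omega, h⟩

/-- The sign of the labels of the points that lie just above the `i`-th threshold. -/
def signAfter (i : ℕ) : ℤ := 1 - 2 * ((i : ℤ) % 2)

theorem signAfter_succ (i : ℕ) : signAfter (i + 1) = -signAfter i := by
  unfold signAfter
  push_cast
  omega

theorem signAfter_of_even {i : ℕ} (h : Even i) : signAfter i = 1 := by
  obtain ⟨j, rfl⟩ := h
  unfold signAfter
  push_cast
  omega

theorem signAfter_of_not_even {i : ℕ} (h : ¬ Even i) : signAfter i = -1 := by
  obtain ⟨j, rfl⟩ := Nat.not_even_iff_odd.1 h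
  unfold signAfter
  push_cast
  omega

/-- The thresholds: the `i + 1`-st one is the smallest `m k` above the `i`-th one such that `k` has
the other label, and `S` if there is none. -/
def threshold (N : ℕ) (m y : ℕ → ℤ) (S : ℤ) : ℕ → ℤ
  | 0 => -1
  | i + 1 => minAbove m y S (signAfter i) (threshold N m y S i) N

section Threshold

variable {N : ℕ} {m y : ℕ → ℤ} {S : ℤ}

theorem threshold_succ_eq (i : ℕ) : threshold N m y S (i + 1) = S ∨
    ∃ l < N, 0 < signAfter i * y l ∧ threshold N m y S i < m l ∧
      threshold N m y S (i + 1) = m l :=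
  minAbove_eq _ _ _ _ _ _

theorem threshold_succ_nonneg (hm : ∀ k < N, 0 ≤ m k) (hS : 0 ≤ S) {i : ℕ} (hi : 0 < i) :
    0 ≤ threshold N m y S i := by
  obtain ⟨i, rfl⟩ := Nat.exists_eq_succ_of_ne_zero hi.ne'
  rcases threshold_succ_eq (N := N) (m := m) (y := y) (S := S) i with h | ⟨l, hl, -, -, h⟩
  · rw [h]; exact hS
  · rw [h]; exact hm l hl

theorem threshold_le (hS : 0 ≤ S) (i : ℕ) : threshold N m y S i ≤ S := by
  cases i with
  | zero => rw [threshold]; omega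
  | succ i => exact minAbove_le _ _ _ _ _ _

theorem threshold_lt_succ {i : ℕ} (h : threshold N m y S i < S) :
    threshold N m y S i < threshold N m y S (i + 1) := by
  rcases threshold_succ_eq (N := N) (m := m) (y := y) (S := S) i with h' | ⟨l, hl, -, h1, h2⟩
  · rwa [h']
  · rwa [h2]

theorem threshold_mono (hS : 0 ≤ S) :
    Monotone (threshold N m y S) := by
  refine monotone_nat_of_le_succ fun i => ?_
  rcases (threshold_le (N := N) (m := m) (y := y) hS i).lt_or_eq with h | h
  · exact (threshold_lt_succ h).le
  · rcases threshold_succ_eq (N := N) (m := m) (y := y) (S := S) i with h' | ⟨l, hl, -, h1, h2⟩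
    · rw [h', h]
    · rw [h2]; exact h1.le

/-- As long as they stay below S, the thresholds increase strictly, and all but the 0-th are
projections of data points; there are only N of those. -/
theorem le_of_threshold_lt (hS : 0 ≤ S) {i : ℕ}
    (h : threshold N m y S i < S) : i ≤ N := by
  have hlt : ∀ j < i, threshold N m y S j < threshold N m y S (j + 1) := fun j hj =>
    threshold_lt_succ ((threshold_mono hS hj.le).trans_lt h)
  have hinj : Set.InjOn (fun j => threshold N m y S (j + 1)) (Finset.range i : Set ℕ) := by
    have hstrict : ∀ a b, a < b → b ≤ i → threshold N m y S a < threshold N m y S b := by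
      intro a b hab hb
      exact (hlt a (by omega)).trans_le (threshold_mono hS hab)
    intro a ha b hb hab
    simp only [Finset.coe_range, Set.mem_Iio] at ha hb
    rcases lt_trichotomy a b with hlt | heq | hgt
    · exact absurd hab (hstrict _ _ (by omega) (by omega)).ne
    · exact heq
    · exact absurd hab (hstrict _ _ (by omega) (by omega)).ne'
  have hmaps : ∀ j ∈ Finset.range i, threshold N m y S (j + 1) ∈ (Finset.range N).image m := by
    intro j hj
    have hj := Finset.mem_range.1 hj
    rcases threshold_succ_eq (N := N) (m := m) (y := y) (S := S) j with h' | ⟨l, hl, -, -, h2⟩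
    · have : threshold N m y S (j + 1) ≤ threshold N m y S i := threshold_mono hS hj
      omega
    · exact Finset.mem_image.2 ⟨l, Finset.mem_range.2 hl, h2.symm⟩
  have := Finset.card_le_card_of_injOn _ hmaps hinj
  simpa using this.trans Finset.card_image_le

/-- The thresholds below `m k`, and their number modulo `2`. -/
theorem exists_threshold_index (hm : ∀ k < N, 0 ≤ m k) (hmS : ∀ k < N, m k < S)
    (hy : ∀ k < N, y k = -1 ∨ y k = 1)
    (hsep : ∀ k < N, ∀ l < N, y k ≠ y l → 2 ≤ |m k - m l|) {k : ℕ} (hk : k < N) {u : ℝ}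
    (hu : (m k : ℝ) + 1 ≤ u) (hu' : u < m k + 2) (huS : u ≤ S) :
    ∃ i ≤ N, (y k = if Even i then -1 else 1) ∧
      ∀ j, ramp (u - threshold N m y S j) = if j ≤ i then 1 else 0 := by
  have hS : 0 ≤ S := by have := hm k hk; have := hmS k hk; omega
  have hmono := threshold_mono (N := N) (m := m) (y := y) hS
  set τ := threshold N m y S with hτ
  -- By monotonicity the thresholds that do not exceed m k form an initial segment; i is its last
  -- index.
  have hex : ∃ i, i ≤ N ∧ ∀ j, τ j ≤ m k ↔ j ≤ i := by
    have h0 : τ 0 ≤ m k := by have := hm k hk; rw [hτ, threshold]; omega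
    refine ⟨Nat.findGreatest (fun i => τ i ≤ m k) N, Nat.findGreatest_le N, fun j => ⟨fun h => ?_,
      fun h => ?_⟩⟩
    · exact Nat.le_findGreatest (le_of_threshold_lt hS (h.trans_lt (hmS k hk))) h
    · exact (hmono h).trans (Nat.findGreatest_spec (P := fun i => τ i ≤ m k) (Nat.zero_le N) h0)
  obtain ⟨i, hiN, hi⟩ := hex
  -- If the threshold after τ j is sought among the points with the label of k, then τ j is -1, S,
  -- or the projection of a point with the other label. In the last case separation excludes
  -- equality.
  have hne : ∀ j, 0 < signAfter j * y k → τ j ≠ m k := by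
    intro j hj h
    cases j with
    | zero => have := hm k hk; rw [hτ, threshold] at h; omega
    | succ j =>
      rcases threshold_succ_eq (N := N) (m := m) (y := y) (S := S) j with h' | ⟨l, hl, h1, -, h2⟩
      · have := hmS k hk
        rw [hτ, h'] at h
        omega
      · have hne : y k ≠ y l := by
          intro e
          rw [signAfter_succ, e] at hj
          linarith
        have := hsep k hk l hl hne
        rw [← h, ← h2, sub_self, abs_zero] at this
        omega
  -- So k is itself a candidate for the next threshold.
  have hnext : ∀ j, 0 < signAfter j * y k → τ j ≤ m k → τ (j + 1) ≤ m k := fun j hj h =>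
    minAbove_le_apply S hk hj (lt_of_le_of_ne h (hne j hj))
  refine ⟨i, hiN, ?_, fun j => ?_⟩
  -- Otherwise the next threshold would not exceed m k either, against the choice of i. Thus the
  -- parity of i determines the label.
  · have h1 : ¬ 0 < signAfter i * y k := fun h => by
      have := (hi (i + 1)).1 (hnext i h ((hi i).2 le_rfl))
      omega
    split_ifs with h
    · rw [signAfter_of_even h] at h1
      rcases hy k hk with h | h <;> omega
    · rw [signAfter_of_not_even h] at h1
      rcases hy k hk with h | h <;> omega
  · split_ifs with h
    · have h' : (τ j : ℝ) ≤ m k := by exact_mod_cast (hi j).2 h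
      exact ramp_of_one_le (by linarith)
    · have h1 : m k + 1 ≤ τ j := by
        by_contra h'
        exact h ((hi j).1 (by omega))
      refine ramp_of_nonpos ?_
      -- As u lies anywhere in [m k + 1, m k + 2), a threshold at m k + 1 could give a ramp strictly
      -- between 0 and 1. By separation such a threshold, if it is not S, belongs to a point with
      -- the same label as k; but then k was a candidate in the same step and has a smaller
      -- projection.
      suffices hsuff : m k + 2 ≤ τ j ∨ τ j = S by
        rcases hsuff with h | h
        · have : (m k : ℝ) + 2 ≤ τ j := by exact_mod_cast h
          linarith
        · rw [h]; linarith
      by_contra hcon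
      rw [not_or] at hcon
      have h2 : τ j = m k + 1 := by omega
      obtain ⟨j, rfl⟩ : ∃ a, j = a + 1 := ⟨j - 1, by omega⟩
      rcases threshold_succ_eq (N := N) (m := m) (y := y) (S := S) j with h' | ⟨l, hl, h3, h4, h5⟩
      · exact hcon.2 h'
      · have hy' : y k = y l := by
          by_contra hne
          have := hsep k hk l hl hne
          rw [← h5, ← hτ, h2, abs_sub_comm, add_sub_cancel_left, abs_one] at this
          omega
        have := hnext j (by rwa [hy']) (by rw [← h5, ← hτ, h2] at h4; omega)
        omega

end Threshold

/-- Networks memorize data that are separated by rounded projections. -/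
theorem memorizes_memoNet {n N K s : ℕ} {w m y : ℕ → ℤ} (hs : N < s * (2 * s))
    (hm : ∀ k < N, 0 ≤ m k) (hmS : ∀ k < N, m k < 2 ^ K - 1) (hy : ∀ k < N, y k = -1 ∨ y k = 1)
    (hsep : ∀ k < N, ∀ l < N, y k ≠ y l → 2 ≤ |m k - m l|) {k : ℕ} (hk : k < N) {x : Fin n → ℝ}
    (hx : (m k : ℝ) ≤ ∑ j : Fin n, (w j : ℝ) * x j)
    (hx' : ∑ j : Fin n, (w j : ℝ) * x j < m k + 1)
    (hxS : (∑ j : Fin n, (w j : ℝ) * x j) + 1 ≤ 2 ^ K - 1) :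
    Real.sign ((memoNet n w (memoLayers K s (threshold N m y (2 ^ K - 1)))).toReal.eval x) =
      y k := by
  have hs0 : 0 < s := Nat.pos_of_ne_zero fun h => by simp [h] at hs
  have hS : (0 : ℤ) ≤ 2 ^ K - 1 := by have := hm k hk; have := hmS k hk; omega
  obtain ⟨i, hi, hyi, hτ⟩ := exists_threshold_index hm hmS hy hsep hk
    (u := (∑ j : Fin n, (w j : ℝ) * x j) + 1) (by linarith) (by linarith) (by push_cast; exact hxS)
  have hmk : (0 : ℝ) ≤ m k := by exact_mod_cast hm k hk
  rw [eval_memoNet _ _ _ _ (by linarith)]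
  have := runLayers_memoLayers (K := K) (s := s) (i := i) hs0
    (fun i hi => threshold_succ_nonneg hm hS hi)
    (fun i _ => lt_of_le_of_lt (threshold_le hS i) (by omega)) (by linarith) (by omega) hτ
  rw [runLayers] at this
  rw [this, hyi]
  split_ifs
  · rw [Real.sign_of_neg (by norm_num)]
    norm_num
  · rw [Real.sign_of_pos (by norm_num)]
    norm_num

/-! ### Projections and precision -/

/-- The square of the distance of the points `X a` and `X b`. -/
noncomputable def sqDist (n : ℕ) (X : ℕ → ℕ → ℝ) (a b : ℕ) : ℝ :=
  ∑ j ∈ Finset.range n, (X a j - X b j) * (X a j - X b j)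

/-- A number that determines the size of the weights of the projection. -/
noncomputable def resolution (n N : ℕ) (X : ℕ → ℕ → ℝ) (Y : ℕ → ℤ) : ℤ :=
  ∑ a ∈ Finset.range N, ∑ b ∈ Finset.range N,
    (1 - Y a * Y b) * (⌊(8 * n * N * N : ℝ) / sqDist n X a b⌋ + 1)

/-- The number of bits of the weights of the projection. -/
noncomputable def precision (n N : ℕ) (X : ℕ → ℕ → ℝ) (Y : ℕ → ℤ) : ℕ :=
  Nat.size (resolution n N X Y).toNat

/-- The rounded projections of the points. -/
noncomputable def proj (n : ℕ) (X : ℕ → ℕ → ℝ) (w : ℕ → ℤ) (a : ℕ) : ℤ :=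
  ⌊∑ j ∈ Finset.range n, (w j : ℝ) * X a j⌋

/-- This number is zero if and only if points with different labels have rounded projections at
distance at least `2`. -/
def defect (N : ℕ) (Y m : ℕ → ℤ) : ℤ :=
  ∑ a ∈ Finset.range N, ∑ b ∈ Finset.range N,
    (1 - Y a * Y b) * (4 / ((m a - m b) * (m a - m b) + 1))

/-- The number of bits of the projections. -/
def codeLength (n k : ℕ) : ℕ := Nat.size (n * (2 ^ k - 1) + 1)

/-- The network for weights `w` with `k` bits and rounded projections `m`. -/
def memorizer (n N k : ℕ) (w m Y : ℕ → ℤ) : Network ℚ n :=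
  memoNet n w (memoLayers (codeLength n k) (Nat.sqrt N + 1)
    (threshold N m Y (2 ^ codeLength n k - 1)))

/-! ### Arithmetic tests for different labels and for separation -/

theorem one_sub_mul_nonneg {a b : ℤ} (ha : a = -1 ∨ a = 1) (hb : b = -1 ∨ b = 1) :
    0 ≤ 1 - a * b := by
  rcases ha with rfl | rfl <;> rcases hb with rfl | rfl <;> norm_num

/-- The factor 1 - ab is 2 for different labels and 0 for equal ones; it selects the relevant pairs
in sums without any case distinction. -/
theorem one_sub_mul_of_ne {a b : ℤ} (ha : a = -1 ∨ a = 1) (hb : b = -1 ∨ b = 1) (h : a ≠ b) :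
    1 - a * b = 2 := by
  rcases ha with rfl | rfl <;> rcases hb with rfl | rfl <;> simp_all

theorem one_sub_mul_self {a : ℤ} (ha : a = -1 ∨ a = 1) : 1 - a * a = 0 := by
  rcases ha with rfl | rfl <;> norm_num

/-- The quotient is 4 for z = 0, 2 for |z| = 1, and 0 as soon as z² + 1 ≥ 5. So the test for
distance 2 is one integer division with a nonnegative result. -/
theorem four_div_eq_zero_iff (z : ℤ) : 4 / (z * z + 1) = 0 ↔ 2 ≤ |z| := by
  have h0 : 0 ≤ z * z := mul_self_nonneg z
  constructor
  · intro h
    by_contra hz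
    have h1 := abs_lt.1 (not_le.1 hz)
    have h2 : -1 ≤ z := by omega
    have h3 : z ≤ 1 := by omega
    interval_cases z <;> simp at h
  · intro h
    have : 2 * 2 ≤ |z| * |z| := mul_le_mul h h (by norm_num) (abs_nonneg z)
    rw [abs_mul_abs_self] at this
    exact Int.ediv_eq_zero_of_lt (by norm_num) (by omega)

theorem defect_eq_zero_iff {N : ℕ} {Y m : ℕ → ℤ} (hY : ∀ a < N, Y a = -1 ∨ Y a = 1) :
    defect N Y m = 0 ↔ ∀ a < N, ∀ b < N, Y a ≠ Y b → 2 ≤ |m a - m b| := by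
  have hnn : ∀ a < N, ∀ b < N,
      0 ≤ (1 - Y a * Y b) * (4 / ((m a - m b) * (m a - m b) + 1)) := fun a ha b hb =>
    mul_nonneg (one_sub_mul_nonneg (hY a ha) (hY b hb))
      (Int.ediv_nonneg (by norm_num) (by have := mul_self_nonneg (m a - m b); omega))
  rw [defect, Finset.sum_eq_zero_iff_of_nonneg fun a ha =>
    Finset.sum_nonneg fun b hb => hnn a (Finset.mem_range.1 ha) b (Finset.mem_range.1 hb)]
  refine ⟨fun h a ha b hb hab => ?_, fun h a ha => Finset.sum_eq_zero fun b hb => ?_⟩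
  · have h1 := (Finset.sum_eq_zero_iff_of_nonneg fun b hb =>
      hnn a ha b (Finset.mem_range.1 hb)).1 (h a (Finset.mem_range.2 ha)) b (Finset.mem_range.2 hb)
    rw [one_sub_mul_of_ne (hY a ha) (hY b hb) hab] at h1
    exact (four_div_eq_zero_iff _).1 (by omega)
  · have ha := Finset.mem_range.1 ha
    have hb := Finset.mem_range.1 hb
    by_cases hab : Y a = Y b
    · rw [hab, one_sub_mul_self (hY b hb), zero_mul]
    · rw [(four_div_eq_zero_iff _).2 (h a ha b hb hab), mul_zero]

theorem sqrt_succ_bound (N : ℕ) : N < (Nat.sqrt N + 1) * (2 * (Nat.sqrt N + 1)) := by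
  have := Nat.lt_succ_sqrt N
  rw [Nat.succ_eq_add_one] at this
  nlinarith

/-- With coordinates in [0, 1] and weights below 2^k the projections lie in [0, n(2^k - 1)]. The
code length is chosen so that even after the shift by 1 they do not exceed the cap 2^K - 1. -/
theorem sign_eval_memorizer {n N k : ℕ} {X : ℕ → ℕ → ℝ} {Y w : ℕ → ℤ}
    (hX : ∀ a < N, ∀ j < n, X a j ∈ Set.Icc (0 : ℝ) 1) (hY : ∀ a < N, Y a = -1 ∨ Y a = 1)
    (hw : ∀ j < n, 0 ≤ w j ∧ w j < 2 ^ k) (hd : defect N Y (proj n X w) = 0) {a : ℕ} (ha : a < N) :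
    Real.sign ((memorizer n N k w (proj n X w) Y).toReal.eval fun j : Fin n => X a j) = Y a := by
  have h0 : ∀ a < N, 0 ≤ ∑ j ∈ Finset.range n, (w j : ℝ) * X a j := fun a ha =>
    Finset.sum_nonneg fun j hj => mul_nonneg
      (by exact_mod_cast (hw j (Finset.mem_range.1 hj)).1) (hX a ha j (Finset.mem_range.1 hj)).1
  have h1 : ∀ a < N, ∑ j ∈ Finset.range n, (w j : ℝ) * X a j ≤ ((n * (2 ^ k - 1) : ℕ) : ℝ) := by
    intro a ha
    have : ∀ j ∈ Finset.range n, (w j : ℝ) * X a j ≤ ((2 ^ k - 1 : ℕ) : ℝ) := by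
      intro j hj
      have hj := Finset.mem_range.1 hj
      have h2 := (hX a ha j hj).2
      have h3 := hw j hj
      have h4 : (w j : ℝ) ≤ ((2 ^ k - 1 : ℕ) : ℝ) := by
        have : w j ≤ ((2 ^ k - 1 : ℕ) : ℤ) := by
          rw [Nat.cast_sub Nat.one_le_two_pow]; push_cast; omega
        exact_mod_cast this
      have h5 : (0 : ℝ) ≤ w j := by exact_mod_cast h3.1
      nlinarith
    refine (Finset.sum_le_sum this).trans (le_of_eq ?_)
    rw [Finset.sum_const, Finset.card_range, nsmul_eq_mul, Nat.cast_mul]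
  -- A number is smaller than 2 to the power of its binary length.
  have hK : n * (2 ^ k - 1) + 1 + 1 ≤ 2 ^ codeLength n k := Nat.lt_size_self _
  have hK' : ((n * (2 ^ k - 1) : ℕ) : ℝ) + 2 ≤ 2 ^ codeLength n k := by
    have : ((n * (2 ^ k - 1) + 1 + 1 : ℕ) : ℝ) ≤ ((2 ^ codeLength n k : ℕ) : ℝ) := by
      exact_mod_cast hK
    push_cast at this ⊢
    linarith
  have hsum : ∀ a, ∑ j : Fin n, (w j : ℝ) * X a j = ∑ j ∈ Finset.range n, (w j : ℝ) * X a j :=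
    fun a => (Finset.sum_range fun j => (w j : ℝ) * X a j).symm
  refine memorizes_memoNet (m := proj n X w) (sqrt_succ_bound N) (fun a ha => Int.floor_nonneg.2 (h0 a ha))
    (fun a ha => ?_) hY ((defect_eq_zero_iff hY).1 hd) ha ?_ ?_ ?_
  · rw [proj, Int.floor_lt]
    push_cast
    have := h1 a ha
    linarith
  · rw [hsum]; exact Int.floor_le _
  · rw [hsum]; exact Int.lt_floor_add_one _
  · rw [hsum]
    have := h1 a ha
    linarith

/-! ### The size of the networks -/

theorem length_memorizer_le (N K : ℕ) (hN : 0 < N) (hK : 0 < K) (τ : ℕ → ℤ) :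
    ((memoLayers K (Nat.sqrt N + 1) τ).length : ℝ) + 2 ≤ 40 * (Real.sqrt N * K) := by
  rw [length_memoLayers]
  have h1 : ((2 * (Nat.sqrt N + 1) + (2 * (Nat.sqrt N + 1) - 1) * (2 * K + 2) : ℕ) : ℝ) ≤
      ((12 * (Nat.sqrt N + 1) * K : ℕ) : ℝ) := by
    have : (2 * (Nat.sqrt N + 1) + (2 * (Nat.sqrt N + 1) - 1) * (2 * K + 2)) ≤
        12 * (Nat.sqrt N + 1) * K := by
      have h2 : (2 * (Nat.sqrt N + 1) - 1) * (2 * K + 2) ≤ 2 * (Nat.sqrt N + 1) * (2 * K + 2) :=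
        Nat.mul_le_mul_right _ (Nat.sub_le _ _)
      nlinarith
    exact_mod_cast this
  have h2 : (Nat.sqrt N : ℝ) ≤ Real.sqrt N := Real.nat_sqrt_le_real_sqrt
  have h3 : 1 ≤ Real.sqrt N := Real.one_le_sqrt.2 (by exact_mod_cast hN)
  have h4 : (1 : ℝ) ≤ K := by exact_mod_cast hK
  push_cast at h1 ⊢
  nlinarith [mul_le_mul h3 h4 zero_le_one (by linarith), mul_le_mul_of_nonneg_right h2 (by linarith : (0:ℝ) ≤ K), mul_le_mul_of_nonneg_right h3 (by linarith : (0:ℝ) ≤ K)]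

theorem codeLength_pos (n k : ℕ) : 0 < codeLength n k := Nat.size_pos.2 (Nat.succ_pos _)

theorem two_pow_size_le {x : ℕ} (hx : 0 < x) : 2 ^ Nat.size x ≤ 2 * x := by
  have h := Nat.size_pos.2 hx
  obtain ⟨k, hk⟩ := Nat.exists_eq_succ_of_ne_zero h.ne'
  have : 2 ^ k ≤ x := Nat.lt_size.1 (by omega)
  rw [hk, pow_succ]
  omega

theorem resolution_eq_zero {n N : ℕ} {X : ℕ → ℕ → ℝ} {Y : ℕ → ℤ}
    (hY : ∀ a < N, Y a = -1 ∨ Y a = 1) (h : ∀ a < N, ∀ b < N, Y a = Y b) :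
    resolution n N X Y = 0 :=
  Finset.sum_eq_zero fun a ha => Finset.sum_eq_zero fun b hb => by
    rw [h a (Finset.mem_range.1 ha) b (Finset.mem_range.1 hb),
      one_sub_mul_self (hY b (Finset.mem_range.1 hb)), zero_mul]

theorem sqDist_nonneg (n : ℕ) (X : ℕ → ℕ → ℝ) (a b : ℕ) : 0 ≤ sqDist n X a b :=
  Finset.sum_nonneg fun _ _ => mul_self_nonneg _

theorem sqDist_le {n N : ℕ} {X : ℕ → ℕ → ℝ} (hX : ∀ a < N, ∀ j < n, X a j ∈ Set.Icc (0 : ℝ) 1)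
    {a b : ℕ} (ha : a < N) (hb : b < N) : sqDist n X a b ≤ n := by
  have : sqDist n X a b ≤ ∑ j ∈ Finset.range n, (1 : ℝ) := Finset.sum_le_sum fun j hj => by
    have h1 := hX a ha j (Finset.mem_range.1 hj)
    have h2 := hX b hb j (Finset.mem_range.1 hj)
    rw [← abs_mul_abs_self]
    have : |X a j - X b j| ≤ 1 := abs_le.2 ⟨by linarith [h1.1, h2.2], by linarith [h1.2, h2.1]⟩
    nlinarith [abs_nonneg (X a j - X b j)]
  simpa using this

theorem resolution_le {n N : ℕ} {X : ℕ → ℕ → ℝ} {Y : ℕ → ℤ} {c : ℝ} (hc : 0 < c)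
    (hY : ∀ a < N, Y a = -1 ∨ Y a = 1)
    (hsep : ∀ a < N, ∀ b < N, Y a ≠ Y b → c ^ 2 ≤ sqDist n X a b) :
    (resolution n N X Y : ℝ) ≤ N * N * (2 * (8 * n * N * N / c ^ 2 + 1)) := by
  have hE : (0 : ℝ) ≤ 2 * (8 * n * N * N / c ^ 2 + 1) := by positivity
  have key : ∀ a ∈ Finset.range N, ∀ b ∈ Finset.range N,
      (((1 - Y a * Y b) * (⌊(8 * n * N * N : ℝ) / sqDist n X a b⌋ + 1) : ℤ) : ℝ) ≤
        2 * (8 * n * N * N / c ^ 2 + 1) := by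
    intro a ha b hb
    have ha := Finset.mem_range.1 ha
    have hb := Finset.mem_range.1 hb
    by_cases hab : Y a = Y b
    · rw [hab, one_sub_mul_self (hY b hb), zero_mul]
      simpa using hE
    · rw [one_sub_mul_of_ne (hY a ha) (hY b hb) hab]
      have h1 := Int.floor_le ((8 * n * N * N : ℝ) / sqDist n X a b)
      have h2 : (8 * n * N * N : ℝ) / sqDist n X a b ≤ 8 * n * N * N / c ^ 2 :=
        div_le_div_of_nonneg_left (by positivity) (by positivity) (hsep a ha b hb hab)
      push_cast
      linarith
  rw [resolution]
  push_cast
  push_cast at key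
  calc _ ≤ ∑ a ∈ Finset.range N, ∑ b ∈ Finset.range N,
        (2 * (8 * n * N * N / c ^ 2 + 1) : ℝ) :=
        Finset.sum_le_sum fun a ha => Finset.sum_le_sum fun b hb => key a ha b hb
    _ = _ := by simp; ring

/-- If all labels agree, the precision is 0 and the code has one digit. Otherwise 2^K is at most a
fixed power of Z = Nn/c, and taking logarithms gives the bound: 11 from the exponent, and a factor 2
from log 2 ≥ 1/2. -/
theorem codeLength_le {n N : ℕ} {X : ℕ → ℕ → ℝ} {Y : ℕ → ℤ} {c : ℝ} (hn : 0 < n) (hc : 0 < c)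
    (hX : ∀ a < N, ∀ j < n, X a j ∈ Set.Icc (0 : ℝ) 1) (hY : ∀ a < N, Y a = -1 ∨ Y a = 1)
    (hsep : ∀ a < N, ∀ b < N, Y a ≠ Y b → c ^ 2 ≤ sqDist n X a b) :
    (codeLength n (precision n N X Y) : ℝ) ≤ 22 * Real.log (max 2 ((N : ℝ) * n / c)) := by
  have hlog2 : (1 / 2 : ℝ) ≤ Real.log 2 := by linarith [Real.log_two_gt_d9]
  have hlogmax : Real.log 2 ≤ Real.log (max 2 ((N : ℝ) * n / c)) :=
    Real.log_le_log (by norm_num) (le_max_left _ _)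
  by_cases hall : ∀ a < N, ∀ b < N, Y a = Y b
  · rw [precision, resolution_eq_zero hY hall]
    simp [codeLength]
    linarith
  · push Not at hall
    obtain ⟨a, ha, b, hb, hab⟩ := hall
    have hN : 2 ≤ N := by
      by_contra h
      have ha0 : a = b := by omega
      exact hab (by rw [ha0])
    have hn' : (1 : ℝ) ≤ n := by exact_mod_cast hn
    have hN' : (2 : ℝ) ≤ N := by exact_mod_cast hN
    -- Two different labels occur, so c is at most the diameter √n of the cube. This gives c ≤ n and
    -- therefore Z ≥ N ≥ 2.
    have hcn2 : c ^ 2 ≤ n := (hsep a ha b hb hab).trans (sqDist_le hX ha hb)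
    have hcn : c ≤ n := by nlinarith
    set Z : ℝ := (N : ℝ) * n / c with hZ
    have hZN : (N : ℝ) ≤ Z := by
      rw [hZ, le_div_iff₀ hc]
      nlinarith
    have hZ2 : 2 ≤ Z := hN'.trans hZN
    rw [max_eq_right hZ2]
    have hres := resolution_le hc hY hsep
    set H := resolution n N X Y with hH
    set k := precision n N X Y with hk
    have hkH : ((2 ^ k : ℕ) : ℝ) ≤ 2 * (N * N * (2 * (8 * n * N * N / c ^ 2 + 1))) := by
      rcases Nat.eq_zero_or_pos H.toNat with h0 | hpos
      · rw [hk, precision, ← hH, h0]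
        have : (1 : ℝ) ≤ N * N * (2 * (8 * n * N * N / c ^ 2 + 1)) := by
          have h1 : (0 : ℝ) ≤ 8 * n * N * N / c ^ 2 := by positivity
          nlinarith
        simp
        linarith
      · have h1 : 2 ^ k ≤ 2 * H.toNat := two_pow_size_le hpos
        have h2 : ((2 ^ k : ℕ) : ℝ) ≤ ((2 * H.toNat : ℕ) : ℝ) := by exact_mod_cast h1
        have h3 : ((H.toNat : ℕ) : ℝ) = (H : ℝ) := by
          have : ((H.toNat : ℕ) : ℤ) = H := Int.toNat_of_nonneg (by omega)
          exact_mod_cast this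
        push_cast at h2 ⊢
        linarith
    have hE : (1 : ℝ) ≤ n * N * N / c ^ 2 := by
      rw [le_div_iff₀ (by positivity)]
      have : (1 : ℝ) ≤ N * N := by nlinarith
      nlinarith [mul_le_mul hcn2 this zero_le_one (by linarith)]
    have hK : ((2 ^ codeLength n k : ℕ) : ℝ) ≤ Z ^ 11 := by
      have h1 : 2 ^ codeLength n k ≤ 2 * (n * (2 ^ k - 1) + 1) := two_pow_size_le (Nat.succ_pos _)
      have h2 : n * (2 ^ k - 1) + 1 ≤ n * 2 ^ k := by
        have : 1 ≤ 2 ^ k := Nat.one_le_two_pow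
        obtain ⟨x, hx⟩ := Nat.exists_eq_add_of_le this
        rw [hx]
        have : 1 + x - 1 = x := by omega
        rw [this]
        nlinarith
      have h3 : ((2 ^ codeLength n k : ℕ) : ℝ) ≤ ((2 * (n * 2 ^ k) : ℕ) : ℝ) := by
        exact_mod_cast h1.trans (Nat.mul_le_mul_left 2 h2)
      -- With E = nN²/c² ≥ 1 one has 2^k ≤ N²(32E + 4) ≤ 36N²E, and nN²E = Z²N².
      have h4 : ((2 * (n * 2 ^ k) : ℕ) : ℝ) ≤ 72 * Z ^ 2 * N ^ 2 := by
        push_cast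
        push_cast at hkH
        have h8 : (72 * Z ^ 2 * N ^ 2 : ℝ) = 2 * n * (36 * (N * N * (n * N * N / c ^ 2))) := by
          rw [hZ]; ring
        have h6 : (8 * n * N * N / c ^ 2 : ℝ) = 8 * (n * N * N / c ^ 2) := by ring
        rw [h8]
        rw [h6] at hkH
        generalize (n * N * N / c ^ 2 : ℝ) = E at hkH hE ⊢
        have h7 : (N : ℝ) * N * 1 ≤ N * N * E := mul_le_mul_of_nonneg_left hE (by positivity)
        have h5 : (2 : ℝ) ^ k ≤ 36 * (N * N * E) := by linarith
        rw [← mul_assoc]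
        exact mul_le_mul_of_nonneg_left h5 (by positivity)
      have h9 : (72 : ℝ) ≤ Z ^ 7 := by
        have : (2 : ℝ) ^ 7 ≤ Z ^ 7 := pow_le_pow_left₀ (by norm_num) hZ2 7
        linarith
      have h10 : (N : ℝ) ^ 2 ≤ Z ^ 2 := pow_le_pow_left₀ (by positivity) hZN 2
      calc ((2 ^ codeLength n k : ℕ) : ℝ) ≤ 72 * Z ^ 2 * N ^ 2 := h3.trans h4
        _ ≤ Z ^ 7 * Z ^ 2 * Z ^ 2 := by gcongr
        _ = Z ^ 11 := by ring
    have hlog := Real.log_le_log (by positivity) hK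
    push_cast at hlog
    rw [Real.log_pow, Real.log_pow] at hlog
    push_cast at hlog
    have := mul_le_mul_of_nonneg_left hlog2 (Nat.cast_nonneg (codeLength n k) : (0 : ℝ) ≤ _)
    linarith

/-! ### Events that depend on finitely many coin tosses -/

instance : IsProbabilityMeasure coinMeasure := by
  unfold coinMeasure; infer_instance

/-- The property `Q` depends only on the tosses with index in `S`. -/
def DependsOnTosses (Q : (ℕ → Bool) → Prop) (S : Finset ℕ) : Prop :=
  ∀ ω ω', (∀ i ∈ S, ω i = ω' i) → (Q ω ↔ Q ω')

/-- An extension of a finite sequence of tosses to an infinite one. -/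
def extendTosses {S : Finset ℕ} (z : S → Bool) (i : ℕ) : Bool :=
  if h : i ∈ S then z ⟨i, h⟩ else false

theorem DependsOnTosses.eq_preimage {Q : (ℕ → Bool) → Prop} {S : Finset ℕ}
    (h : DependsOnTosses Q S) : {ω | Q ω} = S.restrict ⁻¹' {z | Q (extendTosses z)} := by
  ext ω
  exact h _ _ fun i hi => by simp [extendTosses, hi]

theorem DependsOnTosses.measurableSet {Q : (ℕ → Bool) → Prop} {S : Finset ℕ}
    (h : DependsOnTosses Q S) : MeasurableSet {ω | Q ω} := by
  rw [h.eq_preimage]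
  exact (Finset.measurable_restrict S) (Set.toFinite _).measurableSet

theorem DependsOnTosses.measure_inter {Q R : (ℕ → Bool) → Prop} {S T : Finset ℕ}
    (hQ : DependsOnTosses Q S) (hR : DependsOnTosses R T) (h : Disjoint S T) :
    coinMeasure.real {ω | Q ω ∧ R ω} = coinMeasure.real {ω | Q ω} * coinMeasure.real {ω | R ω} := by
  have hind : ProbabilityTheory.iIndepFun (fun (i : ℕ) (ω : ℕ → Bool) => ω i) coinMeasure :=
    ProbabilityTheory.iIndepFun_infinitePi (X := fun _ b => b) fun _ => measurable_id
  have h2 := hind.indepFun_finset S T h fun i => measurable_pi_apply i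
  have h3 := h2.measure_inter_preimage_eq_mul {z : S → Bool | Q (extendTosses z)}
    {z : T → Bool | R (extendTosses z)} (Set.toFinite _).measurableSet
    (Set.toFinite _).measurableSet
  rw [measureReal_def, measureReal_def, measureReal_def, ← ENNReal.toReal_mul, Set.ofPred_and,
    hQ.eq_preimage, hR.eq_preimage]
  exact congrArg _ h3

theorem coinMeasure_cylinder (S : Finset ℕ) (v : ℕ → Bool) :
    coinMeasure.real {ω | ∀ i ∈ S, ω i = v i} = (1 / 2) ^ S.card := by
  have h1 : {ω : ℕ → Bool | ∀ i ∈ S, ω i = v i} = Set.pi S fun i => {v i} := by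
    ext ω; simp [Set.mem_pi]
  rw [measureReal_def, h1, coinMeasure, Measure.infinitePi_pi _ fun i _ => measurableSet_singleton _]
  simp

/-- Conditioning on finitely many tosses: the event Q splits into cylinders, one for each admissible
pattern on T. On a cylinder the second argument of R may be frozen to that pattern, and what remains
depends on S only, hence is independent of the cylinder. -/
theorem DependsOnTosses.measure_le_mul {Q : (ℕ → Bool) → Prop} {R : (ℕ → Bool) → (ℕ → Bool) → Prop}
    {S T : Finset ℕ} {p : ℝ} (hQ : DependsOnTosses Q T)
    (hR : ∀ η, DependsOnTosses (fun ω => R ω η) S) (hR' : ∀ ω, DependsOnTosses (R ω) T)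
    (hd : Disjoint S T) (hp : ∀ η, Q η → coinMeasure.real {ω | R ω η} ≤ p) :
    coinMeasure.real {ω | Q ω ∧ R ω ω} ≤ p * coinMeasure.real {ω | Q ω} := by
  classical
  have hF : ∀ η : ℕ → Bool, DependsOnTosses (fun ω => ∀ i ∈ T, ω i = η i) T := fun η ω ω' h =>
    forall₂_congr fun i hi => by rw [h i hi]
  set Z : Finset (T → Bool) := Finset.univ.filter fun z => Q (extendTosses z) with hZ
  have hext : ∀ ω : ℕ → Bool, ∀ i ∈ T, ω i = extendTosses (T.restrict ω) i := fun ω i hi => by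
    simp [extendTosses, hi]
  have h1 : {ω | Q ω ∧ R ω ω} ⊆ ⋃ z ∈ Z, {ω | R ω (extendTosses z) ∧
      ∀ i ∈ T, ω i = extendTosses z i} := by
    rintro ω ⟨hq, hr⟩
    simp only [Set.mem_iUnion]
    refine ⟨T.restrict ω, ?_, ?_, hext ω⟩
    · rw [hZ, Finset.mem_filter]
      exact ⟨Finset.mem_univ _, (hQ _ _ (hext ω)).1 hq⟩
    · exact (hR' ω _ _ (hext ω)).1 hr
  have h2 : (⋃ z ∈ Z, {ω : ℕ → Bool | ∀ i ∈ T, ω i = extendTosses z i}) ⊆ {ω | Q ω} := by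
    intro ω hω
    simp only [Set.mem_iUnion] at hω
    obtain ⟨z, hz, hω⟩ := hω
    exact (hQ _ _ hω).2 (Finset.mem_filter.1 hz).2
  have h3 : coinMeasure.real (⋃ z ∈ Z, {ω : ℕ → Bool | ∀ i ∈ T, ω i = extendTosses z i}) =
      ∑ z ∈ Z, coinMeasure.real {ω : ℕ → Bool | ∀ i ∈ T, ω i = extendTosses z i} := by
    refine measureReal_biUnion_finset (fun z _ z' _ hzz => ?_) fun z _ => (hF _).measurableSet
    refine Set.disjoint_left.2 fun ω h h' => hzz (funext fun i => ?_)
    have := (h i i.2).symm.trans (h' i i.2)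
    simpa [extendTosses] using this
  calc coinMeasure.real {ω | Q ω ∧ R ω ω}
      ≤ ∑ z ∈ Z, coinMeasure.real {ω | R ω (extendTosses z) ∧
          ∀ i ∈ T, ω i = extendTosses z i} :=
        (measureReal_mono h1 (measure_ne_top _ _)).trans (measureReal_biUnion_finset_le _ _)
    _ ≤ ∑ z ∈ Z, p * coinMeasure.real {ω : ℕ → Bool | ∀ i ∈ T, ω i = extendTosses z i} := by
        refine Finset.sum_le_sum fun z hz => ?_
        rw [(hR (extendTosses z)).measure_inter (hF (extendTosses z)) hd]
        exact mul_le_mul_of_nonneg_right (hp _ (Finset.mem_filter.1 hz).2) measureReal_nonneg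
    _ = p * coinMeasure.real (⋃ z ∈ Z, {ω : ℕ → Bool | ∀ i ∈ T, ω i = extendTosses z i}) := by
        rw [h3, Finset.mul_sum]
    _ ≤ _ := by
        -- The number p is nonnegative as soon as some outcome satisfies Q; if there is none, both
        -- sides vanish.
        rcases Z.eq_empty_or_nonempty with h0 | ⟨z, hz⟩
        · rcases Set.eq_empty_or_nonempty {ω | Q ω} with hE | ⟨η, hη⟩
          · simp [h0, hE]
          · have : 0 ≤ p := measureReal_nonneg.trans (hp η hη)
            exact mul_le_mul_of_nonneg_left (measureReal_mono h2) this
        · have : 0 ≤ p := measureReal_nonneg.trans (hp _ (Finset.mem_filter.1 hz).2)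
          exact mul_le_mul_of_nonneg_left (measureReal_mono h2) this

/-! ### Random integers -/

/-- The integer with the binary digits `ω i, …, ω (i + k - 1)`. -/
def tossedInt (ω : ℕ → Bool) (k i : ℕ) : ℤ :=
  ∑ b ∈ Finset.range k, 2 ^ b * (if ω (i + b) then 1 else 0)

theorem tossedInt_nonneg (ω : ℕ → Bool) (k i : ℕ) : 0 ≤ tossedInt ω k i :=
  Finset.sum_nonneg fun b _ => by split_ifs <;> positivity

theorem tossedInt_lt (ω : ℕ → Bool) (k i : ℕ) : tossedInt ω k i < 2 ^ k := by
  induction k with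
  | zero => simp [tossedInt]
  | succ k ih =>
    rw [tossedInt, Finset.sum_range_succ, ← tossedInt, pow_succ]
    have : (0 : ℤ) < 2 ^ k := by positivity
    split_ifs <;> omega

theorem tossedInt_congr {ω ω' : ℕ → Bool} {k i : ℕ} (h : ∀ b < k, ω (i + b) = ω' (i + b)) :
    tossedInt ω k i = tossedInt ω' k i :=
  Finset.sum_congr rfl fun b hb => by rw [h b (Finset.mem_range.1 hb)]

theorem tossedInt_inj {ω ω' : ℕ → Bool} {k i : ℕ} (h : tossedInt ω k i = tossedInt ω' k i) :
    ∀ b < k, ω (i + b) = ω' (i + b) := by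
  induction k with
  | zero => simp
  | succ k ih =>
    have h1 := tossedInt_lt ω k i
    have h2 := tossedInt_lt ω' k i
    have h3 := tossedInt_nonneg ω k i
    have h4 := tossedInt_nonneg ω' k i
    rw [tossedInt, tossedInt, Finset.sum_range_succ, Finset.sum_range_succ, ← tossedInt,
      ← tossedInt] at h
    have h5 : ω (i + k) = ω' (i + k) := by
      cases hx : ω (i + k) <;> cases hy : ω' (i + k) <;> simp [hx, hy] at h ⊢ <;> omega
    rw [h5] at h
    intro b hb
    rcases Nat.lt_succ_iff_lt_or_eq.1 hb with hb | rfl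
    · exact ih (by omega) b hb
    · exact h5

/-- Binary expansions are unique, so the event is empty or prescribes the results of k tosses. -/
theorem measure_tossedInt_eq_le (k i : ℕ) (v : ℤ) :
    coinMeasure.real {ω | tossedInt ω k i = v} ≤ (1 / 2) ^ k := by
  rcases Set.eq_empty_or_nonempty {ω | tossedInt ω k i = v} with h | ⟨η, hη⟩
  · rw [h]; simp
  · have := coinMeasure_cylinder (Finset.Ico i (i + k)) η
    rw [Nat.card_Ico, Nat.add_sub_cancel_left] at this
    rw [← this]
    refine measureReal_mono fun ω hω j hj => ?_
    obtain ⟨h1, h2⟩ := Finset.mem_Ico.1 hj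
    have := tossedInt_inj (hω.trans hη.symm) (j - i) (by omega)
    rwa [Nat.add_sub_cancel' h1] at this

/-- Anticoncentration of an affine function of a random integer. -/
theorem measure_abs_tossedInt_mul_add_lt (k i : ℕ) {d δ : ℝ} (hδ : 0 < δ) (hd : δ ≤ |d|) (e : ℝ) :
    coinMeasure.real {ω | |(tossedInt ω k i : ℝ) * d + e| < 2} ≤ (4 / δ + 1) * (1 / 2) ^ k := by
  have hd0 : 0 < |d| := hδ.trans_le hd
  have hdne : d ≠ 0 := abs_pos.1 hd0
  set u : ℝ := -e / d - 2 / |d| with hu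
  set v : ℝ := -e / d + 2 / |d| with hv
  -- The integers strictly between u and v, that is, at distance less than 2/|d| from -e/d. An open
  -- interval of length 4/|d| contains at most 4/|d| + 1 of them.
  set B : Finset ℤ := Finset.Icc (⌊u⌋ + 1) (⌈v⌉ - 1) with hB
  have hcard : (B.card : ℝ) ≤ 4 / δ + 1 := by
    have h1 := Int.lt_floor_add_one u
    have h2 := Int.ceil_lt_add_one v
    have h3 : v - u = 4 / |d| := by rw [hu, hv]; ring
    have h4 : 4 / |d| ≤ 4 / δ := div_le_div_of_nonneg_left (by norm_num) hδ hd
    have h5 : 0 < 4 / δ := by positivity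
    rw [hB, Int.card_Icc]
    rcases le_total 0 (⌈v⌉ - 1 + 1 - (⌊u⌋ + 1)) with h | h
    · have : (((⌈v⌉ - 1 + 1 - (⌊u⌋ + 1)).toNat : ℕ) : ℝ) = ((⌈v⌉ - 1 + 1 - (⌊u⌋ + 1) : ℤ) : ℝ) := by
        exact_mod_cast Int.toNat_of_nonneg h
      rw [this]
      push_cast
      linarith
    · rw [Int.toNat_of_nonpos h]
      simp
      linarith
  have hsub : {ω | |(tossedInt ω k i : ℝ) * d + e| < 2} ⊆ ⋃ z ∈ B, {ω | tossedInt ω k i = z} := by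
    intro ω hω
    simp only [Set.mem_iUnion]
    refine ⟨tossedInt ω k i, ?_, rfl⟩
    have h1 : |(tossedInt ω k i : ℝ) - -e / d| < 2 / |d| := by
      rw [lt_div_iff₀ hd0, ← abs_mul]
      have : ((tossedInt ω k i : ℝ) - -e / d) * d = (tossedInt ω k i : ℝ) * d + e := by
        field_simp; ring
      rw [this]
      exact hω
    obtain ⟨h2, h3⟩ := abs_lt.1 h1
    rw [hB, Finset.mem_Icc]
    exact ⟨Int.floor_lt.2 (by rw [hu]; linarith),
      Int.le_sub_one_iff.2 (Int.lt_ceil.2 (by rw [hv]; linarith))⟩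
  calc _ ≤ ∑ z ∈ B, coinMeasure.real {ω | tossedInt ω k i = z} :=
        (measureReal_mono hsub (measure_ne_top _ _)).trans (measureReal_biUnion_finset_le _ _)
    _ ≤ ∑ z ∈ B, (1 / 2 : ℝ) ^ k := Finset.sum_le_sum fun z _ => measure_tossedInt_eq_le k i z
    _ = B.card * (1 / 2 : ℝ) ^ k := by rw [Finset.sum_const, nsmul_eq_mul]
    _ ≤ _ := mul_le_mul_of_nonneg_right hcard (by positivity)

/-! ### Random projections -/

/-- The weights of the projection in the `r`-th try. -/
def coinWeights (n k : ℕ) (ω : ℕ → Bool) (r j : ℕ) : ℤ := tossedInt ω k (r * (n * k) + j * k)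

theorem coinWeights_congr {n k r j : ℕ} {ω ω' : ℕ → Bool}
    (h : ∀ i, r * (n * k) ≤ i → i < (r + 1) * (n * k) → ω i = ω' i) (hj : j < n) :
    coinWeights n k ω r j = coinWeights n k ω' r j := by
  refine tossedInt_congr fun b hb => h _ (by omega) ?_
  have : (j + 1) * k ≤ n * k := Nat.mul_le_mul_right k hj
  rw [Nat.add_mul] at this ⊢
  omega

theorem proj_congr {n : ℕ} {X : ℕ → ℕ → ℝ} {w w' : ℕ → ℤ} (h : ∀ j < n, w j = w' j) :
    proj n X w = proj n X w' :=
  funext fun a => congrArg _ (Finset.sum_congr rfl fun j hj => by rw [h j (Finset.mem_range.1 hj)])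

/-- Some squared coordinate difference is at least the average. Differences of numbers in [0, 1] are
at least their squares in absolute value, so no square root is needed. -/
theorem exists_le_abs_sub {n N : ℕ} {X : ℕ → ℕ → ℝ} (hn : 0 < n)
    (hX : ∀ a < N, ∀ j < n, X a j ∈ Set.Icc (0 : ℝ) 1) {a b : ℕ} (ha : a < N) (hb : b < N) :
    ∃ j < n, sqDist n X a b / n ≤ |X a j - X b j| := by
  obtain ⟨j, hj, h⟩ := Finset.exists_le_of_sum_le (s := Finset.range n)
    (f := fun _ => sqDist n X a b / n) (g := fun j => (X a j - X b j) * (X a j - X b j))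
    ⟨0, Finset.mem_range.2 hn⟩ (by
      rw [Finset.sum_const, Finset.card_range, nsmul_eq_mul, mul_div_cancel₀ _ (by positivity)]
      exact le_of_eq rfl)
  have hj := Finset.mem_range.1 hj
  refine ⟨j, hj, h.trans ?_⟩
  have h1 := hX a ha j hj
  have h2 := hX b hb j hj
  have : |X a j - X b j| ≤ 1 := abs_le.2 ⟨by linarith [h1.1, h2.2], by linarith [h1.2, h2.1]⟩
  change (X a j - X b j) * (X a j - X b j) ≤ _
  rw [← abs_mul_abs_self]
  nlinarith [abs_nonneg (X a j - X b j)]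

/-- Freeze all weights except the one of a coordinate in which the points differ considerably. The
difference of the projections is then an affine function of one random integer, and
anticoncentration applies. -/
theorem measure_proj_close_le {n N k r : ℕ} {X : ℕ → ℕ → ℝ} (hn : 0 < n)
    (hX : ∀ a < N, ∀ j < n, X a j ∈ Set.Icc (0 : ℝ) 1) {a b : ℕ} (ha : a < N) (hb : b < N)
    (hg : 0 < sqDist n X a b) :
    coinMeasure.real {ω | |proj n X (coinWeights n k ω r) a - proj n X (coinWeights n k ω r) b| < 2}
      ≤ (4 / (sqDist n X a b / n) + 1) * (1 / 2) ^ k := by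
  obtain ⟨j, hj, hd⟩ := exists_le_abs_sub hn hX ha hb
  set S := Finset.Ico (r * (n * k) + j * k) (r * (n * k) + j * k + k) with hS
  set T := Finset.range ((r + 1) * (n * k)) \ S with hT
  set e : (ℕ → Bool) → ℝ := fun η =>
    ∑ i ∈ (Finset.range n).erase j, (coinWeights n k η r i : ℝ) * (X a i - X b i) with he
  have hR : ∀ η, DependsOnTosses (fun ω => |(tossedInt ω k (r * (n * k) + j * k) : ℝ) *
      (X a j - X b j) + e η| < 2) S := fun η ω ω' h => by
    beta_reduce
    rw [tossedInt_congr fun b hb => h _ (Finset.mem_Ico.2 ⟨by omega, by omega⟩)]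
  have hR' : ∀ ω, DependsOnTosses (fun η => |(tossedInt ω k (r * (n * k) + j * k) : ℝ) *
      (X a j - X b j) + e η| < 2) T := fun ω η η' h => by
    have : e η = e η' := Finset.sum_congr rfl fun i hi => by
      obtain ⟨hij, hi⟩ := Finset.mem_erase.1 hi
      have hi := Finset.mem_range.1 hi
      rw [coinWeights, coinWeights, tossedInt_congr fun b hb => h _ ?_]
      have h1 : (i + 1) * k ≤ n * k := Nat.mul_le_mul_right k hi
      rw [hT, Finset.mem_sdiff, Finset.mem_range, hS, Finset.mem_Ico]
      rw [Nat.add_mul] at h1 ⊢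
      refine ⟨by omega, fun h2 => ?_⟩
      rcases Nat.lt_or_gt_of_ne hij with h3 | h3
      · have h4 : (i + 1) * k ≤ j * k := Nat.mul_le_mul_right k h3
        rw [Nat.add_mul] at h4
        omega
      · have h4 : (j + 1) * k ≤ i * k := Nat.mul_le_mul_right k h3
        rw [Nat.add_mul] at h4
        omega
    beta_reduce
    rw [this]
  have key := DependsOnTosses.measure_le_mul (Q := fun _ => True) (T := T)
    (p := (4 / (sqDist n X a b / n) + 1) * (1 / 2) ^ k) (fun _ _ _ => Iff.rfl) hR hR'
    Finset.disjoint_sdiff fun η _ => measure_abs_tossedInt_mul_add_lt k _ (by positivity) hd (e η)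
  have h1 : coinMeasure.real {ω : ℕ → Bool | True} = 1 := by
    rw [show {ω : ℕ → Bool | True} = Set.univ from Set.eq_univ_of_forall fun _ => trivial]
    exact probReal_univ
  rw [h1, mul_one] at key
  refine (measureReal_mono fun ω hω => ?_).trans key
  refine ⟨trivial, ?_⟩
  have h2 : (tossedInt ω k (r * (n * k) + j * k) : ℝ) * (X a j - X b j) + e ω =
      (∑ i ∈ Finset.range n, (coinWeights n k ω r i : ℝ) * X a i) -
        ∑ i ∈ Finset.range n, (coinWeights n k ω r i : ℝ) * X b i := by
    rw [← Finset.sum_sub_distrib, ← Finset.add_sum_erase _ _ (Finset.mem_range.2 hj), he]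
    refine congrArg₂ _ ?_ (Finset.sum_congr rfl fun i _ => mul_sub _ _ _)
    rw [coinWeights, mul_sub]
  rw [h2]
  have hω : |proj n X (coinWeights n k ω r) a - proj n X (coinWeights n k ω r) b| < 2 := hω
  rw [proj, proj] at hω
  -- Integer parts at distance less than 2 differ by at most 1, and then the numbers themselves
  -- differ by less than 2.
  generalize (∑ i ∈ Finset.range n, (coinWeights n k ω r i : ℝ) * X a i) = u at hω ⊢
  generalize (∑ i ∈ Finset.range n, (coinWeights n k ω r i : ℝ) * X b i) = v at hω ⊢
  obtain ⟨h3, h4⟩ := abs_lt.1 hω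
  have h5 : -1 ≤ ⌊u⌋ - ⌊v⌋ := by omega
  have h6 : ⌊u⌋ - ⌊v⌋ ≤ 1 := by omega
  have h7 : ((-1 : ℤ) : ℝ) ≤ ((⌊u⌋ - ⌊v⌋ : ℤ) : ℝ) := by exact_mod_cast h5
  have h8 : ((⌊u⌋ - ⌊v⌋ : ℤ) : ℝ) ≤ ((1 : ℤ) : ℝ) := by exact_mod_cast h6
  push_cast at h7 h8
  rw [abs_lt]
  constructor <;> linarith [Int.floor_le u, Int.floor_le v, Int.lt_floor_add_one u,
    Int.lt_floor_add_one v]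

theorem resolution_ge {n N : ℕ} {X : ℕ → ℕ → ℝ} {Y : ℕ → ℤ}
    (hY : ∀ a < N, Y a = -1 ∨ Y a = 1) {a b : ℕ} (ha : a < N) (hb : b < N) (hab : Y a ≠ Y b) :
    2 * (⌊(8 * n * N * N : ℝ) / sqDist n X a b⌋ + 1) ≤ resolution n N X Y := by
  have hnn : ∀ a < N, ∀ b < N,
      0 ≤ (1 - Y a * Y b) * (⌊(8 * n * N * N : ℝ) / sqDist n X a b⌋ + 1) := fun a ha b hb =>
    mul_nonneg (one_sub_mul_nonneg (hY a ha) (hY b hb)) (by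
      have : 0 ≤ ⌊(8 * n * N * N : ℝ) / sqDist n X a b⌋ :=
        Int.floor_nonneg.2 (div_nonneg (by positivity) (sqDist_nonneg _ _ _ _))
      omega)
  rw [← one_sub_mul_of_ne (hY a ha) (hY b hb) hab]
  refine le_trans ?_ (Finset.single_le_sum (f := fun a => ∑ b ∈ Finset.range N,
    (1 - Y a * Y b) * (⌊(8 * n * N * N : ℝ) / sqDist n X a b⌋ + 1)) (fun a ha =>
      Finset.sum_nonneg fun b hb => hnn a (Finset.mem_range.1 ha) b (Finset.mem_range.1 hb))
    (Finset.mem_range.2 ha))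
  exact Finset.single_le_sum (f := fun b =>
    (1 - Y a * Y b) * (⌊(8 * n * N * N : ℝ) / sqDist n X a b⌋ + 1))
    (fun b hb => hnn a ha b (Finset.mem_range.1 hb)) (Finset.mem_range.2 hb)

/-- Here the constant in `resolution` pays off: the pair (a, b) alone forces 2^k ≥ 16nN²/g, while g
≤ n gives 4n/g + 1 ≤ 8n/g. -/
theorem measure_proj_close_le_inv {n N r : ℕ} {X : ℕ → ℕ → ℝ} {Y : ℕ → ℤ} (hn : 0 < n)
    (hX : ∀ a < N, ∀ j < n, X a j ∈ Set.Icc (0 : ℝ) 1) (hY : ∀ a < N, Y a = -1 ∨ Y a = 1)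
    {a b : ℕ} (ha : a < N) (hb : b < N) (hab : Y a ≠ Y b) (hg : 0 < sqDist n X a b) :
    coinMeasure.real {ω | |proj n X (coinWeights n (precision n N X Y) ω r) a -
      proj n X (coinWeights n (precision n N X Y) ω r) b| < 2} ≤ 1 / (2 * N * N) := by
  refine (measure_proj_close_le hn hX ha hb hg).trans ?_
  set g := sqDist n X a b with hgdef
  have hN : (0 : ℝ) < N := by exact_mod_cast Nat.zero_lt_of_lt ha
  have hn' : (0 : ℝ) < n := by exact_mod_cast hn
  have h1 := resolution_ge hY ha hb hab (n := n) (X := X)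
  have h2 := Int.lt_floor_add_one ((8 * n * N * N : ℝ) / g)
  have h3 : resolution n N X Y < 2 ^ precision n N X Y := by
    have := Nat.lt_size_self (resolution n N X Y).toNat
    rw [precision]
    have h4 := Int.self_le_toNat (resolution n N X Y)
    have : ((resolution n N X Y).toNat : ℤ) < ((2 ^ Nat.size (resolution n N X Y).toNat : ℕ) : ℤ) := by
      exact_mod_cast this
    push_cast at this
    omega
  have h4 : (2 * (⌊(8 * n * N * N : ℝ) / g⌋ + 1) : ℝ) < 2 ^ precision n N X Y := by
    exact_mod_cast lt_of_le_of_lt h1 h3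
  have h5 : (16 * n * N * N : ℝ) / g ≤ 2 ^ precision n N X Y := by
    have : (16 * n * N * N : ℝ) / g = 2 * (8 * n * N * N / g) := by ring
    rw [this]
    linarith
  have h6 : g ≤ n := sqDist_le hX ha hb
  rw [one_div, inv_pow, ← div_eq_mul_inv, div_le_div_iff₀ (by positivity) (by positivity), one_mul]
  refine le_trans ?_ h5
  rw [le_div_iff₀ hg]
  have h7 : (4 / (g / n) + 1) * g = 4 * n + g := by field_simp
  calc (4 / (g / n) + 1) * (2 * N * N) * g = (4 / (g / n) + 1) * g * (2 * (N * N)) := by ring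
    _ = (4 * n + g) * (2 * (N * N)) := by rw [h7]
    _ ≤ (8 * n) * (2 * (N * N)) := mul_le_mul_of_nonneg_right (by linarith) (by positivity)
    _ = _ := by ring

/-! ### Success probability of the tries -/

/-- The points with different labels are different. -/
def Separated (n N : ℕ) (X : ℕ → ℕ → ℝ) (Y : ℕ → ℤ) : Prop :=
  (∀ a < N, ∀ j < n, X a j ∈ Set.Icc (0 : ℝ) 1) ∧ (∀ a < N, Y a = -1 ∨ Y a = 1) ∧
    ∀ a < N, ∀ b < N, Y a ≠ Y b → 0 < sqDist n X a b

/-- The `r`-th try fails. -/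
def BadTry (n N : ℕ) (X : ℕ → ℕ → ℝ) (Y : ℕ → ℤ) (r : ℕ) (ω : ℕ → Bool) : Prop :=
  defect N Y (proj n X (coinWeights n (precision n N X Y) ω r)) ≠ 0

theorem dependsOnTosses_badTry (n N : ℕ) (X : ℕ → ℕ → ℝ) (Y : ℕ → ℤ) (r : ℕ) :
    DependsOnTosses (BadTry n N X Y r) (Finset.Ico (r * (n * precision n N X Y))
      ((r + 1) * (n * precision n N X Y))) := fun ω ω' h => by
  rw [BadTry, BadTry, proj_congr fun j hj => coinWeights_congr
    (fun i h1 h2 => h i (Finset.mem_Ico.2 ⟨h1, h2⟩)) hj]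

/-- Union bound over the N² ordered pairs of points. -/
theorem measure_badTry_le {n N : ℕ} {X : ℕ → ℕ → ℝ} {Y : ℕ → ℤ} (hn : 0 < n)
    (h : Separated n N X Y) (r : ℕ) : coinMeasure.real {ω | BadTry n N X Y r ω} ≤ 1 / 2 := by
  obtain ⟨hX, hY, hsep⟩ := h
  set E : ℕ × ℕ → Set (ℕ → Bool) := fun p => {ω | Y p.1 ≠ Y p.2 ∧
    |proj n X (coinWeights n (precision n N X Y) ω r) p.1 -
      proj n X (coinWeights n (precision n N X Y) ω r) p.2| < 2} with hE
  have hsub : {ω | BadTry n N X Y r ω} ⊆ ⋃ p ∈ Finset.range N ×ˢ Finset.range N, E p := by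
    intro ω hω
    have hω : BadTry n N X Y r ω := hω
    rw [BadTry, Ne, defect_eq_zero_iff hY] at hω
    push Not at hω
    obtain ⟨a, ha, b, hb, hab, hlt⟩ := hω
    simp only [Set.mem_iUnion]
    exact ⟨(a, b), Finset.mem_product.2 ⟨Finset.mem_range.2 ha, Finset.mem_range.2 hb⟩, hab, hlt⟩
  calc _ ≤ ∑ p ∈ Finset.range N ×ˢ Finset.range N, coinMeasure.real (E p) :=
        (measureReal_mono hsub (measure_ne_top _ _)).trans (measureReal_biUnion_finset_le _ _)
    _ ≤ ∑ p ∈ Finset.range N ×ˢ Finset.range N, (1 / (2 * N * N) : ℝ) := by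
        refine Finset.sum_le_sum fun p hp => ?_
        obtain ⟨ha, hb⟩ := Finset.mem_product.1 hp
        have ha := Finset.mem_range.1 ha
        have hb := Finset.mem_range.1 hb
        by_cases hab : Y p.1 = Y p.2
        · simp [hE, hab]
          positivity
        · exact (measureReal_mono fun ω hω => hω.2).trans
            (measure_proj_close_le_inv hn hX hY ha hb hab (hsep _ ha _ hb hab))
    _ ≤ 1 / 2 := by
        rw [Finset.sum_const, Finset.card_product, Finset.card_range, nsmul_eq_mul]
        rcases Nat.eq_zero_or_pos N with rfl | hN
        · norm_num
        · have : (0 : ℝ) < N := by exact_mod_cast hN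
          push_cast
          apply le_of_eq
          field_simp

/-- Different tries use disjoint blocks of tosses and are independent. -/
theorem measure_forall_badTry_le {n N : ℕ} {X : ℕ → ℕ → ℝ} {Y : ℕ → ℤ} (hn : 0 < n)
    (h : Separated n N X Y) (R : ℕ) :
    coinMeasure.real {ω | ∀ r < R, BadTry n N X Y r ω} ≤ (1 / 2) ^ R := by
  induction R with
  | zero => exact measureReal_le_one.trans (by simp)
  | succ R ih =>
    set M := n * precision n N X Y with hM
    have h1 : DependsOnTosses (fun ω => ∀ r < R, BadTry n N X Y r ω) (Finset.range (R * M)) :=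
      fun ω ω' hω => forall₂_congr fun r hr => dependsOnTosses_badTry n N X Y r ω ω' fun i hi => by
        refine hω i (Finset.mem_range.2 ((Finset.mem_Ico.1 hi).2.trans_le ?_))
        exact Nat.mul_le_mul_right _ hr
    have h2 := h1.measure_inter (dependsOnTosses_badTry n N X Y R)
      (Finset.disjoint_left.2 fun i hi hi' => by
        have h3 := Finset.mem_range.1 hi
        have h4 := (Finset.mem_Ico.1 hi').1
        rw [← hM] at h4
        omega)
    have h3 : {ω | ∀ r < R + 1, BadTry n N X Y r ω} =
        {ω | (∀ r < R, BadTry n N X Y r ω) ∧ BadTry n N X Y R ω} := by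
      ext ω
      exact Nat.forall_lt_succ_right
    rw [h3, h2, pow_succ]
    exact mul_le_mul ih (measure_badTry_le hn h R) measureReal_nonneg (by positivity)

/-- The probabilistic method: without good weights the try 0 would fail with probability 1. -/
theorem exists_good_weights {n N : ℕ} {X : ℕ → ℕ → ℝ} {Y : ℕ → ℤ} (hn : 0 < n)
    (h : Separated n N X Y) : ∃ w : ℕ → ℤ, (∀ j < n, 0 ≤ w j ∧ w j < 2 ^ precision n N X Y) ∧
      defect N Y (proj n X w) = 0 := by
  by_contra hne
  have h1 : {ω | BadTry n N X Y 0 ω} = Set.univ := Set.eq_univ_of_forall fun ω => by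
    by_contra hω
    exact hne ⟨_, fun j _ => ⟨tossedInt_nonneg _ _ _, tossedInt_lt _ _ _⟩, not_not.1 hω⟩
  have h2 := measure_badTry_le hn h 0
  rw [h1, probReal_univ] at h2
  norm_num at h2

/-! ### The randomized algorithm -/

open Classical in
/-- The weights of the projection: those of the first successful try, if there is one. -/
noncomputable def weights (ω : ℕ → Bool) (n N : ℕ) (X : ℕ → ℕ → ℝ) (Y : ℕ → ℤ) : ℕ → ℤ :=
  if h : ∃ r, ¬ BadTry n N X Y r ω then coinWeights n (precision n N X Y) ω (Nat.find h)
  else if h' : ∃ w : ℕ → ℤ, (∀ j < n, 0 ≤ w j ∧ w j < 2 ^ precision n N X Y) ∧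
      defect N Y (proj n X w) = 0 then h'.choose
  else 0

/-- Memorization is claimed for every outcome of the tosses, including the null set on which no try
succeeds; the second branch of `weights` serves this purpose. -/
theorem weights_spec {n N : ℕ} {X : ℕ → ℕ → ℝ} {Y : ℕ → ℤ} (hn : 0 < n)
    (h : Separated n N X Y) (ω : ℕ → Bool) :
    (∀ j < n, 0 ≤ weights ω n N X Y j ∧ weights ω n N X Y j < 2 ^ precision n N X Y) ∧
      defect N Y (proj n X (weights ω n N X Y)) = 0 := by
  classical
  rw [weights]
  split_ifs with h1 h2
  · exact ⟨fun j _ => ⟨tossedInt_nonneg _ _ _, tossedInt_lt _ _ _⟩, not_not.1 (Nat.find_spec h1)⟩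
  · exact h2.choose_spec
  · exact absurd (exists_good_weights hn h) h2

theorem weights_eq {n N : ℕ} {X : ℕ → ℕ → ℝ} {Y : ℕ → ℤ} {ω : ℕ → Bool} {r : ℕ}
    (h : ∀ r' < r, BadTry n N X Y r' ω) (hr : ¬ BadTry n N X Y r ω) :
    weights ω n N X Y = coinWeights n (precision n N X Y) ω r := by
  classical
  have h1 : ∃ r, ¬ BadTry n N X Y r ω := ⟨r, hr⟩
  rw [weights, dif_pos h1, (Nat.find_eq_iff h1).2 ⟨hr, fun m hm => not_not.2 (h m hm)⟩]

/-- The coordinates of the points of a dataset. -/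
noncomputable def coords {n N : ℕ} (s : Fin N → LabelledPoint n) (a j : ℕ) : ℝ :=
  if h : a < N ∧ j < n then (s ⟨a, h.1⟩).1 ⟨j, h.2⟩ else 0

/-- The labels of a dataset. -/
noncomputable def labels {n N : ℕ} (s : Fin N → LabelledPoint n) (a : ℕ) : ℤ :=
  if h : a < N then ⌊(s ⟨a, h⟩).2⌋ else 0

/-- The network that memorizes a dataset, with rational weights. -/
noncomputable def ratLearner (ω : ℕ → Bool) (n N : ℕ) (s : Fin N → LabelledPoint n) : Network ℚ n :=
  memorizer n N (precision n N (coords s) (labels s)) (weights ω n N (coords s) (labels s))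
    (proj n (coords s) (weights ω n N (coords s) (labels s))) (labels s)

/-- The randomized memorization algorithm. -/
noncomputable def learner (ω : ℕ → Bool) : LearningMap := fun n N s => (ratLearner ω n N s).toReal

theorem coords_fin {n N : ℕ} (s : Fin N → LabelledPoint n) (a : Fin N) (j : Fin n) :
    coords s a j = (s a).1 j := by
  simp [coords]

theorem floor_neg_one : ⌊(-1 : ℝ)⌋ = -1 := by
  exact_mod_cast Int.floor_intCast (R := ℝ) (-1)

theorem labels_fin {n N : ℕ} {s : Fin N → LabelledPoint n} {a : Fin N} (h : s a ∈ dataSpace n) :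
    (labels s a : ℝ) = (s a).2 := by
  rcases h.2 with h | h <;> simp [labels, h, floor_neg_one]

theorem labels_eq {n N : ℕ} {s : Fin N → LabelledPoint n} {a : Fin N} (h : s a ∈ dataSpace n) :
    labels s a = -1 ∨ labels s a = 1 := by
  rcases h.2 with h | h <;> simp [labels, h, floor_neg_one]

theorem sqDist_coords {n N : ℕ} (s : Fin N → LabelledPoint n) (a b : Fin N) :
    sqDist n (coords s) a b = dist (s a).1 (s b).1 ^ 2 := by
  rw [EuclideanSpace.dist_eq, Real.sq_sqrt (Finset.sum_nonneg fun _ _ => sq_nonneg _), sqDist,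
    Finset.sum_range]
  refine Finset.sum_congr rfl fun j _ => ?_
  rw [coords_fin, coords_fin, Real.dist_eq, sq_abs, sq]

theorem coords_mem {n N : ℕ} {s : Fin N → LabelledPoint n} (h : ∀ i, s i ∈ dataSpace n) :
    ∀ a < N, ∀ j < n, coords s a j ∈ Set.Icc (0 : ℝ) 1 := fun a ha j hj => by
  have := (h ⟨a, ha⟩).1 ⟨j, hj⟩
  rwa [← coords_fin] at this

theorem IsDataset.separated {n N : ℕ} {s : Fin N → LabelledPoint n} (h : IsDataset s) :
    Separated n N (coords s) (labels s) := by
  refine ⟨coords_mem h.1, fun a ha => labels_eq (a := ⟨a, ha⟩) (h.1 _), fun a ha b hb hab => ?_⟩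
  have h1 := sqDist_coords s ⟨a, ha⟩ ⟨b, hb⟩
  simp only at h1
  rw [h1]
  have : (s ⟨a, ha⟩).1 ≠ (s ⟨b, hb⟩).1 := fun he => hab (by
    have h2 := h.2 _ _ he
    simp [labels, ha, hb, h2])
  have := dist_pos.2 this
  positivity

theorem isMemorizationAlgorithm_learner (ω : ℕ → Bool) : IsMemorizationAlgorithm (learner ω) := by
  intro n N hn s hs i
  have hsep := hs.separated
  obtain ⟨h1, h2⟩ := weights_spec hn hsep ω
  have := sign_eval_memorizer hsep.1 hsep.2.1 h1 h2 i.2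
  simp only [coords_fin] at this
  rw [learner, ratLearner, this, labels_fin (hs.1 i)]

theorem learner_size {n N : ℕ} {c : ℝ} (hn : 0 < n) (hN : 0 < N) (hc : 0 < c)
    {s : Fin N → LabelledPoint n} (hs : ∀ i, s i ∈ dataSpace n)
    (hsep : ∀ i j, (s i).2 = 1 → (s j).2 = -1 → c ≤ dist (s i).1 (s j).1) (ω : ℕ → Bool) :
    (learner ω n N s).width = 6 ∧
      ((learner ω n N s).depth : ℝ) ≤
        40000 * (Real.sqrt N * Real.log (max 2 ((N : ℝ) * n / c))) ∧
      ((learner ω n N s).numParams : ℝ) ≤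
        7 * n + 40000 * (Real.sqrt N * Real.log (max 2 ((N : ℝ) * n / c))) := by
  have h1 : ∀ a < N, ∀ b < N, labels s a ≠ labels s b → c ^ 2 ≤ sqDist n (coords s) a b := by
    intro a ha b hb hab
    have h1 := sqDist_coords s ⟨a, ha⟩ ⟨b, hb⟩
    simp only at h1
    rw [h1]
    refine pow_le_pow_left₀ hc.le ?_ 2
    rcases (hs ⟨a, ha⟩).2 with h2 | h2 <;> rcases (hs ⟨b, hb⟩).2 with h3 | h3
    · exact absurd (by simp [labels, ha, hb, h2, h3]) hab
    · rw [dist_comm]; exact hsep _ _ h3 h2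
    · exact hsep _ _ h2 h3
    · exact absurd (by simp [labels, ha, hb, h2, h3]) hab
  have h2 := codeLength_le hn hc (coords_mem hs) (fun a ha => labels_eq (a := ⟨a, ha⟩) (hs _)) h1
  set K := codeLength n (precision n N (coords s) (labels s)) with hK
  have h3 := length_memorizer_le N K hN (codeLength_pos _ _)
    (threshold N (proj n (coords s) (weights ω n N (coords s) (labels s))) (labels s) (2 ^ K - 1))
  have h4 := mul_le_mul_of_nonneg_left h2 (Real.sqrt_nonneg N)
  rw [learner, ratLearner, memorizer, ← hK,
    width_memoNet, depth_memoNet, numParams_memoNet]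
  generalize (memoLayers K (Nat.sqrt N + 1) (threshold N (proj n (coords s)
    (weights ω n N (coords s) (labels s))) (labels s) (2 ^ K - 1))).length = l at h3 ⊢
  have h5 : (0 : ℝ) ≤ l := Nat.cast_nonneg l
  -- 42 parameters per layer, 40 from the number of layers and 22 from the code length: 42 · 40 · 22
  -- = 36960 ≤ 40000.
  push_cast
  refine ⟨trivial, ?_, ?_⟩ <;> linarith

/-- Two different members of the sample have joint law D × D, so each of the finitely many pairs is
separated almost surely. For i = j nothing is to be shown, as a label is not both 1 and -1. -/
theorem IsSeparatedDistribution.ae_separated_sample {n N : ℕ} {c : ℝ}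
    {D : Measure (LabelledPoint n)} (h : IsSeparatedDistribution n c D) :
    ∀ᵐ s ∂(Measure.pi fun _ : Fin N => D), (∀ i, s i ∈ dataSpace n) ∧
      ∀ i j, (s i).2 = 1 → (s j).2 = -1 → c ≤ dist (s i).1 (s j).1 := by
  have := h.isProbabilityMeasure
  have h1 : ∀ i : Fin N, ∀ᵐ s ∂(Measure.pi fun _ : Fin N => D), s i ∈ dataSpace n := fun i =>
    (measurePreserving_eval (fun _ : Fin N => D) i).quasiMeasurePreserving.ae h.ae_mem_dataSpace
  have h2 : ∀ i j : Fin N, ∀ᵐ s ∂(Measure.pi fun _ : Fin N => D),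
      (s i).2 = 1 → (s j).2 = -1 → c ≤ dist (s i).1 (s j).1 := fun i j => by
    by_cases hij : i = j
    · refine Filter.Eventually.of_forall fun s hi hj => ?_
      rw [hij, hj] at hi
      norm_num at hi
    · have hind := ProbabilityTheory.iIndepFun_pi (μ := fun _ : Fin N => D)
        (X := fun _ p => p) fun _ => aemeasurable_id
      have h3 := (ProbabilityTheory.indepFun_iff_map_prod_eq_prod_map_map
        (measurable_pi_apply i).aemeasurable (measurable_pi_apply j).aemeasurable).1
        (hind.indepFun hij)
      rw [(measurePreserving_eval (fun _ : Fin N => D) i).map_eq,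
        (measurePreserving_eval (fun _ : Fin N => D) j).map_eq] at h3
      have h4 := h.ae_separated
      rw [← h3] at h4
      exact ae_of_ae_map ((measurable_pi_apply i).prodMk (measurable_pi_apply j)).aemeasurable h4
  filter_upwards [ae_all_iff.2 h1, ae_all_iff.2 fun i => ae_all_iff.2 (h2 i)] with s hs hs'
  exact ⟨hs, hs'⟩

/-! ### Functions given by integer terms -/

/-- An input of the machine: a dataset, a parameter `k`, and an array `C` of coin tosses. -/
structure MachineInput where
  n : ℕ
  N : ℕ
  T : RatData n N
  k : ℕ
  C : ℤ → ℤ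
  C_nonneg : ∀ i, 0 ≤ C i
  isDataset : IsDataset T.toReal

/-- The contents of the input array. -/
def MachineInput.I (A : MachineInput) : ℤ → ℤ := inputArray (A.T.input A.k)

/-- A scope for terms that denote functions on `γ`: each `c : γ` comes with an input of the machine
and with the values of `depth` variables; only those `c` with `ok c` matter. -/
structure Scope (γ : Type) where
  inst : γ → MachineInput
  ok : γ → Prop
  depth : ℕ
  vars : γ → ℕ → ℤ

namespace Scope

open Function (update)

variable {γ : Type} {S : Scope γ}

/-- A scope with one more variable. -/
def push (S : Scope γ) {β : Type} (val : β → ℤ) (ok : γ → β → Prop) : Scope (γ × β) where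
  inst p := S.inst p.1
  ok p := S.ok p.1 ∧ ok p.1 p.2
  depth := S.depth + 1
  vars p i := if i < S.depth then S.vars p.1 i else val p.2

/-- A scope with an index `j < k` as a new variable. -/
def index (S : Scope γ) (k : γ → ℕ) : Scope (γ × ℕ) := S.push (fun j => (j : ℤ)) fun c j => j < k c

/-- The environments that fit to an element of `γ`. -/
def Fits (S : Scope γ) (c : γ) (env : ℕ → ℤ) : Prop := ∀ i < S.depth, env i = S.vars c i

/-- `f` is given by a term. -/
def IsTerm (S : Scope γ) (f : γ → ℤ) : Prop :=
  ∃ t : IntTerm, t.WF ∧ ∀ c env, S.ok c → S.Fits c env →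
    t.eval (S.inst c).I (S.inst c).C env = f c

/-- `f` is given by a term and takes values in the natural numbers. -/
def IsNat (S : Scope γ) (f : γ → ℕ) : Prop := S.IsTerm fun c => (f c : ℤ)

/-- `f` is given by a term that can be used as number of rounds of a loop. -/
def IsCount (S : Scope γ) (f : γ → ℕ) : Prop :=
  ∃ t : IntTerm, t.IsCount ∧ t.WF ∧ ∀ c env, S.ok c → S.Fits c env →
    t.eval (S.inst c).I (S.inst c).C env = f c

/-- `l` is given by a list of terms. -/
def IsList (S : Scope γ) (l : γ → List ℤ) : Prop :=
  ∃ t : ListTerm, t.WF ∧ ∀ c env, S.ok c → S.Fits c env →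
    t.eval (S.inst c).I (S.inst c).C env = l c

/-- The condition `P` is given by the sign of a term. -/
def IsCond (S : Scope γ) (P : γ → Prop) : Prop :=
  ∃ g : γ → ℤ, S.IsTerm g ∧ ∀ c, S.ok c → (0 < g c ↔ P c)

theorem IsTerm.congr {f g : γ → ℤ} (hf : S.IsTerm f) (h : ∀ c, S.ok c → f c = g c) :
    S.IsTerm g := by
  obtain ⟨t, ht, he⟩ := hf
  exact ⟨t, ht, fun c env hc hv => (he c env hc hv).trans (h c hc)⟩

theorem IsCount.isNat {f : γ → ℕ} (hf : S.IsCount f) : S.IsNat f := by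
  obtain ⟨t, _, ht, he⟩ := hf
  exact ⟨t, ht, he⟩

section Push

variable {β : Type} {val : β → ℤ} {ok : γ → β → Prop}

theorem Fits.fst {p : γ × β} {env : ℕ → ℤ} (h : (S.push val ok).Fits p env) :
    S.Fits p.1 env := fun i hi => (h i (Nat.lt_succ_of_lt hi)).trans (if_pos hi)

theorem Fits.snd {p : γ × β} {env : ℕ → ℤ} (h : (S.push val ok).Fits p env) :
    env S.depth = val p.2 := (h S.depth (Nat.lt_succ_self _)).trans (if_neg (lt_irrefl _))

theorem Fits.update {c : γ} {env : ℕ → ℤ} (h : S.Fits c env) (b : β) :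
    (S.push val ok).Fits (c, b) (update env S.depth (val b)) := fun i hi => by
  have hi : i < S.depth + 1 := hi
  change _ = if i < S.depth then _ else _
  split_ifs with h1
  · rw [Function.update_of_ne (by omega)]
    exact h i h1
  · rw [show i = S.depth by omega, Function.update_self]

theorem IsTerm.weaken {f : γ → ℤ} (hf : S.IsTerm f) :
    (S.push val ok).IsTerm fun p => f p.1 := by
  obtain ⟨t, ht, he⟩ := hf
  exact ⟨t, ht, fun p env hp hv => he p.1 env hp.1 hv.fst⟩

theorem IsCount.weaken {f : γ → ℕ} (hf : S.IsCount f) :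
    (S.push val ok).IsCount fun p => f p.1 := by
  obtain ⟨t, hc, ht, he⟩ := hf
  exact ⟨t, hc, ht, fun p env hp hv => he p.1 env hp.1 hv.fst⟩

theorem isTerm_last : (S.push val ok).IsTerm fun p => val p.2 :=
  ⟨.var S.depth, trivial, fun _ _ _ hv => hv.snd⟩

end Push

theorem isNat_last {k : γ → ℕ} : (S.index k).IsNat fun p => p.2 := isTerm_last

theorem IsTerm.index {f : γ → ℤ} {k : γ → ℕ} (hf : S.IsTerm f) :
    (S.index k).IsTerm fun p => f p.1 := hf.weaken

theorem IsNat.index {f k : γ → ℕ} (hf : S.IsNat f) : (S.index k).IsNat fun p => f p.1 :=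
  IsTerm.weaken hf

theorem IsCount.index {f k : γ → ℕ} (hf : S.IsCount f) : (S.index k).IsCount fun p => f p.1 :=
  hf.weaken

theorem isTerm_const (z : ℤ) : S.IsTerm fun _ => z := ⟨.lit z, trivial, fun _ _ _ _ => rfl⟩

theorem isNat_const (m : ℕ) : S.IsNat fun _ => m := isTerm_const _

theorem isCount_const (m : ℕ) : S.IsCount fun _ => m :=
  ⟨.lit m, trivial, trivial, fun _ _ _ _ => rfl⟩

theorem IsTerm.inp {f : γ → ℤ} (hf : S.IsTerm f) : S.IsTerm fun c => (S.inst c).I (f c) := by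
  obtain ⟨t, ht, he⟩ := hf
  exact ⟨.inp t, ht, fun c env hc hv => by rw [IntTerm.eval, he c env hc hv]⟩

theorem IsTerm.coin {f : γ → ℤ} (hf : S.IsTerm f) : S.IsTerm fun c => (S.inst c).C (f c) := by
  obtain ⟨t, ht, he⟩ := hf
  exact ⟨.coin t, ht, fun c env hc hv => by rw [IntTerm.eval, he c env hc hv]⟩

theorem IsTerm.bin {f g : γ → ℤ} (o : ArithOp) (hf : S.IsTerm f) (hg : S.IsTerm g) :
    S.IsTerm fun c => o.ap (f c) (g c) := by
  obtain ⟨t, ht, he⟩ := hf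
  obtain ⟨t', ht', he'⟩ := hg
  exact ⟨.bin o t t', ⟨ht, ht'⟩, fun c env hc hv => by
    rw [IntTerm.eval, he c env hc hv, he' c env hc hv]⟩

theorem IsTerm.add {f g : γ → ℤ} (hf : S.IsTerm f) (hg : S.IsTerm g) :
    S.IsTerm fun c => f c + g c := hf.bin .add hg

theorem IsTerm.sub {f g : γ → ℤ} (hf : S.IsTerm f) (hg : S.IsTerm g) :
    S.IsTerm fun c => f c - g c := hf.bin .sub hg

theorem IsTerm.mul {f g : γ → ℤ} (hf : S.IsTerm f) (hg : S.IsTerm g) :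
    S.IsTerm fun c => f c * g c := hf.bin .mul hg

theorem IsTerm.div {f g : γ → ℤ} (hf : S.IsTerm f) (hg : S.IsTerm g) :
    S.IsTerm fun c => f c / g c := hf.bin .div hg

theorem IsTerm.neg {f : γ → ℤ} (hf : S.IsTerm f) : S.IsTerm fun c => -f c :=
  ((isTerm_const 0).sub hf).congr fun _ _ => zero_sub _

theorem IsNat.add {f g : γ → ℕ} (hf : S.IsNat f) (hg : S.IsNat g) : S.IsNat fun c => f c + g c :=
  (IsTerm.add hf hg).congr fun _ _ => (Nat.cast_add _ _).symm

theorem IsNat.mul {f g : γ → ℕ} (hf : S.IsNat f) (hg : S.IsNat g) : S.IsNat fun c => f c * g c :=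
  (IsTerm.mul hf hg).congr fun _ _ => (Nat.cast_mul _ _).symm

theorem IsCount.add {f g : γ → ℕ} (hf : S.IsCount f) (hg : S.IsCount g) :
    S.IsCount fun c => f c + g c := by
  obtain ⟨t, hc, ht, he⟩ := hf
  obtain ⟨t', hc', ht', he'⟩ := hg
  exact ⟨.bin .add t t', ⟨hc, hc'⟩, ⟨ht, ht'⟩, fun c env hc hv => by
    rw [IntTerm.eval, he c env hc hv, he' c env hc hv]; exact (Nat.cast_add _ _).symm⟩

theorem IsCount.mul {f g : γ → ℕ} (hf : S.IsCount f) (hg : S.IsCount g) :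
    S.IsCount fun c => f c * g c := by
  obtain ⟨t, hc, ht, he⟩ := hf
  obtain ⟨t', hc', ht', he'⟩ := hg
  exact ⟨.bin .mul t t', ⟨hc, hc'⟩, ⟨ht, ht'⟩, fun c env hc hv => by
    rw [IntTerm.eval, he c env hc hv, he' c env hc hv]; exact (Nat.cast_mul _ _).symm⟩

theorem IsTerm.isCount_size {f : γ → ℤ} (hf : S.IsTerm f) :
    S.IsCount fun c => Nat.size (f c).toNat := by
  obtain ⟨t, ht, he⟩ := hf
  exact ⟨.size t, trivial, ht, fun c env hc hv => by rw [IntTerm.eval, he c env hc hv]⟩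

theorem IsCond.ite {f g : γ → ℤ} {P : γ → Prop} [∀ c, Decidable (P c)] (hP : S.IsCond P)
    (hf : S.IsTerm f) (hg : S.IsTerm g) : S.IsTerm fun c => if P c then f c else g c := by
  obtain ⟨q, ⟨t, ht, he⟩, hq⟩ := hP
  obtain ⟨t₁, ht₁, he₁⟩ := hf
  obtain ⟨t₂, ht₂, he₂⟩ := hg
  refine ⟨.ite t t₁ t₂, ⟨ht, ht₁, ht₂⟩, fun c env hc hv => ?_⟩
  rw [IntTerm.eval, he c env hc hv, he₁ c env hc hv, he₂ c env hc hv]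
  simp only [hq c hc]

theorem IsTerm.lt {f g : γ → ℤ} (hf : S.IsTerm f) (hg : S.IsTerm g) :
    S.IsCond fun c => f c < g c := ⟨_, hg.sub hf, fun _ _ => sub_pos⟩

theorem IsNat.lt {f g : γ → ℕ} (hf : S.IsNat f) (hg : S.IsNat g) :
    S.IsCond fun c => f c < g c := ⟨_, IsTerm.sub hg hf, fun _ _ => sub_pos.trans Nat.cast_lt⟩

theorem IsNat.le {f g : γ → ℕ} (hf : S.IsNat f) (hg : S.IsNat g) :
    S.IsCond fun c => f c ≤ g c :=
  ⟨_, (IsTerm.sub hg hf).add (isTerm_const 1), fun c _ => by omega⟩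

theorem IsCond.and {P Q : γ → Prop} (hP : S.IsCond P) (hQ : S.IsCond Q) :
    S.IsCond fun c => P c ∧ Q c := by
  classical
  refine ⟨_, hP.ite (hQ.ite (isTerm_const 1) (isTerm_const 0)) (isTerm_const 0), fun c _ => ?_⟩
  split_ifs <;> simp_all

theorem IsCond.not {P : γ → Prop} (hP : S.IsCond P) : S.IsCond fun c => ¬ P c := by
  classical
  refine ⟨_, hP.ite (isTerm_const 0) (isTerm_const 1), fun c _ => ?_⟩
  split_ifs <;> simp_all

theorem IsTerm.eq_zero {f : γ → ℤ} (hf : S.IsTerm f) : S.IsCond fun c => f c = 0 := by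
  obtain ⟨g, hg, h⟩ := (hf.lt (isTerm_const 0)).not.and ((isTerm_const 0).lt hf).not
  exact ⟨g, hg, fun c hc => (h c hc).trans (by omega)⟩

theorem IsNat.sub {f g : γ → ℕ} (hf : S.IsNat f) (hg : S.IsNat g) : S.IsNat fun c => f c - g c :=
  ((hg.le hf).ite (IsTerm.sub hf hg) (isTerm_const 0)).congr fun c _ => by
    beta_reduce
    split_ifs <;> omega

/-! ### Sums, products, iterations and bounded powers as terms -/

theorem _root_.FoldOp.acc_sum (f : ℕ → ℤ) (k : ℕ) (m i : ℤ) :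
    FoldOp.sum.acc (fun j _ => f j) m i k = i + ∑ j ∈ Finset.range k, f j := by
  induction k with
  | zero => simp [FoldOp.acc]
  | succ k ih => rw [FoldOp.acc, ih, Finset.sum_range_succ, FoldOp.ap, add_assoc]

theorem _root_.FoldOp.acc_prod (f : ℕ → ℤ) (k : ℕ) (m i : ℤ) :
    FoldOp.prod.acc (fun j _ => f j) m i k = i * ∏ j ∈ Finset.range k, f j := by
  induction k with
  | zero => simp [FoldOp.acc]
  | succ k ih => rw [FoldOp.acc, ih, Finset.prod_range_succ, FoldOp.ap, mul_assoc]

theorem _root_.FoldOp.acc_congr {o : FoldOp} {f g : ℕ → ℤ → ℤ} {m i : ℤ} {k : ℕ}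
    (h : ∀ j < k, ∀ v, f j v = g j v) : o.acc f m i k = o.acc g m i k := by
  induction k with
  | zero => rfl
  | succ k ih =>
    rw [FoldOp.acc, FoldOp.acc, ih fun j hj => h j (Nat.lt_succ_of_lt hj), h k (Nat.lt_succ_self k)]

theorem IsCount.sum {k : γ → ℕ} {f : γ → ℕ → ℤ} (hk : S.IsCount k)
    (hf : (S.index k).IsTerm fun p => f p.1 p.2) :
    S.IsTerm fun c => ∑ j ∈ Finset.range (k c), f c j := by
  obtain ⟨t, hc, ht, he⟩ := hk
  obtain ⟨t', ht', he'⟩ := hf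
  -- Index and accumulator share one variable: the index overwrites the accumulator, which the body
  -- of a sum does not need.
  refine ⟨.loop .sum S.depth S.depth t (.lit 0) (.lit 0) t', ⟨hc, ht, trivial, trivial, ht'⟩,
    fun c env hc hv => ?_⟩
  rw [IntTerm.eval, he c env hc hv, Int.toNat_natCast, FoldOp.acc_congr (g := fun j _ => f c j),
    FoldOp.acc_sum]
  · exact zero_add _
  · intro j hj v
    rw [Function.update_idem]
    exact he' (c, j) _ ⟨hc, hj⟩ (hv.update j)

theorem IsCount.prod {k : γ → ℕ} {f : γ → ℕ → ℤ} (hk : S.IsCount k)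
    (hf : (S.index k).IsTerm fun p => f p.1 p.2) :
    S.IsTerm fun c => ∏ j ∈ Finset.range (k c), f c j := by
  obtain ⟨t, hc, ht, he⟩ := hk
  obtain ⟨t', ht', he'⟩ := hf
  refine ⟨.loop .prod S.depth S.depth t (.lit 1) (.lit 0) t', ⟨hc, ht, trivial, trivial, ht'⟩,
    fun c env hc hv => ?_⟩
  rw [IntTerm.eval, he c env hc hv, Int.toNat_natCast, FoldOp.acc_congr (g := fun j _ => f c j),
    FoldOp.acc_prod]
  · exact one_mul _
  · intro j hj v
    rw [Function.update_idem]
    exact he' (c, j) _ ⟨hc, hj⟩ (hv.update j)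

/-- A scope with an accumulator and an index `j < k` as new variables. -/
def round (S : Scope γ) (k : γ → ℕ) : Scope ((γ × ℤ) × ℕ) :=
  (S.push (fun v : ℤ => v) fun _ _ => True).index fun p => k p.1

theorem IsTerm.round {f : γ → ℤ} {k : γ → ℕ} (hf : S.IsTerm f) :
    (S.round k).IsTerm fun p => f p.1.1 :=
  IsTerm.index (f := fun p : γ × ℤ => f p.1) hf.weaken

theorem isTerm_acc {k : γ → ℕ} : (S.round k).IsTerm fun p => p.1.2 :=
  IsTerm.index (f := fun p : γ × ℤ => p.2) isTerm_last

theorem isNat_round {k : γ → ℕ} : (S.round k).IsNat fun p => p.2 := isNat_last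

/-- Iteration. -/
theorem IsCount.iterate {k : γ → ℕ} {m : γ → ℤ} {F : γ → ℕ → ℤ} {g : γ → ℤ → ℕ → ℤ}
    (hk : S.IsCount k) (h0 : S.IsTerm fun c => F c 0) (hm : S.IsTerm m)
    (hg : (S.round k).IsTerm fun p => g p.1.1 p.1.2 p.2)
    (hF : ∀ c, S.ok c → ∀ j < k c, F c (j + 1) = g c (F c j) j ∧ 0 ≤ F c (j + 1) ∧
      F c (j + 1) ≤ m c * m c) : S.IsTerm fun c => F c (k c) := by
  obtain ⟨t, hc, ht, he⟩ := hk
  obtain ⟨t₀, ht₀, he₀⟩ := h0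
  obtain ⟨tm, htm, hem⟩ := hm
  obtain ⟨t', ht', he'⟩ := hg
  refine ⟨.loop .iter (S.depth + 1) S.depth t t₀ tm t', ⟨hc, ht, ht₀, htm, ht'⟩,
    fun c env hc hv => ?_⟩
  rw [IntTerm.eval, he c env hc hv, he₀ c env hc hv, hem c env hc hv, Int.toNat_natCast,
    FoldOp.acc_congr (g := fun j v => g c v j)]
  · have : ∀ j ≤ k c, FoldOp.iter.acc (fun j v => g c v j) (m c) (F c 0) j = F c j := by
      intro j
      induction j with
      | zero => exact fun _ => rfl
      | succ j ih =>
        intro hj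
        obtain ⟨h1, h2, h3⟩ := hF c hc j hj
        rw [FoldOp.acc, ih (by omega), FoldOp.ap, FoldOp.seen, ← h1]
        -- All values lie in [0, m²], so the reduction modulo m² + 1 does not change them.
        exact Int.emod_eq_of_lt h2 (by omega)
    exact this _ le_rfl
  · intro j hj v
    exact he' ((c, v), j) _ ⟨⟨hc, trivial⟩, hj⟩
      (Fits.update (S := S.push (fun v : ℤ => v) fun _ _ => True) (hv.update v) j)

/-- Powers of two with bounded exponents. -/
theorem IsNat.two_pow {e M : γ → ℕ} (he : S.IsNat e) (hM : S.IsCount M)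
    (h : ∀ c, S.ok c → e c ≤ M c) : S.IsTerm fun c => 2 ^ e c := by
  -- The exponent need not be a number of rounds; the loop runs over the bound M instead, and the
  -- superfluous factors are 1.
  refine (hM.prod (f := fun c j => if j < e c then 2 else 1)
    ((isNat_last.lt he.index).ite (isTerm_const 2) (isTerm_const 1))).congr fun c hc => ?_
  rw [Finset.prod_ite, Finset.prod_const_one, mul_one, Finset.prod_const]
  congr 1
  have : (Finset.range (M c)).filter (· < e c) = Finset.range (e c) := by
    ext j
    have := h c hc
    simp only [Finset.mem_filter, Finset.mem_range]
    omega
  rw [this, Finset.card_range]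

/-- A bounded natural number can be used as number of rounds of a loop. -/
theorem IsNat.isCount {e M : γ → ℕ} (he : S.IsNat e) (hM : S.IsCount M)
    (h : ∀ c, S.ok c → e c ≤ M c) : S.IsCount e := by
  -- Binary lengths are admissible as numbers of rounds, and 2^e - 1 has exactly e digits.
  obtain ⟨t, hc, ht, hs⟩ := ((he.two_pow hM h).sub (isTerm_const 1)).isCount_size
  refine ⟨t, hc, ht, fun c env hc hv => (hs c env hc hv).trans ?_⟩
  have h1 : ((2 : ℤ) ^ e c - 1).toNat = 2 ^ e c - 1 := by
    have : ((2 ^ e c - 1 : ℕ) : ℤ) = 2 ^ e c - 1 := by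
      rw [Nat.cast_sub Nat.one_le_two_pow]; push_cast; rfl
    rw [← this, Int.toNat_natCast]
  beta_reduce
  rw [h1]
  have h2 : (2 ^ e c - 1).size = e c := by
    refine le_antisymm (Nat.size_le.2 (Nat.sub_lt (Nat.two_pow_pos _) one_pos)) ?_
    rcases Nat.eq_zero_or_pos (e c) with h | h
    · omega
    · obtain ⟨d, hd⟩ := Nat.exists_eq_succ_of_ne_zero h.ne'
      rw [hd]
      refine Nat.lt_size.2 ?_
      rw [Nat.succ_eq_add_one, pow_succ]
      have := Nat.two_pow_pos d
      omega
  rw [h2]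

theorem isList_nil : S.IsList fun _ => [] := ⟨.nil, trivial, fun _ _ _ _ => rfl⟩

theorem IsList.congr {f g : γ → List ℤ} (hf : S.IsList f) (h : ∀ c, S.ok c → f c = g c) :
    S.IsList g := by
  obtain ⟨t, ht, he⟩ := hf
  exact ⟨t, ht, fun c env hc hv => (he c env hc hv).trans (h c hc)⟩

theorem IsList.append {f g : γ → List ℤ} (hf : S.IsList f) (hg : S.IsList g) :
    S.IsList fun c => f c ++ g c := by
  obtain ⟨t, ht, he⟩ := hf
  obtain ⟨t', ht', he'⟩ := hg
  exact ⟨.append t t', ⟨ht, ht'⟩, fun c env hc hv => by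
    rw [ListTerm.eval, he c env hc hv, he' c env hc hv]⟩

theorem IsTerm.cons {f : γ → ℤ} {g : γ → List ℤ} (hf : S.IsTerm f) (hg : S.IsList g) :
    S.IsList fun c => f c :: g c := by
  obtain ⟨t, ht, he⟩ := hf
  obtain ⟨t', ht', he'⟩ := hg
  exact ⟨.append (.emit t) t', ⟨ht, ht'⟩, fun c env hc hv => by
    rw [ListTerm.eval, ListTerm.eval, he c env hc hv, he' c env hc hv]; rfl⟩

theorem IsCount.flatMap {k : γ → ℕ} {f : γ → ℕ → List ℤ} (hk : S.IsCount k)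
    (hf : (S.index k).IsList fun p => f p.1 p.2) :
    S.IsList fun c => (List.range (k c)).flatMap (f c) := by
  obtain ⟨t, hc, ht, he⟩ := hk
  obtain ⟨t', ht', he'⟩ := hf
  refine ⟨.loop S.depth t t', ⟨hc, ht, ht'⟩, fun c env hc hv => ?_⟩
  rw [ListTerm.eval, he c env hc hv, Int.toNat_natCast]
  exact List.flatMap_congr fun j hj =>
    he' (c, j) _ ⟨hc, List.mem_range.1 hj⟩ (hv.update j)

theorem isList_flatMap {ι : Type} (l : List ι) {f : ι → γ → List ℤ}
    (hf : ∀ i, S.IsList (f i)) : S.IsList fun c => l.flatMap fun i => f i c := by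
  induction l with
  | nil => exact isList_nil
  | cons i l ih => exact ((hf i).append ih).congr fun c _ => by rw [List.flatMap_cons]

end Scope

/-! ### The input of the machine -/

theorem getD_flatMap {ι α : Type} (f : ι → List α) (d : α) {m i : ℕ} (hi : i < m) :
    ∀ (l : List ι) (_ : ∀ x ∈ l, (f x).length = m) (a : ℕ) (ha : a < l.length),
      (l.flatMap f).getD (a * m + i) d = (f l[a]).getD i d
  | [], _, _, ha => absurd ha (Nat.not_lt_zero _)
  | x :: l, h, a, ha => by
    have hx : (f x).length = m := h x List.mem_cons_self
    rw [List.flatMap_cons]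
    cases a with
    | zero =>
      rw [zero_mul, zero_add, List.getD_append _ _ _ _ (by omega)]
      rfl
    | succ a =>
      rw [List.getD_append_right _ _ _ _ (by rw [hx, add_mul]; omega), hx,
        show (a + 1) * m + i - m = a * m + i by rw [add_mul]; omega,
        getD_flatMap f d hi l (fun y hy => h y (List.mem_cons_of_mem _ hy)) a
          (by simpa using ha)]
      rfl

theorem length_flatMap_const {ι α : Type} {f : ι → List α} {m : ℕ} (h : ∀ x, (f x).length = m)
    (l : List ι) : (l.flatMap f).length = l.length * m := by
  simp [List.length_flatMap, h]

namespace RatData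

variable {n N : ℕ} (T : RatData n N) (k : ℕ)

theorem input_getD (a : Fin N) {i : ℕ} (hi : i < 2 * n + 1) :
    (T.input k).getD (3 + a * (2 * n + 1) + i) 0 =
      ((T a).2 :: (List.finRange n).flatMap fun j =>
        [((T a).1 j).num, (((T a).1 j).den : ℤ)]).getD i 0 := by
  have h1 : (T.input k).getD (3 + a * (2 * n + 1) + i) 0 =
      ((List.finRange N).flatMap fun a => (T a).2 :: (List.finRange n).flatMap fun j =>
        [((T a).1 j).num, (((T a).1 j).den : ℤ)]).getD (a * (2 * n + 1) + i) 0 := by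
    rw [show 3 + a * (2 * n + 1) + i = (a * (2 * n + 1) + i) + 1 + 1 + 1 by ring]
    rfl
  rw [h1, getD_flatMap _ _ hi (List.finRange N) _ a (by simp)]
  · simp
  · intro x _
    rw [List.length_cons, length_flatMap_const (m := 2) fun _ => rfl, List.length_finRange, mul_comm]

theorem input_label (a : Fin N) : (T.input k).getD (3 + a * (2 * n + 1)) 0 = (T a).2 :=
  input_getD T k a (Nat.succ_pos _)

theorem input_num (a : Fin N) (j : Fin n) :
    (T.input k).getD (3 + a * (2 * n + 1) + (1 + 2 * j)) 0 = ((T a).1 j).num := by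
  rw [input_getD T k a (by omega), show 1 + 2 * (j : ℕ) = j * 2 + 1 by ring, List.getD_cons_succ,
    ← add_zero (j * 2 : ℕ), getD_flatMap (m := 2) _ _ two_pos _ (fun _ _ => rfl) j (by simp),
    List.getElem_finRange]
  rfl

theorem input_den (a : Fin N) (j : Fin n) :
    (T.input k).getD (3 + a * (2 * n + 1) + (2 + 2 * j)) 0 = ((T a).1 j).den := by
  rw [input_getD T k a (by omega), show 2 + 2 * (j : ℕ) = (j * 2 + 1) + 1 by ring,
    List.getD_cons_succ, getD_flatMap (m := 2) _ _ one_lt_two _ (fun _ _ => rfl) j (by simp)]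
  rw [List.getElem_finRange]
  rfl

end RatData

theorem inputArray_natCast (l : List ℤ) (i : ℕ) : inputArray l i = l.getD i 0 := by
  simp [inputArray]

/-- The link between the real floors in the construction and the integer division of the machine. -/
theorem floor_intCast_div (a : ℤ) {b : ℤ} (hb : 0 < b) : ⌊(a : ℝ) / b⌋ = a / b := by
  have hb' : (0 : ℝ) < b := by exact_mod_cast hb
  rw [Int.floor_eq_iff, le_div_iff₀ hb', div_lt_iff₀ hb']
  exact ⟨by exact_mod_cast Int.ediv_mul_le a hb.ne', by
    exact_mod_cast Int.lt_ediv_add_one_mul_self a hb⟩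

namespace MachineInput

variable (A : MachineInput)

/-- The coordinates of the points. -/
noncomputable abbrev X : ℕ → ℕ → ℝ := coords A.T.toReal

/-- The labels of the points. -/
noncomputable abbrev Y : ℕ → ℤ := labels A.T.toReal

/-- The numerator of a coordinate. -/
def num (a j : ℕ) : ℤ := A.I (3 + a * (2 * A.n + 1) + (1 + 2 * j))

/-- The denominator of a coordinate. -/
def den (a j : ℕ) : ℤ := A.I (3 + a * (2 * A.n + 1) + (2 + 2 * j))

/-- The product of all denominators. -/
def denProd : ℤ := ∏ a ∈ Finset.range A.N, ∏ j ∈ Finset.range A.n, A.den a j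

/-- The coordinates of the points, times the product of all denominators. -/
def scaled (a j : ℕ) : ℤ := A.num a j * (A.denProd / A.den a j)

/-- The number of bits of the weights. -/
noncomputable def bits : ℕ := precision A.n A.N A.X A.Y

/-- The weights of the projection in the `r`-th try. -/
noncomputable def tryWeights (r j : ℕ) : ℤ :=
  ∑ b ∈ Finset.range A.bits, 2 ^ b * A.C (r * (A.n * A.bits) + j * A.bits + b)

theorem I_label {a : ℕ} (ha : a < A.N) : A.I (3 + a * (2 * A.n + 1)) = A.Y a := by
  have h1 : (3 + a * (2 * A.n + 1) : ℤ) = ((3 + a * (2 * A.n + 1) : ℕ) : ℤ) := by push_cast; ring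
  rw [I, h1, inputArray_natCast, RatData.input_label A.T A.k ⟨a, ha⟩, Y, labels, dif_pos ha]
  exact (Int.floor_intCast _).symm

theorem num_eq {a j : ℕ} (ha : a < A.N) (hj : j < A.n) :
    A.num a j = ((A.T ⟨a, ha⟩).1 ⟨j, hj⟩).num := by
  have h1 : (3 + a * (2 * A.n + 1) + (1 + 2 * j) : ℤ) =
    ((3 + a * (2 * A.n + 1) + (1 + 2 * j) : ℕ) : ℤ) := by push_cast; ring
  rw [num, I, h1, inputArray_natCast]
  exact RatData.input_num A.T A.k ⟨a, ha⟩ ⟨j, hj⟩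

theorem den_eq {a j : ℕ} (ha : a < A.N) (hj : j < A.n) :
    A.den a j = ((A.T ⟨a, ha⟩).1 ⟨j, hj⟩).den := by
  have h1 : (3 + a * (2 * A.n + 1) + (2 + 2 * j) : ℤ) =
    ((3 + a * (2 * A.n + 1) + (2 + 2 * j) : ℕ) : ℤ) := by push_cast; ring
  rw [den, I, h1, inputArray_natCast]
  exact RatData.input_den A.T A.k ⟨a, ha⟩ ⟨j, hj⟩

theorem den_pos {a j : ℕ} (ha : a < A.N) (hj : j < A.n) : 0 < A.den a j := by
  rw [den_eq A ha hj]
  exact_mod_cast Rat.den_pos _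

theorem X_eq {a j : ℕ} (ha : a < A.N) (hj : j < A.n) : A.X a j = A.num a j / A.den a j := by
  rw [num_eq A ha hj, den_eq A ha hj, X, coords, dif_pos ⟨ha, hj⟩]
  exact Rat.cast_def _

theorem denProd_pos : 0 < A.denProd :=
  Finset.prod_pos fun _ ha => Finset.prod_pos fun _ hj =>
    A.den_pos (Finset.mem_range.1 ha) (Finset.mem_range.1 hj)

theorem den_dvd {a j : ℕ} (ha : a < A.N) (hj : j < A.n) : A.den a j ∣ A.denProd :=
  (Finset.dvd_prod_of_mem (fun j => A.den a j) (Finset.mem_range.2 hj)).trans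
    (Finset.dvd_prod_of_mem (fun a => ∏ j ∈ Finset.range A.n, A.den a j) (Finset.mem_range.2 ha))

/-- Over the common denominator projections and squared distances become quotients of integers, so
that all floors are computable by integer division. -/
theorem X_eq_scaled {a j : ℕ} (ha : a < A.N) (hj : j < A.n) :
    A.X a j = A.scaled a j / A.denProd := by
  have h1 : (A.den a j : ℝ) ≠ 0 := by exact_mod_cast (A.den_pos ha hj).ne'
  have h2 : (A.denProd : ℝ) ≠ 0 := by exact_mod_cast A.denProd_pos.ne'
  rw [X_eq A ha hj, scaled, Int.cast_mul, Int.cast_div (A.den_dvd ha hj) h1]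
  field_simp

theorem separated : Separated A.n A.N A.X A.Y := A.isDataset.separated

theorem proj_eq (w : ℕ → ℤ) {a : ℕ} (ha : a < A.N) :
    proj A.n A.X w a = (∑ j ∈ Finset.range A.n, w j * A.scaled a j) / A.denProd := by
  rw [← floor_intCast_div _ A.denProd_pos, proj]
  congr 1
  push_cast
  rw [Finset.sum_div]
  exact Finset.sum_congr rfl fun j hj => by
    rw [A.X_eq_scaled ha (Finset.mem_range.1 hj), mul_div_assoc]

theorem resolution_eq : resolution A.n A.N A.X A.Y = ∑ a ∈ Finset.range A.N,
    ∑ b ∈ Finset.range A.N, (1 - A.Y a * A.Y b) *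
      ((8 * A.n * A.N * A.N * A.denProd * A.denProd) / (∑ j ∈ Finset.range A.n,
        (A.scaled a j - A.scaled b j) * (A.scaled a j - A.scaled b j)) + 1) := by
  refine Finset.sum_congr rfl fun a ha => Finset.sum_congr rfl fun b hb => ?_
  have ha := Finset.mem_range.1 ha
  have hb := Finset.mem_range.1 hb
  -- Points with equal labels may coincide, but their term has the factor 0. For all other pairs the
  -- divisor is positive.
  by_cases hab : A.Y a = A.Y b
  · rw [hab, one_sub_mul_self (A.separated.2.1 b hb), zero_mul, zero_mul]
  congr 2
  set G : ℤ := ∑ j ∈ Finset.range A.n,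
        (A.scaled a j - A.scaled b j) * (A.scaled a j - A.scaled b j) with hG
  have hQ : (0 : ℝ) < A.denProd := by exact_mod_cast A.denProd_pos
  have h1 : sqDist A.n A.X a b = G / (A.denProd * A.denProd) := by
    rw [hG, sqDist]
    push_cast
    rw [Finset.sum_div]
    refine Finset.sum_congr rfl fun j hj => ?_
    have hj := Finset.mem_range.1 hj
    rw [A.X_eq_scaled ha hj, A.X_eq_scaled hb hj]
    field_simp
  have h2 := A.separated.2.2 a ha b hb hab
  have h3 : 0 < G := by
    rw [h1] at h2
    have := (div_pos_iff_of_pos_right (mul_pos hQ hQ)).1 h2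
    exact_mod_cast this
  rw [← floor_intCast_div _ h3, h1]
  congr 1
  push_cast
  field_simp

end MachineInput

/-! ### Projections, defects and other quantities of the dataset as terms -/

namespace Scope

variable {γ : Type} {S : Scope γ}

theorem isCount_k : S.IsCount fun c => (S.inst c).k :=
  ⟨.inp (.lit 0), ⟨le_rfl, by norm_num⟩, trivial, fun _ _ _ _ => rfl⟩

theorem isCount_n : S.IsCount fun c => (S.inst c).n :=
  ⟨.inp (.lit 1), ⟨by norm_num, by norm_num⟩, trivial, fun _ _ _ _ => rfl⟩

theorem isCount_N : S.IsCount fun c => (S.inst c).N :=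
  ⟨.inp (.lit 2), ⟨by norm_num, by norm_num⟩, trivial, fun _ _ _ _ => rfl⟩

theorem isTerm_n : S.IsTerm fun c => ((S.inst c).n : ℤ) := isCount_n.isNat

theorem isTerm_N : S.IsTerm fun c => ((S.inst c).N : ℤ) := isCount_N.isNat

theorem IsNat.label {a : γ → ℕ} (ha : S.IsNat a) (h : ∀ c, S.ok c → a c < (S.inst c).N) :
    S.IsTerm fun c => (S.inst c).Y (a c) :=
  (((isTerm_const 3).add (IsTerm.mul ha (((isTerm_const 2).mul isTerm_n).add
    (isTerm_const 1)))).inp).congr fun c hc => MachineInput.I_label _ (h c hc)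

theorem isTerm_num {a j : γ → ℕ} (ha : S.IsNat a) (hj : S.IsNat j) :
    S.IsTerm fun c => (S.inst c).num (a c) (j c) :=
  (((isTerm_const 3).add (IsTerm.mul ha (((isTerm_const 2).mul isTerm_n).add
    (isTerm_const 1)))).add ((isTerm_const 1).add ((isTerm_const 2).mul hj))).inp

theorem isTerm_den {a j : γ → ℕ} (ha : S.IsNat a) (hj : S.IsNat j) :
    S.IsTerm fun c => (S.inst c).den (a c) (j c) :=
  (((isTerm_const 3).add (IsTerm.mul ha (((isTerm_const 2).mul isTerm_n).add
    (isTerm_const 1)))).add ((isTerm_const 2).add ((isTerm_const 2).mul hj))).inp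

theorem isTerm_denProd : S.IsTerm fun c => (S.inst c).denProd :=
  isCount_N.prod (f := fun c a => ∏ j ∈ Finset.range (S.inst c).n, (S.inst c).den a j)
    (isCount_n.prod (S := S.index _) (isTerm_den isNat_last.index isNat_last))

theorem isTerm_scaled {a j : γ → ℕ} (ha : S.IsNat a) (hj : S.IsNat j) :
    S.IsTerm fun c => (S.inst c).scaled (a c) (j c) :=
  (isTerm_num ha hj).mul (isTerm_denProd.div (isTerm_den ha hj))

theorem isTerm_resolution : S.IsTerm fun c =>
    resolution (S.inst c).n (S.inst c).N (S.inst c).X (S.inst c).Y := by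
  refine IsTerm.congr ?_ fun c _ => (S.inst c).resolution_eq.symm
  refine isCount_N.sum (isCount_N.sum (S := S.index _) (IsTerm.mul ?_ (IsTerm.add ?_ ?_)))
  · exact (isTerm_const 1).sub ((isNat_last.index.label fun p h => h.1.2).mul
      (isNat_last.label fun p h => h.2))
  · refine IsTerm.div (((((isTerm_const 8).mul isTerm_n).mul isTerm_N).mul isTerm_N).mul
      isTerm_denProd |>.mul isTerm_denProd) (isCount_n.sum (S := (S.index _).index _) ?_)
    have h := (isTerm_scaled (S := ((S.index fun c => (S.inst c).N).index
      fun p => (S.inst p.1).N).index fun p => (S.inst p.1.1).n)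
      isNat_last.index.index isNat_last).sub (isTerm_scaled isNat_last.index isNat_last)
    exact h.mul h
  · exact isTerm_const 1

theorem isCount_bits : S.IsCount fun c => (S.inst c).bits := isTerm_resolution.isCount_size

theorem isTerm_tryWeights {r j : γ → ℕ} (hr : S.IsNat r) (hj : S.IsNat j) :
    S.IsTerm fun c => (S.inst c).tryWeights (r c) (j c) := by
  refine isCount_bits.sum (IsTerm.mul (isNat_last.two_pow (isCount_bits (S := S.index _))
    fun p h => h.2.le) (IsTerm.coin ?_))
  exact ((IsTerm.mul hr.index (isTerm_n.mul isCount_bits.isNat)).add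
    (IsTerm.mul hj.index (isCount_bits (S := S.index _)).isNat)).add isNat_last

theorem isTerm_proj {w : γ → ℕ → ℤ} {a : γ → ℕ} (ha : S.IsNat a)
    (hw : (S.index fun c => (S.inst c).n).IsTerm fun p => w p.1 p.2)
    (h : ∀ c, S.ok c → a c < (S.inst c).N) :
    S.IsTerm fun c => proj (S.inst c).n (S.inst c).X (w c) (a c) :=
  ((isCount_n.sum (hw.mul (isTerm_scaled ha.index isNat_last))).div isTerm_denProd).congr
    fun c hc => (MachineInput.proj_eq _ _ (h c hc)).symm

theorem isTerm_tryProj {r a : γ → ℕ} (hr : S.IsNat r) (ha : S.IsNat a)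
    (h : ∀ c, S.ok c → a c < (S.inst c).N) : S.IsTerm fun c =>
      proj (S.inst c).n (S.inst c).X ((S.inst c).tryWeights (r c)) (a c) :=
  isTerm_proj (w := fun c => (S.inst c).tryWeights (r c)) ha
    (isTerm_tryWeights (S := S.index _) hr.index isNat_last) h

theorem isTerm_tryDefect {r : γ → ℕ} (hr : S.IsNat r) : S.IsTerm fun c =>
    defect (S.inst c).N (S.inst c).Y
      (proj (S.inst c).n (S.inst c).X ((S.inst c).tryWeights (r c))) := by
  refine isCount_N.sum (isCount_N.sum (S := S.index _) (IsTerm.mul ?_ ?_))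
  · exact (isTerm_const 1).sub ((isNat_last.index.label fun p h => h.1.2).mul
      (isNat_last.label fun p h => h.2))
  · have h := (isTerm_tryProj (S := (S.index fun c => (S.inst c).N).index
      fun p => (S.inst p.1).N) hr.index.index isNat_last.index fun p h => h.1.2).sub
      (isTerm_tryProj hr.index.index isNat_last fun p h => h.2)
    exact (isTerm_const 4).div ((h.mul h).add (isTerm_const 1))

end Scope

namespace MachineInput

variable (A : MachineInput)

open Classical in
/-- The number of failures before the first successful one of the first `k` tries. -/
noncomputable def failures : ℕ :=
  ∑ r ∈ Finset.range A.k, ∏ i ∈ Finset.range A.k,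
    if i ≤ r ∧ defect A.N A.Y (proj A.n A.X (A.tryWeights i)) = 0 then 0 else 1

/-- The product over i is 1 exactly when no try up to the current index has succeeded, so the sum
counts the tries before the first success. In this way the search needs only sums and products. -/
theorem failures_eq {r : ℕ} (hr : r < A.k)
    (h : defect A.N A.Y (proj A.n A.X (A.tryWeights r)) = 0)
    (h' : ∀ i < r, defect A.N A.Y (proj A.n A.X (A.tryWeights i)) ≠ 0) : A.failures = r := by
  classical
  have h1 : ∀ j ∈ Finset.range A.k, (∏ i ∈ Finset.range A.k,
      if i ≤ j ∧ defect A.N A.Y (proj A.n A.X (A.tryWeights i)) = 0 then 0 else 1) =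
      if j < r then 1 else 0 := by
    intro j _
    split_ifs with hj
    · exact Finset.prod_eq_one fun i _ => if_neg fun hi => h' i (by omega) hi.2
    · exact Finset.prod_eq_zero (Finset.mem_range.2 hr) (if_pos ⟨by omega, h⟩)
  have h2 : (Finset.range A.k).filter (· < r) = Finset.range r := by
    ext j
    simp only [Finset.mem_filter, Finset.mem_range]
    omega
  rw [failures, Finset.sum_congr rfl h1, Finset.sum_ite, Finset.sum_const_zero, add_zero, h2]
  simp

/-- The weights of the first successful try. -/
noncomputable def firstWeights : ℕ → ℤ := A.tryWeights A.failures

/-- The rounded projections for the first successful try. -/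
noncomputable def firstProj : ℕ → ℤ := proj A.n A.X A.firstWeights

end MachineInput

namespace Scope

variable {γ : Type} {S : Scope γ}

theorem isNat_failures : S.IsNat fun c => (S.inst c).failures := by
  classical
  have h : S.IsTerm fun c => ∑ r ∈ Finset.range (S.inst c).k, ∏ i ∈ Finset.range (S.inst c).k,
      if i ≤ r ∧ defect (S.inst c).N (S.inst c).Y (proj (S.inst c).n (S.inst c).X
        ((S.inst c).tryWeights i)) = 0 then (0 : ℤ) else 1 := by
    refine isCount_k.sum (isCount_k.prod (S := S.index _) (IsCond.ite ?_ (isTerm_const 0)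
      (isTerm_const 1)))
    exact (isNat_last.le isNat_last.index).and (isTerm_tryDefect isNat_last).eq_zero
  refine h.congr fun c _ => ?_
  beta_reduce
  rw [MachineInput.failures]
  push_cast
  exact Finset.sum_congr rfl fun r _ => Finset.prod_congr rfl fun i _ => by congr

theorem isTerm_firstWeights {j : γ → ℕ} (hj : S.IsNat j) :
    S.IsTerm fun c => (S.inst c).firstWeights (j c) := isTerm_tryWeights isNat_failures hj

theorem isTerm_firstProj {a : γ → ℕ} (ha : S.IsNat a) (h : ∀ c, S.ok c → a c < (S.inst c).N) :
    S.IsTerm fun c => (S.inst c).firstProj (a c) := isTerm_tryProj isNat_failures ha h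

end Scope

/-! ### The memorizing network as a list of terms -/

namespace MachineInput

variable (A : MachineInput)

/-- The number of bits of the rounded projections. -/
noncomputable def codeBits : ℕ := codeLength A.n A.bits

/-- An upper bound for the rounded projections. -/
noncomputable def cap : ℤ := 2 ^ A.codeBits - 1

/-- The thresholds of the network. -/
noncomputable def thresholds : ℕ → ℤ := threshold A.N A.firstProj A.Y A.cap

theorem tryWeights_nonneg (r j : ℕ) : 0 ≤ A.tryWeights r j :=
  Finset.sum_nonneg fun _ _ => mul_nonneg (by positivity) (A.C_nonneg _)

theorem firstProj_nonneg {a : ℕ} (ha : a < A.N) : 0 ≤ A.firstProj a :=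
  Int.floor_nonneg.2 (Finset.sum_nonneg fun j hj => mul_nonneg
    (by exact_mod_cast A.tryWeights_nonneg _ _)
    (A.separated.1 a ha j (Finset.mem_range.1 hj)).1)

theorem cap_nonneg : 0 ≤ A.cap := by
  have : (0 : ℤ) < 2 ^ A.codeBits := by positivity
  rw [cap]
  omega

end MachineInput

/-- The alternating signs of `decodeLayers` can thus be computed from a parity. -/
theorem signAfter_eq (i : ℕ) : signAfter i = (-1) ^ i := by
  induction i with
  | zero => rfl
  | succ i ih => rw [signAfter_succ, ih, pow_succ, mul_neg_one]

namespace Scope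

variable {γ : Type} {S : Scope γ}

theorem isCount_codeBits : S.IsCount fun c => (S.inst c).codeBits := by
  have h : S.IsTerm fun c => (((S.inst c).n * (2 ^ (S.inst c).bits - 1) + 1 : ℕ) : ℤ) := by
    refine ((isTerm_n.mul ((isCount_bits.isNat.two_pow isCount_bits fun _ _ => le_rfl).sub
      (isTerm_const 1))).add (isTerm_const 1)).congr fun c _ => ?_
    push_cast [Nat.cast_sub Nat.one_le_two_pow]
    rfl
  exact h.isCount_size

theorem isTerm_cap : S.IsTerm fun c => (S.inst c).cap :=
  (isCount_codeBits.isNat.two_pow isCount_codeBits fun _ _ => le_rfl).sub (isTerm_const 1)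

theorem IsNat.signAfter {j : γ → ℕ} (hj : S.IsNat j) : S.IsTerm fun c => signAfter (j c) :=
  ((isTerm_const 1).sub ((isTerm_const 2).mul (IsTerm.sub hj ((isTerm_const 2).mul
    (IsTerm.div hj (isTerm_const 2)))))).congr fun c _ => by
      rw [_root_.signAfter, Int.emod_def]

/-- The recursion is an iteration with values in [0, cap], and cap ≤ cap² for a natural number; so
the cap itself serves as modulus parameter. -/
theorem isTerm_minAbove {s t : γ → ℤ} (hs : S.IsTerm s) (ht : S.IsTerm t) : S.IsTerm fun c =>
    minAbove (S.inst c).firstProj (S.inst c).Y (S.inst c).cap (s c) (t c) (S.inst c).N := by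
  refine isCount_N.iterate (F := fun c =>
    minAbove (S.inst c).firstProj (S.inst c).Y (S.inst c).cap (s c) (t c))
    (g := fun c v j => if 0 < s c * (S.inst c).Y j ∧ t c < (S.inst c).firstProj j ∧
      (S.inst c).firstProj j < v then (S.inst c).firstProj j else v)
    isTerm_cap isTerm_cap ?_ fun c _ j hj => ⟨rfl, ?_, ?_⟩
  · have hm : (S.round fun c => (S.inst c).N).IsTerm fun p => (S.inst p.1.1).firstProj p.2 :=
      isTerm_firstProj isNat_round fun p h => h.2
    exact IsCond.ite (((isTerm_const 0).lt (hs.round.mul (isNat_round.label fun p h => h.2))).and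
      ((ht.round.lt hm).and (hm.lt isTerm_acc))) hm isTerm_acc
  · rcases minAbove_eq (S.inst c).firstProj (S.inst c).Y (S.inst c).cap (s c) (t c) (j + 1) with
      h | ⟨l, hl, -, -, h⟩
    · exact h.symm ▸ (S.inst c).cap_nonneg
    · exact h.symm ▸ (S.inst c).firstProj_nonneg (by omega)
  · have h1 := minAbove_le (S.inst c).firstProj (S.inst c).Y (S.inst c).cap (s c) (t c) (j + 1)
    have h2 := (S.inst c).cap_nonneg
    nlinarith

/-- An iteration needs nonnegative values, but the 0-th threshold is -1; hence the shift by 1. The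
loop runs M rounds and stands still after round e. -/
theorem isTerm_thresholds {e M : γ → ℕ} (he : S.IsNat e) (hM : S.IsCount M)
    (h : ∀ c, S.ok c → e c ≤ M c) : S.IsTerm fun c => (S.inst c).thresholds (e c) := by
  have key : S.IsTerm fun c => (S.inst c).thresholds (min (M c) (e c)) + 1 := by
    refine hM.iterate (F := fun c j => (S.inst c).thresholds (min j (e c)) + 1)
      (m := fun c => (S.inst c).cap + 1)
      (g := fun c v j => if j < e c then minAbove (S.inst c).firstProj (S.inst c).Y
        (S.inst c).cap (_root_.signAfter j) (v - 1) (S.inst c).N + 1 else v) ?_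
      (isTerm_cap.add (isTerm_const 1)) ?_ fun c _ j _ => ⟨?_, ?_, ?_⟩
    · refine (isTerm_const 0).congr fun c _ => ?_
      rw [Nat.zero_min]
      rfl
    · exact IsCond.ite (isNat_round.lt (IsTerm.round he)) ((isTerm_minAbove
        isNat_round.signAfter (isTerm_acc.sub (isTerm_const 1))).add (isTerm_const 1)) isTerm_acc
    · split_ifs with hj
      · rw [min_eq_left (show j + 1 ≤ e c by omega), min_eq_left hj.le, add_sub_cancel_right]
        rfl
      · rw [min_eq_right (show e c ≤ j + 1 by omega), min_eq_right (show e c ≤ j by omega)]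
    · rcases Nat.eq_zero_or_pos (min (j + 1) (e c)) with h0 | h0
      · rw [h0]
        exact le_rfl
      · have := threshold_succ_nonneg (N := (S.inst c).N) (y := (S.inst c).Y)
          (fun k hk => (S.inst c).firstProj_nonneg hk) (S.inst c).cap_nonneg h0
        exact this.trans (Int.le_add_one le_rfl)
    · have h1 : (S.inst c).thresholds (min (j + 1) (e c)) ≤ (S.inst c).cap :=
        threshold_le (S.inst c).cap_nonneg _
      have h2 := (S.inst c).cap_nonneg
      nlinarith
  refine (key.sub (isTerm_const 1)).congr fun c hc => ?_
  rw [min_eq_right (h c hc), add_sub_cancel_right]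

/-- The root of N is the number of positive integers whose square is at most N. -/
theorem isCount_sqrt : S.IsCount fun c => Nat.sqrt (S.inst c).N := by
  refine IsNat.isCount ?_ isCount_N fun c _ => Nat.sqrt_le_self _
  have hj : (S.index fun c => (S.inst c).N).IsNat fun p => p.2 + 1 := isNat_last.add (isNat_const 1)
  refine (isCount_N.sum (f := fun c j => if (j + 1) * (j + 1) ≤ (S.inst c).N then 1 else 0)
    (((hj.mul hj).le isCount_N.isNat).ite (isTerm_const 1) (isTerm_const 0))).congr fun c _ => ?_
  have : (Finset.range (S.inst c).N).filter (fun j => (j + 1) * (j + 1) ≤ (S.inst c).N) =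
      Finset.range (Nat.sqrt (S.inst c).N) := by
    ext j
    have := Nat.sqrt_le_self (S.inst c).N
    rw [Finset.mem_filter, Finset.mem_range, Finset.mem_range, ← Nat.le_sqrt]
    omega
  rw [Finset.sum_ite, Finset.sum_const_zero, add_zero, this]
  simp

/-! ### Codes of layers -/

theorem isTerm_vecCons {m : ℕ} {f : γ → ℤ} {v : γ → Fin m → ℤ} (hf : S.IsTerm f)
    (hv : ∀ j, S.IsTerm fun c => v c j) (j : Fin (m + 1)) :
    S.IsTerm fun c => Matrix.vecCons (f c) (v c) j := by
  induction j using Fin.cases with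
  | zero => exact hf
  | succ j => exact hv j

theorem isTerm_matCons {m k : ℕ} {f : γ → Fin k → ℤ} {B : γ → Fin m → Fin k → ℤ}
    (hf : ∀ j, S.IsTerm fun c => f c j) (hB : ∀ i j, S.IsTerm fun c => B c i j) (i : Fin (m + 1))
    (j : Fin k) : S.IsTerm fun c => Matrix.vecCons (f c) (B c) i j := by
  induction i using Fin.cases with
  | zero => exact hf j
  | succ i => exact hB i j

end Scope

/-- The code of a hidden layer with integer weights. -/
def layerCode (B : LayerMatrix ℤ) : List ℤ :=
  1 :: 6 :: (List.finRange 6).flatMap fun i =>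
    (List.finRange 6).flatMap (fun j => [B i j.castSucc, 1]) ++ [B i (Fin.last 6), 1]

theorem ratCode_intCast (z : ℤ) : Network.ratCode z = [z, 1] := rfl

/-- The constant list at the end is the code of the output layer 2v₃ - 1, with all denominators 1.
-/
theorem encode_stackNet (l : List (LayerMatrix ℤ)) : (stackNet l).encode =
    l.flatMap layerCode ++ [0, 0, 1, 0, 1, 0, 1, 2, 1, 0, 1, 0, 1, -1, 1] := by
  induction l with
  | nil => rfl
  | cons B l ih =>
    rw [stackNet, Network.encode, ih, List.flatMap_cons, layerCode]
    simp only [ratCode_intCast, List.cons_append, List.append_assoc]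
    rfl

theorem encode_memoNet (n : ℕ) (w : ℕ → ℤ) (l : List (LayerMatrix ℤ)) :
    (memoNet n w l).encode = 1 :: 6 :: ((List.finRange 6).flatMap (fun i =>
      (List.range n).flatMap (fun j => [if i = 0 then w j else 0, 1]) ++
        [if i = 0 then 1 else 0, 1]) ++ (l.flatMap layerCode ++
          [0, 0, 1, 0, 1, 0, 1, 2, 1, 0, 1, 0, 1, -1, 1])) := by
  rw [memoNet, Network.encode, encode_stackNet]
  refine congrArg _ (congrArg _ (congrArg₂ _ (List.flatMap_congr fun i _ => ?_) rfl))
  rw [← List.map_coe_finRange_eq_range, List.flatMap_map]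
  split_ifs <;> rfl

namespace Scope

variable {γ : Type} {S : Scope γ}

theorem isList_layerCode {B : γ → LayerMatrix ℤ} (h : ∀ i j, S.IsTerm fun c => B c i j) :
    S.IsList fun c => layerCode (B c) :=
  (isTerm_const 1).cons ((isTerm_const 6).cons (isList_flatMap _ fun i => IsList.append
    (isList_flatMap _ fun j => (h i j.castSucc).cons ((isTerm_const 1).cons isList_nil))
    ((h i (Fin.last 6)).cons ((isTerm_const 1).cons isList_nil))))

theorem isList_opLayers {p₀ p₁ p₂ θ ρ c₁ c₂ c₃ : γ → ℤ} (h₀ : S.IsTerm p₀) (h₁ : S.IsTerm p₁)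
    (h₂ : S.IsTerm p₂) (hθ : S.IsTerm θ) (hρ : S.IsTerm ρ) (k₁ : S.IsTerm c₁) (k₂ : S.IsTerm c₂)
    (k₃ : S.IsTerm c₃) : S.IsList fun c =>
      (opLayers (p₀ c) (p₁ c) (p₂ c) (θ c) (ρ c) (c₁ c) (c₂ c) (c₃ c)).flatMap layerCode := by
  have z : S.IsTerm fun _ => 0 := isTerm_const 0
  have hc : ∀ (v : Fin 7 → ℤ) (j : Fin 7), S.IsTerm fun _ => v j := fun v j => isTerm_const _
  have e : ∀ j : Fin 0, S.IsTerm fun _ => (![] : Fin 0 → ℤ) j := fun j => j.elim0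
  have e' : ∀ (i : Fin 0) (j : Fin 7), S.IsTerm fun _ => (![] : Fin 0 → Fin 7 → ℤ) i j :=
    fun i => i.elim0
  have hp : ∀ {b : γ → ℤ}, S.IsTerm b → ∀ j, S.IsTerm fun c =>
      ![p₀ c, p₁ c, p₂ c, 0, 0, 0, b c] j := fun hb =>
    isTerm_vecCons h₀ (isTerm_vecCons h₁ (isTerm_vecCons h₂ (isTerm_vecCons z (isTerm_vecCons z
      (isTerm_vecCons z (isTerm_vecCons hb e))))))
  have ha : ∀ {a : γ → ℤ} (x y z w : ℤ), S.IsTerm a → ∀ j, S.IsTerm fun c =>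
      ![x, y, z, w, a c, -a c, 0] j := fun x y z' w hb =>
    isTerm_vecCons (isTerm_const x) (isTerm_vecCons (isTerm_const y) (isTerm_vecCons
      (isTerm_const z') (isTerm_vecCons (isTerm_const w) (isTerm_vecCons hb (isTerm_vecCons hb.neg
        (isTerm_vecCons z e))))))
  refine ((isList_layerCode (B := fun c =>
      probeMatrix (p₀ c) (p₁ c) (p₂ c) (-θ c) (-θ c - 1)) ?_).append
    (isList_layerCode (B := fun c => updateMatrix (ρ c) (1 - ρ c) (c₁ c) (-c₁ c) (c₂ c) (-c₂ c)
      (c₃ c) (-c₃ c)) ?_)).congr fun c _ => by simp [opLayers]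
  · exact isTerm_matCons (hc _) (isTerm_matCons (hc _) (isTerm_matCons (hc _) (isTerm_matCons (hc _)
      (isTerm_matCons (hp hθ.neg) (isTerm_matCons (hp (hθ.neg.sub (isTerm_const 1))) e')))))
  · refine isTerm_matCons (hc _) (isTerm_matCons (ha _ _ _ _ k₁) (isTerm_matCons ?_ (isTerm_matCons
      (ha _ _ _ _ k₃) (isTerm_matCons (hc _) (isTerm_matCons (hc _) e')))))
    exact isTerm_vecCons hρ (isTerm_vecCons z (isTerm_vecCons ((isTerm_const 1).sub hρ)
      (isTerm_vecCons z (isTerm_vecCons k₂ (isTerm_vecCons k₂.neg (isTerm_vecCons z e))))))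

theorem isList_bitLayers {T : γ → ℕ} {M : γ → ℕ} (hT : S.IsNat T) (hM : S.IsCount M)
    (h : ∀ c, S.ok c → T c ≤ M c) :
    S.IsList fun c => (bitLayers (S.inst c).codeBits (T c)).flatMap layerCode := by
  have hl : S.IsList fun c => (List.range (S.inst c).codeBits).flatMap fun b =>
      (opLayers 0 1 0 (2 ^ (T c + ((S.inst c).codeBits - 1 - b)) - 1) 0
        (-2 ^ (T c + ((S.inst c).codeBits - 1 - b))) (-2 ^ ((S.inst c).codeBits - 1 - b))
        0).flatMap layerCode := by
    refine isCount_codeBits.flatMap ?_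
    have he : (S.index fun c => (S.inst c).codeBits).IsNat
        fun p => (S.inst p.1).codeBits - 1 - p.2 :=
      ((isCount_codeBits (S := S.index _)).isNat.sub (isNat_const 1)).sub isNat_last
    have h1 := he.two_pow (isCount_codeBits (S := S.index _)) fun p _ =>
      (Nat.sub_le _ _).trans (Nat.sub_le _ _)
    have h2 := (hT.index.add he).two_pow (hM.index.add (isCount_codeBits (S := S.index _)))
      fun p hp => Nat.add_le_add (h p.1 hp.1) ((Nat.sub_le _ _).trans (Nat.sub_le _ _))
    exact isList_opLayers (isTerm_const 0) (isTerm_const 1) (isTerm_const 0)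
      (h2.sub (isTerm_const 1)) (isTerm_const 0) h2.neg h1.neg (isTerm_const 0)
  exact hl.congr fun c _ => by rw [bitLayers, List.flatMap_assoc]

theorem isList_decodeLayers {m : γ → ℕ} (hm : S.IsCount m) :
    S.IsList fun c => (decodeLayers (S.inst c).codeBits 1 (m c)).flatMap layerCode := by
  have hl : S.IsList fun c => (List.range (m c)).flatMap fun r =>
      (bitLayers (S.inst c).codeBits ((S.inst c).codeBits * (m c - 1 - r))).flatMap layerCode ++
        (opLayers 0 0 1 0 1 0 0 (signAfter r)).flatMap layerCode := by
    refine hm.flatMap (IsList.append ?_ ?_)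
    · exact isList_bitLayers (S := S.index _) ((isCount_codeBits (S := S.index _)).isNat.mul
        ((hm.isNat.index.sub (isNat_const 1)).sub isNat_last))
        ((isCount_codeBits (S := S.index _)).mul hm.index)
        fun p _ => Nat.mul_le_mul_left _ ((Nat.sub_le _ _).trans (Nat.sub_le _ _))
    · exact isList_opLayers (isTerm_const 0) (isTerm_const 0) (isTerm_const 1) (isTerm_const 0)
        (isTerm_const 1) (isTerm_const 0) (isTerm_const 0) isNat_last.signAfter
  refine hl.congr fun c _ => ?_
  simp only [decodeLayers, List.flatMap_assoc, List.flatMap_append, signAfter_eq, one_mul]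

theorem isTerm_groupCode {s j : γ → ℕ} (hs : S.IsCount s) (hj : S.IsNat j)
    (h : ∀ c, S.ok c → j c ≤ s c) : S.IsTerm fun c =>
      groupCode (S.inst c).codeBits (2 * s c) (S.inst c).thresholds (j c) := by
  have hq : S.IsCount fun c => 2 * s c := (isCount_const 2).mul hs
  have hq' : S.IsCount fun c => 2 * s c - 1 :=
    (hq.isNat.sub (isNat_const 1)).isCount hq fun c _ => Nat.sub_le _ _
  refine IsCond.ite ((isNat_const 0).lt hj) (hq'.sum (IsTerm.mul ?_ ?_)) (isTerm_const 0)
  · refine isTerm_thresholds (S := S.index _) (e := fun p => (j p.1 - 1) * (2 * s p.1) + 1 + p.2)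
      ((((hj.index.sub (isNat_const 1)).mul hq.isNat.index).add (isNat_const 1)).add isNat_last)
      ((hs.index.mul hq.index).add ((isCount_const 1).add hq.index)) fun p hp => ?_
    have h1 := h p.1 hp.1
    have h2 : p.2 < 2 * s p.1 - 1 := hp.2
    have h3 : (j p.1 - 1) * (2 * s p.1) ≤ s p.1 * (2 * s p.1) := Nat.mul_le_mul_right _ (by omega)
    omega
  · exact IsNat.two_pow (S := S.index _) ((isCount_codeBits (S := S.index _)).isNat.mul
      ((hq'.isNat.index.sub (isNat_const 1)).sub isNat_last))
      ((isCount_codeBits (S := S.index _)).mul hq'.index)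
      fun p _ => Nat.mul_le_mul_left _ ((Nat.sub_le _ _).trans (Nat.sub_le _ _))

theorem isList_selectLayers {s : γ → ℕ} (hs : S.IsCount s) : S.IsList fun c =>
    (selectLayers (S.inst c).codeBits (2 * s c) (S.inst c).thresholds (s c)).flatMap layerCode := by
  have hl : S.IsList fun c => (List.range (s c)).flatMap fun j =>
      (opLayers 1 0 0 ((S.inst c).thresholds (j * (2 * s c))) 1
        (groupCode (S.inst c).codeBits (2 * s c) (S.inst c).thresholds (j + 1) -
          groupCode (S.inst c).codeBits (2 * s c) (S.inst c).thresholds j) 0 0).flatMap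
            layerCode := by
    refine hs.flatMap (isList_opLayers (S := S.index _) (isTerm_const 1) (isTerm_const 0)
      (isTerm_const 0) ?_ (isTerm_const 1) (IsTerm.sub ?_ ?_) (isTerm_const 0) (isTerm_const 0))
    · exact isTerm_thresholds (S := S.index _)
        (isNat_last.mul ((isNat_const 2).mul hs.isNat.index))
        (hs.index.mul ((isCount_const 2).mul hs.index))
        fun p hp => Nat.mul_le_mul_right _ hp.2.le
    · exact isTerm_groupCode (S := S.index _) hs.index (isNat_last.add (isNat_const 1))
        fun p hp => hp.2
    · exact isTerm_groupCode (S := S.index _) hs.index isNat_last fun p hp => hp.2.le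
  exact hl.congr fun c _ => by rw [selectLayers, List.flatMap_assoc]

theorem isList_encode : S.IsList fun c => (memorizer (S.inst c).n (S.inst c).N (S.inst c).bits
    (S.inst c).firstWeights (S.inst c).firstProj (S.inst c).Y).encode := by
  have hs : S.IsCount fun c => Nat.sqrt (S.inst c).N + 1 := isCount_sqrt.add (isCount_const 1)
  have hd : S.IsCount fun c => 2 * (Nat.sqrt (S.inst c).N + 1) - 1 :=
    (((isNat_const 2).mul hs.isNat).sub (isNat_const 1)).isCount ((isCount_const 2).mul hs)
      fun c _ => Nat.sub_le _ _
  have hlast : ∀ l : List ℤ, S.IsList fun _ => l := fun l => by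
    induction l with
    | nil => exact isList_nil
    | cons z l ih => exact (isTerm_const z).cons ih
  have hw : ∀ i : Fin 6, S.IsList fun c => (List.range (S.inst c).n).flatMap (fun j =>
      [if i = 0 then (S.inst c).firstWeights j else 0, 1]) ++ [if i = 0 then 1 else 0, 1] :=
    fun i => by
      refine IsList.append (isCount_n.flatMap (S := S) (IsTerm.cons ?_
        ((isTerm_const 1).cons isList_nil))) (hlast _)
      split_ifs
      · exact isTerm_firstWeights (S := S.index _) isNat_last
      · exact isTerm_const 0
  refine ((isTerm_const 1).cons ((isTerm_const 6).cons ((isList_flatMap (List.finRange 6) hw).append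
    (((isList_selectLayers hs).append (isList_decodeLayers hd)).append (hlast
      [0, 0, 1, 0, 1, 0, 1, 2, 1, 0, 1, 0, 1, -1, 1]))))).congr fun c _ => ?_
  rw [memorizer, encode_memoNet, memoLayers, List.flatMap_append]
  rfl

end Scope

/-! ### The program -/

namespace RatData

variable {n N : ℕ} (T : RatData n N)

theorem size_ge (i : Fin N) : bitSize (T i).2 + ∑ j, (bitSize ((T i).1 j).num +
    bitSize (((T i).1 j).den : ℤ)) ≤ T.size :=
  Finset.single_le_sum (f := fun i => bitSize (T i).2 + ∑ j, (bitSize ((T i).1 j).num +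
    bitSize (((T i).1 j).den : ℤ))) (fun _ _ => Nat.zero_le _) (Finset.mem_univ i)

theorem size_ge_coord (i : Fin N) (j : Fin n) :
    bitSize ((T i).1 j).num + bitSize (((T i).1 j).den : ℤ) ≤ T.size :=
  (Finset.single_le_sum (f := fun j => bitSize ((T i).1 j).num + bitSize (((T i).1 j).den : ℤ))
    (fun _ _ => Nat.zero_le _) (Finset.mem_univ j)).trans
    ((Nat.le_add_left _ _).trans (T.size_ge i))

theorem card_le_size : N ≤ T.size := by
  have : ∑ _i : Fin N, 1 ≤ T.size := Finset.sum_le_sum fun i _ => by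
    have : 1 ≤ bitSize (T i).2 := Nat.succ_pos _
    omega
  simpa using this

theorem dim_le_size (hN : 0 < N) : n ≤ T.size := by
  have h : ∑ _j : Fin n, 1 ≤ ∑ j, (bitSize ((T ⟨0, hN⟩).1 j).num +
      bitSize (((T ⟨0, hN⟩).1 j).den : ℤ)) := Finset.sum_le_sum fun j _ => by
    have : 1 ≤ bitSize ((T ⟨0, hN⟩).1 j).num := Nat.succ_pos _
    omega
  have h' := T.size_ge ⟨0, hN⟩
  simp only [Finset.sum_const, Finset.card_univ, Fintype.card_fin, smul_eq_mul, mul_one] at h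
  omega

theorem bitSize_le_of_mem_input (hN : 0 < N) (k : ℕ) {z : ℤ} (hz : z ∈ T.input k) :
    bitSize z ≤ T.size + k + 1 := by
  simp only [input, List.mem_cons, List.mem_flatMap, List.mem_finRange, true_and,
    List.not_mem_nil, or_false] at hz
  rcases hz with rfl | rfl | rfl | ⟨i, rfl | ⟨j, rfl | rfl⟩⟩
  · have := bitSize_le_natAbs_add_one (k : ℤ); omega
  · have := bitSize_le_natAbs_add_one (n : ℤ); have := T.dim_le_size hN; omega
  · have := bitSize_le_natAbs_add_one (N : ℤ); have := T.card_le_size; omega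
  · have := T.size_ge i; omega
  · have := T.size_ge_coord i j; omega
  · have := T.size_ge_coord i j; omega

/-- The first three entries are numbers of rounds, so their values have to be bounded. Every number
takes at least one bit, hence N and, as there is at least one datum, also n are at most the size of
the dataset. -/
theorem natAbs_input_le (hN : 0 < N) (k : ℕ) {i : ℕ} (hi : i < 3) :
    ((T.input k).getD i 0).natAbs ≤ T.size + k + 1 := by
  have h1 := T.dim_le_size hN
  have h2 := T.card_le_size
  interval_cases i
  · exact (le_of_eq (Int.natAbs_natCast k)).trans (by omega)
  · exact (le_of_eq (Int.natAbs_natCast n)).trans (by omega)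
  · exact (le_of_eq (Int.natAbs_natCast N)).trans (by omega)

end RatData

theorem memorizer_congr {n N k : ℕ} {w w' m Y : ℕ → ℤ} (h : ∀ j < n, w j = w' j) :
    memorizer n N k w m Y = memorizer n N k w' m Y := by
  rw [memorizer, memorizer, memoNet, memoNet]
  congr 1
  funext i j
  rw [h j j.2]

namespace MachineInput

/-- The input for the dataset `T`, where the tosses `ω` are used. -/
noncomputable def ofTosses {n N : ℕ} (T : RatData n N) (k : ℕ) (hT : IsDataset T.toReal) (ω : ℕ → Bool) : MachineInput where
  n := n
  N := N
  T := T
  k := k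
  C := coinArray ω (k * n * precision n N (coords T.toReal) (labels T.toReal))
  C_nonneg i := by
    unfold coinArray
    split_ifs <;> norm_num
  isDataset := hT

variable {n N : ℕ} {T : RatData n N} {k : ℕ} {hT : IsDataset T.toReal}
  {ω : ℕ → Bool}

theorem tryWeights_ofTosses {r j : ℕ} (hr : r < k) (hj : j < n) :
    (ofTosses T k hT ω).tryWeights r j =
      coinWeights n (precision n N (coords T.toReal) (labels T.toReal)) ω r j := by
  refine Finset.sum_congr rfl fun b hb => congrArg _ ?_
  have hb : b < precision n N (coords T.toReal) (labels T.toReal) := Finset.mem_range.1 hb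
  change coinArray ω (k * n * precision n N (coords T.toReal) (labels T.toReal))
    (r * (n * (precision n N (coords T.toReal) (labels T.toReal) : ℕ)) +
      j * (precision n N (coords T.toReal) (labels T.toReal) : ℕ) + b) = _
  generalize precision n N (coords T.toReal) (labels T.toReal) = q at hb ⊢
  have h1 : (r * (n * q) + j * q + b : ℤ) = ((r * (n * q) + j * q + b : ℕ) : ℤ) := by push_cast; rfl
  have h2 : r * (n * q) + j * q + b < k * n * q := by
    have h3 : (r + 1) * (n * q) ≤ k * (n * q) := Nat.mul_le_mul_right _ hr
    have h4 : (j + 1) * q ≤ n * q := Nat.mul_le_mul_right _ hj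
    rw [add_mul, one_mul] at h3 h4
    rw [mul_assoc]
    omega
  rw [coinArray, h1, if_pos ⟨Int.natCast_nonneg _, by exact_mod_cast h2⟩, Int.toNat_natCast]

/-- If one of the first k tries succeeds, then the first success of the machine, which sees only the
tosses of these tries, is the first success of the algorithm. -/
theorem toReal_ofTosses (h : ¬ ∀ r < k, BadTry n N (coords T.toReal) (labels T.toReal) r ω) :
    (memorizer n N (ofTosses T k hT ω).bits (ofTosses T k hT ω).firstWeights
      (ofTosses T k hT ω).firstProj (ofTosses T k hT ω).Y).toReal =
      learner ω n N T.toReal := by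
  classical
  have h1 : ∃ r, r < k ∧ ¬ BadTry n N (coords T.toReal) (labels T.toReal) r ω := by
    push Not at h
    exact h
  obtain ⟨hr, hgood⟩ := Nat.find_spec h1
  set r := Nat.find h1
  have hbad : ∀ i < r, BadTry n N (coords T.toReal) (labels T.toReal) i ω := fun i hi => by
    by_contra hb
    exact Nat.find_min h1 hi ⟨hi.trans hr, hb⟩
  have hproj : ∀ i < k, proj n (coords T.toReal) ((ofTosses T k hT ω).tryWeights i) =
      proj n (coords T.toReal)
        (coinWeights n (precision n N (coords T.toReal) (labels T.toReal)) ω i) :=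
    fun i hi => proj_congr fun j hj => tryWeights_ofTosses hi hj
  have hf : (ofTosses T k hT ω).failures = r := by
    refine failures_eq _ hr ?_ fun i hi => ?_
    · change defect N _ (proj n (coords T.toReal) _) = 0
      rw [hproj r hr]
      exact not_not.1 hgood
    · change defect N _ (proj n (coords T.toReal) _) ≠ 0
      rw [hproj i (hi.trans hr)]
      exact hbad i hi
  have hw := weights_eq hbad hgood
  rw [learner, ratLearner, hw, firstProj, firstWeights, hf, ← hproj r hr]
  exact congrArg _ (memorizer_congr fun j hj => tryWeights_ofTosses hr hj)

end MachineInput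

/-- The scope without variables. -/
def Scope.base : Scope MachineInput := ⟨id, fun _ => True, 0, fun _ _ => 0⟩

/-- The bound on the time holds for all tosses. When all k tries fail, the program halts as well,
but nothing is claimed about its output. -/
theorem exists_learner_prog : ∃ (P : Prog) (d : ℕ), ∀ (n N : ℕ) (T : RatData n N) (k : ℕ),
    0 < N → IsDataset T.toReal → ∀ ω, ∃ (t : ℕ) (s : MachineState),
      Exec ω P (initState (T.input k)) t s ∧ t ≤ (T.size + k + 3) ^ d ∧
      ((¬ ∀ r < k, BadTry n N (coords T.toReal) (labels T.toReal) r ω) →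
        ∃ F : Network ℚ n, s.HasOutput F.encode ∧ F.toReal = learner ω n N T.toReal) := by
  obtain ⟨c, hcount, hc, hce⟩ := ((Scope.isCount_k (S := Scope.base)).mul Scope.isCount_n).mul
    Scope.isCount_bits
  obtain ⟨l, hl, hle⟩ := Scope.isList_encode (S := Scope.base)
  obtain ⟨P, B, ⟨d, hd⟩, hP⟩ := exists_prog hcount hc hl
  refine ⟨P, d, fun n N T k hN hT ω => ?_⟩
  obtain ⟨s, ⟨t, ht, hexec⟩, hs⟩ := hP (T.size + k + 1) ω (T.input k)
    (fun z hz => T.bitSize_le_of_mem_input hN k hz) fun i hi => T.natAbs_input_le hN k hi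
  refine ⟨t, s, hexec, ht.trans (hd _), fun h => ⟨_, ?_, MachineInput.toReal_ofTosses h
    (hT := hT)⟩⟩
  -- The number of tosses, k blocks of n weights with `bits` digits, is computed before the tosses;
  -- therefore the coin array is 0 here.
  have h1 := hce ⟨n, N, T, k, fun _ => 0, fun _ => le_rfl, hT⟩ (fun _ => 0) trivial
    fun i hi => absurd hi (Nat.not_lt_zero i)
  have h2 := hle (MachineInput.ofTosses T k hT ω) (fun _ => 0) trivial
    fun i hi => absurd hi (Nat.not_lt_zero i)
  change c.eval (inputArray (T.input k)) (fun _ => 0) _ = _ at h1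
  rw [h1, Int.toNat_natCast] at hs
  exact (congrArg s.HasOutput h2).mp hs

theorem half_pow_ceil_logb_le {ε : ℝ} (hε : 0 < ε) :
    (1 / 2 : ℝ) ^ ⌈Real.logb 2 (1 / ε)⌉₊ ≤ ε := by
  have h1 : Real.logb 2 (1 / ε) ≤ (⌈Real.logb 2 (1 / ε)⌉₊ : ℕ) := Nat.le_ceil _
  rw [Real.logb_le_iff_le_rpow one_lt_two (by positivity), Real.rpow_natCast] at h1
  rw [div_pow, one_pow, div_le_iff₀ (by positivity)]
  rw [div_le_iff₀ hε] at h1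
  linarith

theorem ceil_logb_le {x : ℝ} (hx : 1 < x) :
    ((⌈Real.logb 2 x⌉₊ : ℕ) : ℝ) ≤ 2 * Real.log x + 1 := by
  have h0 : 0 < Real.log x := Real.log_pos hx
  have h2 : (1 / 2 : ℝ) < Real.log 2 := by linarith [Real.log_two_gt_d9]
  have h1 := (Nat.ceil_lt_add_one (Real.logb_nonneg one_lt_two hx.le)).le
  have h3 : Real.logb 2 x ≤ 2 * Real.log x := by
    rw [Real.logb, div_le_iff₀ (by linarith)]
    nlinarith
  linarith

theorem mainTheorem6 :
    ∃ (C : ℝ) (L : (ℕ → Bool) → LearningMap),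
      (∀ ω, IsMemorizationAlgorithm (L ω)) ∧
      (∀ (n N : ℕ) (c : ℝ) (D : Measure (LabelledPoint n)),
        0 < n → 0 < N → 0 < c → IsSeparatedDistribution n c D →
        ∀ᵐ s ∂(Measure.pi fun _ : Fin N => D), ∀ ω,
          (L ω n N s).width = 6 ∧
          ((L ω n N s).depth : ℝ) ≤
            C * (Real.sqrt N * Real.log (max 2 ((N : ℝ) * n / c))) ∧
          ((L ω n N s).numParams : ℝ) ≤
            7 * n + C * (Real.sqrt N * Real.log (max 2 ((N : ℝ) * n / c)))) ∧
      ∃ (P : Prog) (p : MvPolynomial (Fin 2) ℝ),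
        ∀ (n N : ℕ) (T : RatData n N) (ε : ℝ),
          0 < n → 0 < N → IsDataset T.toReal → 0 < ε → ε < 1 →
          (∀ ω, ∃ (t : ℕ) (s : MachineState),
            Exec ω P (initState (T.input ⌈Real.logb 2 (1 / ε)⌉₊)) t s ∧
            (t : ℝ) ≤ MvPolynomial.eval ![(T.size : ℝ), Real.log (1 / ε)] p) ∧
          coinMeasure {ω | ¬ ∃ (t : ℕ) (s : MachineState) (F : Network ℚ n),
            Exec ω P (initState (T.input ⌈Real.logb 2 (1 / ε)⌉₊)) t s ∧
            s.HasOutput F.encode ∧ F.toReal = L ω n N T.toReal} ≤ ENNReal.ofReal ε := by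
  obtain ⟨P, d, hP⟩ := exists_learner_prog
  refine ⟨40000, learner, isMemorizationAlgorithm_learner, fun n N c D hn hN hc hD => ?_, P,
    -- The number of tries is at most 2 ln(1/ε) + 1, which turns size + k + 3 into this linear form.
    (.X 0 + .C 2 * .X 1 + .C 4) ^ d, fun n N T ε hn hN hT hε hε1 => ⟨fun ω => ?_, ?_⟩⟩
  · filter_upwards [hD.ae_separated_sample] with s hs ω
    exact learner_size hn hN hc hs.1 hs.2 ω
  · obtain ⟨t, s, hexec, ht, -⟩ := hP n N T _ hN hT ω
    refine ⟨t, s, hexec, ?_⟩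
    have h1 : (1 : ℝ) < 1 / ε := by rwa [lt_div_iff₀ hε, one_mul]
    have h2 := ceil_logb_le h1
    have h3 : (t : ℝ) ≤ ((T.size : ℝ) + (⌈Real.logb 2 (1 / ε)⌉₊ : ℕ) + 3) ^ d := by
      exact_mod_cast ht
    simp only [map_pow, map_add, map_mul, MvPolynomial.eval_X, MvPolynomial.eval_C,
      Matrix.cons_val_zero, Matrix.cons_val_one]
    exact h3.trans (pow_le_pow_left₀ (by positivity) (by linarith) d)
  -- A wrong output is possible only if all tries of the program fail.
  · refine (measure_mono (t := {ω | ∀ r < ⌈Real.logb 2 (1 / ε)⌉₊,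
      BadTry n N (coords T.toReal) (labels T.toReal) r ω}) fun ω hω => ?_).trans ?_
    · by_contra h
      obtain ⟨t, s, hexec, -, hs⟩ := hP n N T _ hN hT ω
      obtain ⟨F, hF, hF'⟩ := hs h
      exact hω ⟨t, s, F, hexec, hF, hF'⟩
    · rw [← ofReal_measureReal]
      exact ENNReal.ofReal_le_ofReal
        ((measure_forall_badTry_le hn hT.separated _).trans (half_pow_ceil_logb_le hε))
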